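/- **Conventions.** A partition is identified with its Young diagram, the set of boxes $(i,j)$ with $1\le j\le\ell(\lambda)$ (the row) and $1\le i\le\lambda_j$ (the column); row $j+1$ lies above row $j$. For a box $\square=(i,j)$ of $\lambda$ its arm is $a(\square)=\lambda_j-i$, its leg $\ell(\square)$ is the number of boxes above it in its column, and its coleg is $\ell'(\square)=j-1$. For partitions $\lambda^1,\dots,\lambda^r$ ($r\ge1$) and $B\subseteq[r]=\{1,\dots,r\}$ let $\lambda^B=\bigoplus_{b\in B}\lambda^b$ be the entry-wise sum. The Macdonald polynomial is $\tilde H_\lambda(\boldsymbol x;q,t)=\sum_{\sigma:\lambda\to\mathbb N_+}q^{\mathrm{inv}(\sigma)}t^{\mathrm{maj}(\sigma)}\boldsymbol x^\sigma$, where $\mathrm{Des}(\sigma)$ is the set of boxes whose entry exceeds that of the box immediately below, $\mathrm{maj}(\sigma)=\sum_{\square\in\mathrm{Des}(\sigma)}(\ell(\square)+1)$, and $\mathrm{inv}(\sigma)=\#\mathrm{Inv}(\sigma)-\sum_{\square\in\mathrm{Des}(\sigma)}a(\square)$. Here $\mathrm{Inv}(\sigma)$ is the set of pairs $(\square,\square')$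 of boxes with $\sigma(\square)>\sigma(\square')$ such that $\square$ precedes $\square'$ in the reading order (row by row from top to bottom, left to right in each row) and the two boxes are in the same row, or in consecutive rows with the upper one strictly to the right of the lower one. The Macdonald cumulant is $$\kappa(\lambda^1,\dots,\lambda^r)=(q-1)^{1-r}\sum_{\pi}(-1)^{\#\pi-1}(\#\pi-1)!\prod_{B\in\pi}\tilde H_{\lambda^B},$$ the sum being over all set partitions $\pi$ of $[r]$. The plethystic evaluation $f[1-u]$ of a symmetric function $f$ is obtained by writing $f$ as a polynomial in the power sums $p_k$ over $\mathbb Q(q,t)$ and substituting $p_k\mapsto1-u^k$. The multivariate $q,t$-Kostka numbers $\widetilde K_{\mu;\lambda^1,\dots,\lambda^r}(q,t)$ are defined by $\kappa(\lambda^1,\dots,\lambda^r)=\sum_\mu\widetilde K_{\mu;\lambda^1,\dots,\lambda^r}(q,t)\,s_\mu$. The columns of $\lambda^{[r]}$ are the columns of $\lambda^1,\dots,\lambda^r$ sorted by decreasing length, those of equal length being ordered by the index of the partition they come from; a box of $\lambda^{[r]}$ has colour $b$ if its column comes from $\lambda^b$. For boxes $\square_1,\dots,\square_s$ of $\lambda^{[r]}$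 let $G^{\square_1,\dots,\square_s}_{\lambda^1,\dots,\lambda^r}$ be the multigraph (loops allowed) with vertex set $[r]$ in which the number of edges linking $i$ and $j$ (possibly $i=j$) is the number of pairs $(\square_k,\square')$ such that $\square'$ lies in the same row as $\square_k$, to its left, and the set of the colours of the two boxes is $\{i,j\}$. For a multigraph $G$ on $[r]$ with $e_{i,j}$ edges linking $i$ and $j$, let $\tilde G$ be the graph obtained by replacing multiple edges by single ones, and $$\mathcal I_G(q)=q^{\#\text{loops of }G}\sum_{T}q^{\kappa(T)}\prod_{\{i,j\}\in T}[e_{i,j}]_q,\qquad \kappa(T)=\sum_{(i,j)}e_{\mathrm{parent}(i),j},$$ where $T$ runs over the spanning trees of $\tilde G$ rooted at the vertex $1$, $(i,j)$ runs over the pairs of non-root vertices with $i$ an ancestor of $j$ in $T$, $i>j$, and $j$ adjacent in $G$ to the parent of $i$, and $[n]_q=1+q+\dots+q^{n-1}$. (So $\mathcal I_G=0$ if $G$ is not connected.) **Theorem.** Let $\lambda^1,\dots,\lambda^r$ ($r\ge1$) be partitions with $|\lambda^{[r]}|=n$. Then $\kappa(\lambda^1,\dots,\lambda^r)$ is a symmetric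 function: it is a polynomial in the power sums, and a finite linear combination of Schur functions, over $\mathbb Q(q,t)$. For every integer $s\ge0$ the coefficient of $(-u)^s$ in $\kappa(\lambda^1,\dots,\lambda^r)[1-u]$ is $$\kappa(\lambda^1,\dots,\lambda^r)[1-u]\big|_{(-u)^s}=\sum_{\{\square_1,\dots,\square_s\}\subset\lambda^{[r]}}\mathcal I_{G^{\square_1,\dots,\square_s}_{\lambda^1,\dots,\lambda^r}}(q)\;t^{\sum_{1\le i\le s}\ell'_{\lambda^{[r]}}(\square_i)},$$ the sum being over the $s$-element subsets of boxes. Equivalently, for every integer $0\le s<n$ the multivariate $q,t$-Kostka number of the hook $(n-s,1^s)$ is $$\widetilde K_{(n-s,1^s);\lambda^1,\dots,\lambda^r}(q,t)=\sum_{\{\square_1,\dots,\square_s\}\subset\lambda^{[r]}\setminus(1,1)}\mathcal I_{G^{\square_1,\dots,\square_s}_{\lambda^1,\dots,\lambda^r}}(q)\;t^{\sum_{1\le i\le s}\ell'_{\lambda^{[r]}}(\square_i)}.$$ In particular it is a polynomial in $q,t$ with nonnegative integer coefficients. -/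

import Mathlib

/-!
Partitions are Mathlib's Young diagrams. A box is `c = (i, j)` with `i` the row index and `j` the
column index, both counted from `0`; row `0` is the longest row and "above" means "larger row
index" (so the box called `(1,1)` in 1-based notation is `(0, 0)`). The variables of symmetric
functions are `x_k`, `k : ℕ`, and correspondingly entries of fillings and tableaux are natural
numbers (only the order of the letters matters).
-/

noncomputable section

namespace MacdonaldCumulant

/-! ### Coefficients -/

/-- The field `ℚ(q,t)`. -/
abbrev QT : Type := FractionRing (MvPolynomial (Fin 2) ℚ)

/-- The indeterminate `q`. -/
def q : QT := algebraMap (MvPolynomial (Fin 2) ℚ) QT (MvPolynomial.X 0)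

/-- The indeterminate `t`. -/
def t : QT := algebraMap (MvPolynomial (Fin 2) ℚ) QT (MvPolynomial.X 1)

/-- The inclusion `ℕ[q,t] → ℚ(q,t)`. -/
def natPoly : MvPolynomial (Fin 2) ℕ →+* QT :=
  (algebraMap (MvPolynomial (Fin 2) ℚ) QT).comp (MvPolynomial.map (Nat.castRingHom ℚ))

/-! ### Symmetric functions, as formal power series in `x_0, x_1, …` over `ℚ(q,t)` -/

/-- Formal power series in countably many variables over `ℚ(q,t)`. -/
abbrev Series : Type := MvPowerSeries ℕ QT

open Classical in
/-- The power sum `p_k = ∑_j x_j ^ k`, for `k ≥ 1`. -/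
def powerSum (k : ℕ+) : Series :=
  fun m => if ∃ j : ℕ, m = Finsupp.single j (k : ℕ) then 1 else 0

/-- The symmetric function given by a polynomial in the power sums. -/
def ofPowerSums : MvPolynomial ℕ+ QT →ₐ[QT] Series :=
  MvPolynomial.aeval powerSum

/-- The plethystic evaluation at `1 - u` of a polynomial in the power sums:
`p_k[1 - u] = 1 - u ^ k`, with values in `ℚ(q,t)[u]`. -/
def plethOneSubU : MvPolynomial ℕ+ QT →ₐ[QT] Polynomial QT :=
  MvPolynomial.aeval fun k : ℕ+ => 1 - Polynomial.X ^ (k : ℕ)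

/-- The exponent vector of the monomial `x^T` of a tableau `T`. -/
def tableauContent {μ : YoungDiagram} (T : SemistandardYoungTableau μ) : ℕ →₀ ℕ :=
  ∑ c ∈ μ.cells, Finsupp.single (T c.1 c.2) 1

/-- The Schur function `s_μ = ∑_T x^T`, over semistandard tableaux `T` of shape `μ`. -/
def schur (μ : YoungDiagram) : Series :=
  fun m => (Nat.card {T : SemistandardYoungTableau μ // tableauContent T = m} : QT)

/-- The (finite) linear combination `∑_μ c_μ s_μ`. -/
def schurSum (c : YoungDiagram →₀ QT) : Series :=
  c.sum fun μ a => a • schur μ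

/-- The hook `(n - s, 1^s)`, for `s < n`. -/
def hook (n s : ℕ) (h : s < n) : YoungDiagram :=
  YoungDiagram.ofRowLens ((n - s) :: List.replicate s 1) (by
    apply List.Pairwise.sortedGE
    simp only [List.pairwise_cons, List.mem_replicate, List.pairwise_replicate]
    exact ⟨fun a ha => by omega, Or.inr le_rfl⟩)

/-! ### Fillings and Macdonald polynomials -/

/-- Fillings of (the boxes of) a diagram. -/
abbrev Filling (μ : YoungDiagram) : Type := {c // c ∈ μ.cells} → ℕ

/-- Arm-length of a box of `μ`. -/
def arm (μ : YoungDiagram) (c : ℕ × ℕ) : ℕ := μ.rowLen c.1 - (c.2 + 1)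

/-- Leg-length of a box of `μ`. -/
def leg (μ : YoungDiagram) (c : ℕ × ℕ) : ℕ := μ.colLen c.2 - (c.1 + 1)

/-- Coleg-length of a box. -/
def coleg (c : ℕ × ℕ) : ℕ := c.1

open Classical in
/-- The descents of `σ`: boxes whose entry exceeds the entry of the box immediately below. -/
def descents {μ : YoungDiagram} (σ : Filling μ) : Finset {c // c ∈ μ.cells} :=
  Finset.univ.filter fun u => ∃ v : {c // c ∈ μ.cells},
    u.1.1 = v.1.1 + 1 ∧ u.1.2 = v.1.2 ∧ σ v < σ u

/-- The major index. -/
def maj {μ : YoungDiagram} (σ : Filling μ) : ℕ :=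
  ∑ u ∈ descents σ, (leg μ u + 1)

/-- `v` is in the row of `u`, or in the row just below that of `u` and strictly to the left. -/
def AttacksDown (u v : ℕ × ℕ) : Prop :=
  (u.1 = v.1 ∧ u ≠ v) ∨ (u.1 = v.1 + 1 ∧ v.2 < u.2)

/-- Two boxes attack each other: same row, or consecutive rows with the upper box strictly to the
right of the lower one. -/
def Attack (u v : ℕ × ℕ) : Prop := AttacksDown u v ∨ AttacksDown v u

/-- `u` precedes `v` in the reading order: row by row, top to bottom, left to right. -/
def Precedes (u v : ℕ × ℕ) : Prop := v.1 < u.1 ∨ (u.1 = v.1 ∧ u.2 < v.2)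

open Classical in
/-- The inversions of `σ`. -/
def inversions {μ : YoungDiagram} (σ : Filling μ) :
    Finset ({c // c ∈ μ.cells} × {c // c ∈ μ.cells}) :=
  Finset.univ.filter fun p =>
    Attack p.1.1 p.2.1 ∧ Precedes p.1.1 p.2.1 ∧ σ p.2 < σ p.1

/-- The statistic `inv(σ) = #Inv(σ) - ∑_{u ∈ Des(σ)} a(u)`. -/
def inv {μ : YoungDiagram} (σ : Filling μ) : ℤ :=
  ((inversions σ).card : ℤ) - ∑ u ∈ descents σ, (arm μ u : ℤ)

/-- The exponent vector of `x^σ`. -/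
def content {μ : YoungDiagram} (σ : Filling μ) : ℕ →₀ ℕ :=
  ∑ u, Finsupp.single (σ u) 1

open Classical in
/-- The (transformed) Macdonald polynomial `∑_σ q^inv(σ) t^maj(σ) x^σ` over all fillings `σ`.
Its coefficient at `x^m` is the sum over the finitely many fillings `σ` with `x^σ = x^m`; these
have all their entries in the support of `m`. -/
def macdonald (μ : YoungDiagram) : Series :=
  fun m => ∑ σ ∈ (Fintype.piFinset fun _ : {c // c ∈ μ.cells} => m.support).filter
      (fun σ => content σ = m), q ^ inv σ * t ^ maj σ

/-! ### Cumulants -/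

/-- The joint cumulant `∑_π (-1)^(#π-1) (#π-1)! ∏_{B ∈ π} u_B` over set partitions `π` of `J`. -/
def cumulant {A J : Type*} [CommRing A] [Fintype J] [DecidableEq J] (u : Finset J → A) : A :=
  ∑ π : Finpartition (Finset.univ : Finset J),
    (-1) ^ (π.parts.card - 1) * ((π.parts.card - 1).factorial : A) * ∏ B ∈ π.parts, u B

/-- The entry-wise sum `λ^B = ⨁_{b ∈ B} λ^b`: the diagram whose `i`-th row has length
`∑_{b ∈ B} λ^b_i`. -/
def oplus {r : ℕ} (lam : Fin r → YoungDiagram) (B : Finset (Fin r)) : YoungDiagram where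
  cells := (Finset.range (B.sup fun b => (lam b).colLen 0) ×ˢ
      Finset.range (∑ b ∈ B, (lam b).rowLen 0)).filter
    fun c => c.2 < ∑ b ∈ B, (lam b).rowLen c.1
  isLowerSet := by
    rintro ⟨i, j⟩ ⟨i', j'⟩ ⟨hi, hj⟩ h
    simp only [Finset.coe_filter, Finset.mem_product, Finset.mem_range, Set.mem_ofPred_eq] at h ⊢
    simp only at hi hj
    refine ⟨⟨lt_of_le_of_lt hi h.1.1, lt_of_le_of_lt hj h.1.2⟩, ?_⟩
    exact lt_of_le_of_lt hj (lt_of_lt_of_le h.2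
      (Finset.sum_le_sum fun b _ => (lam b).rowLen_anti _ _ hi))

theorem mem_oplus {r : ℕ} (lam : Fin r → YoungDiagram) (B : Finset (Fin r)) (i j : ℕ) :
    (i, j) ∈ oplus lam B ↔ j < ∑ b ∈ B, (lam b).rowLen i := by
  rw [← YoungDiagram.mem_cells]
  simp only [oplus, Finset.mem_filter, Finset.mem_product, Finset.mem_range]
  refine ⟨fun h => h.2, fun h => ⟨⟨?_, ?_⟩, h⟩⟩
  · have hne : ∑ b ∈ B, (lam b).rowLen i ≠ 0 := by omega
    obtain ⟨b, hb, hb0⟩ := Finset.exists_ne_zero_of_sum_ne_zero hne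
    refine (Finset.lt_sup_iff).2 ⟨b, hb, ?_⟩
    rw [← YoungDiagram.mem_iff_lt_colLen, YoungDiagram.mem_iff_lt_rowLen]
    omega
  · exact lt_of_lt_of_le h
      (Finset.sum_le_sum fun b _ => (lam b).rowLen_anti _ _ (Nat.zero_le i))

/-- The diagram `λ^{[r]} = λ^1 ⊕ ⋯ ⊕ λ^r`. -/
def total {r : ℕ} (lam : Fin r → YoungDiagram) : YoungDiagram := oplus lam Finset.univ

/-- The Macdonald cumulant `κ(λ^1, …, λ^r)`, that is the joint cumulant of the Macdonald
polynomials `H_{λ^B}`, `B ⊆ [r]`, divided by `(q - 1)^(r - 1)`. -/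
def macdonaldCumulant {r : ℕ} (lam : Fin r → YoungDiagram) : Series :=
  ((q - 1) ^ (r - 1))⁻¹ • cumulant fun B => macdonald (oplus lam B)

/-! ### Multigraphs and the `G`-inversion polynomial -/

/-- Multigraphs on `V`, loops allowed, given by the number `e s(i, j)` of edges linking `i` and
`j`. -/
abbrev Multigraph (V : Type*) : Type _ := Sym2 V → ℕ

/-- The simple graph obtained by replacing multiple edges with single ones (loops, which lie on no
tree, are dropped). -/
def Multigraph.simplify {V : Type*} (G : Multigraph V) : SimpleGraph V where
  Adj i j := i ≠ j ∧ 0 < G s(i, j)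
  symm := ⟨fun i j h => ⟨h.1.symm, by rw [Sym2.eq_swap]; exact h.2⟩⟩
  loopless := ⟨fun _ h => h.1 rfl⟩

/-- In the tree `T` rooted at `root`, `i` is an ancestor of `j`: it lies on the path from `j` to
the root, and `i ≠ j`. -/
def IsAncestor {V : Type*} (T : SimpleGraph V) (root i j : V) : Prop :=
  i ≠ j ∧ ∃ p : T.Walk j root, p.IsPath ∧ i ∈ p.support

/-- `p` is the parent of `i` in the tree `T` rooted at `root`. -/
def IsParent {V : Type*} (T : SimpleGraph V) (root p i : V) : Prop :=
  IsAncestor T root p i ∧ T.Adj p i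

open Classical in
/-- `κ(T)`: the sum of `e_{parent(i), j}` over the `κ`-inversions `(i, j)` of the tree `T`, i.e.
over `i, j` with `i` an ancestor of `j` other than the root, `i > j`, and `j` adjacent in `G` to
the parent of `i`. The sum runs over triples `(parent(i), i, j)`. The root is the smallest
vertex. -/
def kappaStat {r : ℕ} [NeZero r] (G : Multigraph (Fin r)) (T : SimpleGraph (Fin r)) : ℕ :=
  ∑ x ∈ (Finset.univ : Finset (Fin r × Fin r × Fin r)).filter
      (fun x => IsParent T 0 x.1 x.2.1 ∧ IsAncestor T 0 x.2.1 x.2.2 ∧ x.2.2 < x.2.1 ∧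
        0 < G s(x.1, x.2.2)),
    G s(x.1, x.2.2)

/-- `[n]_q = 1 + q + ⋯ + q^(n-1)`. -/
def qInt (n : ℕ) : Polynomial ℕ := ∑ k ∈ Finset.range n, Polynomial.X ^ k

open Classical in
/-- The `G`-inversion polynomial
`I_G(q) = q^(number of loops) ∑_T q^κ(T) ∏_{{i,j} ∈ T} [e_{i,j}(G)]_q`, the sum being over the
spanning trees `T` of the simplification of `G`. It is `0` when `G` is not connected. -/
def inversionPoly {r : ℕ} [NeZero r] (G : Multigraph (Fin r)) : Polynomial ℕ :=
  Polynomial.X ^ (∑ i : Fin r, G s(i, i)) *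
    ∑ T ∈ (Finset.univ : Finset (SimpleGraph (Fin r))).filter
        (fun T => T ≤ G.simplify ∧ T.IsTree),
      Polynomial.X ^ kappaStat G T * ∏ e ∈ T.edgeFinset, qInt (G e)

/-! ### Coloured columns and the graph of a set of boxes -/

/-- All columns `(b, k)` of all the diagrams `λ^b`. -/
abbrev Column {r : ℕ} (lam : Fin r → YoungDiagram) : Type := (b : Fin r) × Fin ((lam b).rowLen 0)

/-- The length of a column. -/
def Column.length {r : ℕ} {lam : Fin r → YoungDiagram} (x : Column lam) : ℕ :=
  (lam x.1).colLen x.2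

/-- The order in which the columns of `λ^1, …, λ^r` are placed in `λ^{[r]}`: by decreasing length,
columns of equal length being ordered by colour, and inside one colour as in `λ^b`. -/
def Column.Before {r : ℕ} {lam : Fin r → YoungDiagram} (x y : Column lam) : Prop :=
  y.length < x.length ∨
    (x.length = y.length ∧ (x.1 < y.1 ∨ (x.1 = y.1 ∧ (x.2 : ℕ) < (y.2 : ℕ))))

open Classical in
/-- The index of the column of `λ^{[r]}` which is identified with the column `x`. -/
def Column.position {r : ℕ} {lam : Fin r → YoungDiagram} (x : Column lam) : ℕ :=
  (Finset.univ.filter fun y : Column lam => y.Before x).card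

/-- The box `c` of `λ^{[r]}` is coloured by `b`: it lies in a column identified with a column of
`λ^b`. -/
def HasColor {r : ℕ} (lam : Fin r → YoungDiagram) (c : ℕ × ℕ) (b : Fin r) : Prop :=
  ∃ x : Column lam, x.1 = b ∧ x.position = c.2

open Classical in
/-- The multigraph of a set `S` of boxes of `λ^{[r]}`: the number of edges linking `i` and `j` is
the number of pairs `(u, v)`, with `u ∈ S` and `v` a box in the same row to the left of `u`, whose
colours are `{i, j}`. -/
def boxGraph {r : ℕ} (lam : Fin r → YoungDiagram) (S : Finset (ℕ × ℕ)) : Multigraph (Fin r) :=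
  fun e => ((S ×ˢ (total lam).cells).filter fun p =>
    p.2.1 = p.1.1 ∧ p.2.2 < p.1.2 ∧
      ∃ a b : Fin r, HasColor lam p.1 a ∧ HasColor lam p.2 b ∧ s(a, b) = e).card

/-- For a set `C` of boxes of `λ^{[r]}`, the polynomial `∑_S I_{G^S}(q) t^(∑_{c ∈ S} coleg(c))` in
`ℕ[q,t]`, the sum being over the `s`-element subsets `S` of `C`. -/
def boxSum {r : ℕ} [NeZero r] (lam : Fin r → YoungDiagram) (C : Finset (ℕ × ℕ)) (s : ℕ) :
    MvPolynomial (Fin 2) ℕ :=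
  ∑ S ∈ C.powersetCard s,
    Polynomial.aeval (MvPolynomial.X 0 : MvPolynomial (Fin 2) ℕ) (inversionPoly (boxGraph lam S)) *
      MvPolynomial.X 1 ^ (∑ c ∈ S, coleg c)

end MacdonaldCumulant

end

/-! At the alphabet `1 - u` everything becomes a product over boxes. A Macdonald polynomial
evaluates to the product of `1 - u q^j t^i` over its boxes `(i, j)` (`plethOneSubU_of_macdonald`). A
Schur function of positive degree evaluates to `(1 - u) (-u)^s` on the hook with `s` boxes above the
bottom row, and to zero on all other shapes (`plethOneSubU_of_schur`, `prod_cells_hook`,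
`eq_hook_or_prod_eq_zero`). The hook coefficients are therefore read off from the value at `1 - u`
after division by `1 - u`. On the box side this factor comes from the corner box, which has coleg
zero and creates no edge (`sum_powerset_eq_mul`).

Plethystic evaluation is a ring homomorphism, so it commutes with cumulants, and only the cumulant
of a product over the boxes of `oplus lam B` has to be computed. These boxes are the boxes of `total
lam` with colour in `B`, the column index being replaced by the number of boxes of such colours to
the left (`prod_oplus_cells`). Expanding over sets `S` of boxes, a set partition contributes, for
each block `B`, the power of `q` whose exponent is the number of edges of `boxGraph lam S` inside
`B` (`prod_blocks_eq_sum_powerset`).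

What remains is a fact on multigraphs: the cumulant of `B ↦ Q ^ (number of edges inside B)` is `(Q -
1)^(r - 1)` times the inversion polynomial (`cumulant_pow_edges`). Both sides obey one recursion.
For a fixed `w` in `U`, the cumulant on `insert v U` is a sum over the sets `B` with `w ∈ B ⊆ U`
(`cumulantOn_insert`), and a tree rooted at `v` is cut along the branch `B` that contains `w`
(`treeSum_insert`). The sum over the possible roots of that branch telescopes to the coefficient of
the cumulant recursion (`sum_geom_telescope`).

The two evaluations follow from one principle for series of fillings weighted by pairs of boxes
(`plethOneSubU_of_pairSeries`). The map `p_k ↦ 1 + N u^k` is polynomial in `N`, and for natural `N`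
it counts fillings with one letter of weight `1` and `N` letters of weight `u`. Adjoining a barred
letter of weight `-u` and one more letter of weight `u` changes nothing, by a sign-reversing
involution. In this form the count extends to `N = -1`, where only `0` and the barred letter are
left and the sum factors over the boxes.

Symmetry of Macdonald polynomials comes from a two-letter identity (`twoLetterSum_comm`), that of
Schur functions from Bender–Knuth involutions. Triangularity (`mem_of_triangular`) then expresses
homogeneous symmetric series through power sums and through Schur functions. -/

noncomputable section

namespace MacdonaldCumulant

/-! ### Two-letter sums -/

section TwoLetter

variable {ι β R : Type*} [DecidableEq ι] [LinearOrder β] [CommRing R]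

/-- The generating function of the words in two letters `b > a` on the positions `S`, the set of
positions of `b` being `A`; each pair `(u, v)` with `b` at `u` and `a` at `v` has weight `z u v`. -/
def twoLetterSum (z : ι → ι → R) (S : Finset ι) (x y : R) : R :=
  ∑ A ∈ S.powerset, x ^ A.card * y ^ (S \ A).card * ∏ u ∈ A, ∏ v ∈ S \ A, z u v

/-- The pairs with nontrivial weight are increasing, and the pairs strictly nested in such a pair
have weight `Q`. -/
def IsStaircase (ρ : ι → β) (z : ι → ι → R) (Q : R) (S : Finset ι) : Prop :=
  ∀ u ∈ S, ∀ v ∈ S, z u v ≠ 1 → ρ u < ρ v ∧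
    ∀ u' ∈ S, ∀ v' ∈ S, ρ u ≤ ρ u' → ρ u' < ρ v' → ρ v' ≤ ρ v → (u' ≠ u ∨ v' ≠ v) → z u' v' = Q

theorem twoLetterSum_eq_of_eq_one (z : ι → ι → R) (S : Finset ι) (x y : R)
    (h : ∀ u ∈ S, ∀ v ∈ S, z u v = 1) : twoLetterSum z S x y = (x + y) ^ S.card := by
  rw [← Finset.sum_pow_mul_eq_add_pow]
  refine Finset.sum_congr rfl fun A hA => ?_
  rw [Finset.mem_powerset] at hA
  rw [Finset.card_sdiff_of_subset hA, Finset.prod_eq_one, mul_one]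
  exact fun u hu => Finset.prod_eq_one fun v hv => h u (hA hu) v (Finset.sdiff_subset hv)

theorem prod_two_letters_insert (z : ι → ι → R) {u v : ι} {A B : Finset ι} (hu : u ∉ A)
    (hv : v ∉ B) : ∏ a ∈ insert u A, ∏ b ∈ insert v B, z a b =
      z u v * ((∏ b ∈ B, z u b) * ∏ a ∈ A, z a v) * ∏ a ∈ A, ∏ b ∈ B, z a b := by
  rw [Finset.prod_insert hu, Finset.prod_insert hv]
  have : ∏ a ∈ A, ∏ b ∈ insert v B, z a b = ∏ a ∈ A, (z a v * ∏ b ∈ B, z a b) :=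
    Finset.prod_congr rfl fun a _ => Finset.prod_insert hv
  rw [this, Finset.prod_mul_distrib]
  ring

/-- Only words with `b` at `u` and `a` at `v` see the weight of `(u, v)`. In these words the
interaction of `u` and `v` with the other positions is the constant `K`, so the correction factors
through the words on the remaining positions. -/
theorem twoLetterSum_update (z : ι → ι → R) (S : Finset ι) {u v : ι} (hu : u ∈ S) (hv : v ∈ S)
    (huv : u ≠ v) (K : R) (hK : ∀ A ⊆ (S.erase u).erase v,
      (∏ b ∈ (S.erase u).erase v \ A, z u b) * ∏ a ∈ A, z a v = K) (x y : R) :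
    twoLetterSum z S x y =
      twoLetterSum (fun a b => if a = u ∧ b = v then 1 else z a b) S x y +
        (z u v - 1) * K * (x * y) * twoLetterSum z ((S.erase u).erase v) x y := by
  set S₀ := (S.erase u).erase v with hS₀
  set z' : ι → ι → R := fun a b => if a = u ∧ b = v then 1 else z a b with hz'
  have hS : S = insert u (insert v S₀) := by
    rw [hS₀, Finset.insert_erase (Finset.mem_erase.2 ⟨huv.symm, hv⟩), Finset.insert_erase hu]
  have hu₀ : u ∉ S₀ := by simp [hS₀]
  have hv₀ : v ∉ S₀ := by simp [hS₀]
  have huS : u ∉ insert v S₀ := by simp [huv, hu₀]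
  have key : ∀ A ∈ S₀.powerset, A ⊆ S₀ ∧ u ∉ A ∧ v ∉ A := fun A hA => by
    rw [Finset.mem_powerset] at hA
    exact ⟨hA, fun h => hu₀ (hA h), fun h => hv₀ (hA h)⟩
  have same : ∀ A B : Finset ι, (u ∉ A ∨ v ∉ B) →
      ∏ a ∈ A, ∏ b ∈ B, z a b = ∏ a ∈ A, ∏ b ∈ B, z' a b := fun A B h =>
    Finset.prod_congr rfl fun a ha => Finset.prod_congr rfl fun b hb => by
      have : ¬ (a = u ∧ b = v) := by
        rintro ⟨rfl, rfl⟩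
        exact h.elim (fun h => h ha) fun h => h hb
      simp [hz', this]
  unfold twoLetterSum
  rw [hS]
  simp only [Finset.sum_powerset_insert huS, Finset.sum_powerset_insert hv₀]
  rw [Finset.mul_sum]
  have e1 : ∀ A ∈ S₀.powerset, insert u (insert v S₀) \ insert u A = insert v (S₀ \ A) := by
    intro A hA
    obtain ⟨h1, h2, h3⟩ := key A hA
    ext w
    simp only [Finset.mem_sdiff, Finset.mem_insert]
    constructor
    · rintro ⟨h | h | h, h'⟩
      · exact absurd (Or.inl h) h'
      · exact Or.inl h
      · exact Or.inr ⟨h, fun hh => h' (Or.inr hh)⟩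
    · rintro (rfl | ⟨h, h'⟩)
      · exact ⟨Or.inr (Or.inl rfl), by rintro (h | h); exacts [huv h.symm, h3 h]⟩
      · exact ⟨Or.inr (Or.inr h), by rintro (rfl | hh); exacts [hu₀ h, h' hh]⟩
  rw [add_assoc, add_assoc, add_assoc]
  simp only [← Finset.sum_add_distrib]
  refine Finset.sum_congr rfl fun A hA => ?_
  obtain ⟨h1, h2, h3⟩ := key A hA
  have hvB : v ∉ S₀ \ A := fun h => hv₀ (Finset.sdiff_subset h)
  rw [e1 A hA, prod_two_letters_insert z h2 hvB, prod_two_letters_insert z' h2 hvB,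
    same A _ (Or.inl h2), same (insert v A) _ (Or.inl (by simp [huv, h2])),
    same (insert u (insert v A)) _ (Or.inr (by simp)), same A (S₀ \ A) (Or.inl h2)]
  have e2 : ∏ b ∈ S₀ \ A, z' u b = ∏ b ∈ S₀ \ A, z u b :=
    Finset.prod_congr rfl fun b hb => by
      have : b ≠ v := fun h => hvB (h ▸ hb)
      simp [hz', this]
  have e3 : ∏ a ∈ A, z' a v = ∏ a ∈ A, z a v :=
    Finset.prod_congr rfl fun a ha => by
      have : a ≠ u := fun h => h2 (h ▸ ha)
      simp [hz', this]
  have e4 : z' u v = 1 := by simp [hz']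
  rw [e2, e3, e4, hK A h1, Finset.card_insert_of_notMem h2, Finset.card_insert_of_notMem hvB]
  ring

/-- Induction on a bound `n` for the number of nontrivial pairs. Removing an outermost pair by
`twoLetterSum_update` leaves two sums with fewer nontrivial pairs, and the coefficient of the second
involves `x` and `y` only through `x * y`. Without nontrivial pairs the sum is a power of `x + y`.
-/
theorem twoLetterSum_comm (ρ : ι → β) (hρ : Function.Injective ρ) (Q : R) (x y : R) :
    ∀ (n : ℕ) (z : ι → ι → R) (S : Finset ι), IsStaircase ρ z Q S →
      (∀ p : Finset (ι × ι), (∀ a ∈ p, a.1 ∈ S ∧ a.2 ∈ S ∧ z a.1 a.2 ≠ 1) → p.card ≤ n) →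
      twoLetterSum z S x y = twoLetterSum z S y x := by
  classical
  intro n
  induction n with
  | zero =>
    intro z S _ hn
    have h : ∀ u ∈ S, ∀ v ∈ S, z u v = 1 := fun u hu v hv => by
      by_contra h
      have := hn {(u, v)} (by simp [hu, hv, h])
      simp at this
    rw [twoLetterSum_eq_of_eq_one z S x y h, twoLetterSum_eq_of_eq_one z S y x h, add_comm]
  | succ n ih =>
    intro z S hz hn
    by_cases hne : ∃ u ∈ S, ∃ v ∈ S, z u v ≠ 1
    swap
    · have h : ∀ u ∈ S, ∀ v ∈ S, z u v = 1 := fun u hu v hv => by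
        by_contra h
        exact hne ⟨u, hu, v, hv, h⟩
      rw [twoLetterSum_eq_of_eq_one z S x y h, twoLetterSum_eq_of_eq_one z S y x h, add_comm]
    -- An outermost pair: `u` is the first left end of a nontrivial pair, and `v` below is the last
    -- partner of `u`.
    obtain ⟨u, huU, humin⟩ := Finset.exists_min_image
      (S.filter fun u => ∃ v ∈ S, z u v ≠ 1) ρ (by
        obtain ⟨u, hu, h⟩ := hne
        exact ⟨u, Finset.mem_filter.2 ⟨hu, h⟩⟩)
    obtain ⟨hu, hu'⟩ := Finset.mem_filter.1 huU
    obtain ⟨v, hvV, hvmax⟩ := Finset.exists_max_image (S.filter fun v => z u v ≠ 1) ρ (by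
      obtain ⟨v, hv, h⟩ := hu'
      exact ⟨v, Finset.mem_filter.2 ⟨hv, h⟩⟩)
    obtain ⟨hv, huv1⟩ := Finset.mem_filter.1 hvV
    obtain ⟨hlt, hnest⟩ := hz u hu v hv huv1
    have huv : u ≠ v := fun h => by simp [h] at hlt
    set S₀ := (S.erase u).erase v with hS₀
    have hS₀S : S₀ ⊆ S := (Finset.erase_subset _ _).trans (Finset.erase_subset _ _)
    have hleft : ∀ b ∈ S₀, z u b = if ρ u < ρ b ∧ ρ b < ρ v then Q else 1 := fun b hb => by
      split_ifs with h
      · exact hnest u hu b (hS₀S hb) le_rfl h.1 h.2.le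
          (Or.inr fun e => by simp [hS₀, e] at hb)
      · by_contra hb1
        refine h ⟨(hz u hu b (hS₀S hb) hb1).1, lt_of_le_of_ne ?_ ?_⟩
        · exact hvmax b (Finset.mem_filter.2 ⟨hS₀S hb, hb1⟩)
        · exact fun e => by simp [hS₀, hρ e] at hb
    have hright : ∀ a ∈ S₀, z a v = if ρ u < ρ a ∧ ρ a < ρ v then Q else 1 := fun a ha => by
      split_ifs with h
      · exact hnest a (hS₀S ha) v hv h.1.le h.2 le_rfl (Or.inl fun e => by simp [hS₀, e] at ha)
      · by_contra hb1
        refine h ⟨lt_of_le_of_ne ?_ ?_, (hz a (hS₀S ha) v hv hb1).1⟩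
        · exact humin a (Finset.mem_filter.2 ⟨hS₀S ha, v, hv, hb1⟩)
        · exact fun e => by simp [hS₀, ← hρ e] at ha
    -- A position strictly between `u` and `v` contributes one factor `Q` in either case: through
    -- its pair with `u` if it carries `a`, through its pair with `v` if it carries `b`. Positions
    -- outside contribute `1`. Hence the product does not depend on `A`.
    have hK : ∀ A ⊆ S₀, (∏ b ∈ S₀ \ A, z u b) * ∏ a ∈ A, z a v =
        ∏ w ∈ S₀, if ρ u < ρ w ∧ ρ w < ρ v then Q else 1 := fun A hA => by
      rw [← Finset.prod_sdiff hA]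
      congr 1
      · exact Finset.prod_congr rfl fun b hb => hleft b (Finset.sdiff_subset hb)
      · exact Finset.prod_congr rfl fun a ha => hright a (hA ha)
    have hcount : ∀ p : Finset (ι × ι), (u, v) ∉ p →
        (∀ a ∈ p, a.1 ∈ S ∧ a.2 ∈ S ∧ z a.1 a.2 ≠ 1) → p.card ≤ n := fun p hp h => by
      have := hn (insert (u, v) p) (fun a ha => by
        rcases Finset.mem_insert.1 ha with rfl | ha
        · exact ⟨hu, hv, huv1⟩
        · exact h a ha)
      rw [Finset.card_insert_of_notMem hp] at this
      omega
    rw [twoLetterSum_update z S hu hv huv _ hK x y, twoLetterSum_update z S hu hv huv _ hK y x,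
      mul_comm y x]
    congr 1
    · apply ih
      · intro a ha b hb hab
        have hne : ¬ (a = u ∧ b = v) := fun h => hab (by simp [h])
        simp only [hne, if_false] at hab
        obtain ⟨h1, h2⟩ := hz a ha b hb hab
        refine ⟨h1, fun u' hu' v' hv' huu' huv' hvv' hne' => ?_⟩
        -- By extremality `(u, v)` is not strictly nested in another nontrivial pair, so resetting
        -- its weight to `1` preserves the staircase condition.
        have : ¬ (u' = u ∧ v' = v) := by
          rintro ⟨rfl, rfl⟩
          have e1 := humin a (Finset.mem_filter.2 ⟨ha, b, hb, hab⟩)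
          have e2 : a = u' := hρ (le_antisymm huu' e1)
          subst e2
          have e3 := hvmax b (Finset.mem_filter.2 ⟨hb, hab⟩)
          exact hne ⟨rfl, hρ (le_antisymm e3 hvv')⟩
        simp only [this, if_false]
        exact h2 u' hu' v' hv' huu' huv' hvv' hne'
      · intro p hp
        refine hcount p (fun h => (hp _ h).2.2 (by simp)) fun a ha => ?_
        obtain ⟨h1, h2, h3⟩ := hp a ha
        refine ⟨h1, h2, ?_⟩
        have : ¬ (a.1 = u ∧ a.2 = v) := fun h => h3 (by simp [h])
        simpa only [this, if_false] using h3
    · congr 1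
      apply ih
      · intro a ha b hb hab
        obtain ⟨h1, h2⟩ := hz a (hS₀S ha) b (hS₀S hb) hab
        exact ⟨h1, fun u' hu' v' hv' => h2 u' (hS₀S hu') v' (hS₀S hv')⟩
      · intro p hp
        refine hcount p (fun h => by simp at hp; exact (hp _ _ h).1.2.1 rfl) fun a ha => ?_
        obtain ⟨h1, h2, h3⟩ := hp a ha
        exact ⟨hS₀S h1, hS₀S h2, h3⟩

/-- The number of `b`'s and the number of `a`'s are symmetrically distributed. -/
theorem sum_powersetCard_two_letters (ρ : ι → β) (hρ : Function.Injective ρ) (Q : R)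
    (z : ι → ι → R) (S : Finset ι) (hz : IsStaircase ρ z Q S) {k l : ℕ} (hkl : k + l = S.card) :
    ∑ A ∈ S.powersetCard k, ∏ u ∈ A, ∏ v ∈ S \ A, z u v =
      ∑ A ∈ S.powersetCard l, ∏ u ∈ A, ∏ v ∈ S \ A, z u v := by
  classical
  have hz' : IsStaircase ρ (fun a b => Polynomial.C (z a b)) (Polynomial.C Q) S :=
    fun u hu v hv h => by
      obtain ⟨h1, h2⟩ := hz u hu v hv fun h' => h (by simp [h'])
      exact ⟨h1, fun u' hu' v' hv' a b c d => congrArg _ (h2 u' hu' v' hv' a b c d)⟩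
  -- With `x = X` and `y = 1`, the exponent of `X` counts the `b`'s on one side and the `a`'s on the
  -- other; coefficients of `X ^ k` are compared.
  have key := twoLetterSum_comm ρ hρ (Polynomial.C Q) (Polynomial.X) 1
    (S ×ˢ S).card _ S hz' fun p hp => Finset.card_le_card fun a ha =>
      Finset.mem_product.2 ⟨(hp a ha).1, (hp a ha).2.1⟩
  have := congrArg (fun p => Polynomial.coeff p k) key
  simp only [twoLetterSum, one_pow, mul_one, one_mul, ← map_prod, Polynomial.finsetSum_coeff,
    Polynomial.X_pow_mul_C, Polynomial.coeff_C_mul, Polynomial.coeff_X_pow, mul_ite,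
    mul_zero] at this
  rw [← Finset.sum_filter, ← Finset.sum_filter] at this
  have e1 : S.powerset.filter (fun A => k = A.card) = S.powersetCard k := by
    ext A
    simp [Finset.mem_powersetCard, eq_comm]
  have e2 : S.powerset.filter (fun A => k = (S \ A).card) = S.powersetCard l := by
    ext A
    simp only [Finset.mem_filter, Finset.mem_powerset, Finset.mem_powersetCard]
    refine and_congr_right fun hA => ?_
    have := Finset.card_sdiff_add_card_eq_card hA
    omega
  rwa [e1, e2] at this

end TwoLetter

/-! ### Generating series of fillings with pair weights -/

section PairWeight

variable {ι : Type*} [Fintype ι]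

/-- The exponent vector of `∏_u x_{σ(u)}`. -/
def exponent (σ : ι → ℕ) : ℕ →₀ ℕ := ∑ u, Finsupp.single (σ u) 1

theorem exponent_apply (σ : ι → ℕ) (k : ℕ) :
    exponent σ k = (Finset.univ.filter fun u => σ u = k).card := by
  simp [exponent, Finsupp.finsetSum_apply, Finsupp.single_apply]

theorem mem_support_exponent (σ : ι → ℕ) (u : ι) : σ u ∈ (exponent σ).support := by
  rw [Finsupp.mem_support_iff, exponent_apply]
  exact Finset.card_ne_zero_of_mem (Finset.mem_filter.2 ⟨Finset.mem_univ u, rfl⟩)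

theorem degree_exponent (σ : ι → ℕ) : (exponent σ).degree = Fintype.card ι := by
  simp [exponent, map_sum, Finsupp.degree_single]

/-- The product of the weights of all pairs of positions. -/
def pairWeight {R : Type*} [CommMonoid R] (c : ι → ι → Bool → R) (σ : ι → ℕ) : R :=
  ∏ u, ∏ v, c u v (decide (σ v < σ u))

open Classical in
/-- The generating series of fillings, weighted by `pairWeight`. -/
def pairSeries (c : ι → ι → Bool → QT) : Series :=
  fun m => ∑ σ ∈ (Fintype.piFinset fun _ : ι => m.support).filter (fun σ => exponent σ = m),
    pairWeight c σ

open Classical in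
theorem filter_exponent_eq (m : ℕ →₀ ℕ) (T : Finset ℕ) (hT : m.support ⊆ T) :
    (Fintype.piFinset fun _ : ι => T).filter (fun σ => exponent σ = m) =
      (Fintype.piFinset fun _ : ι => m.support).filter (fun σ => exponent σ = m) := by
  ext σ
  simp only [Finset.mem_filter, Fintype.mem_piFinset]
  constructor
  · rintro ⟨-, rfl⟩
    exact ⟨mem_support_exponent σ, rfl⟩
  · rintro ⟨h, h'⟩
    exact ⟨fun u => hT (h u), h'⟩

/-- Invariance of a series under the exchange of two adjacent variables. -/
def IsAdjSymmetric (F : Series) : Prop :=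
  ∀ (a : ℕ) (m m' : ℕ →₀ ℕ), m' a = m (a + 1) → m' (a + 1) = m a →
    (∀ k, k ≠ a → k ≠ a + 1 → m' k = m k) → F m = F m'

/-- Raising some letters `a` to the absent letter `a + 1` affects only the comparison of a raised
box with an unraised box carrying `a`. It passes from `false`, of weight `1`, to `true`. -/
theorem pairWeight_raise (c : ι → ι → Bool → QT) (hc : ∀ u v, c u v false = 1) [DecidableEq ι]
    (a : ℕ) (τ : ι → ℕ) (hτ : ∀ u, τ u ≠ a + 1) (A : Finset ι)
    (hA : A ⊆ Finset.univ.filter fun u => τ u = a) :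
    pairWeight c (fun u => if u ∈ A then a + 1 else τ u) = pairWeight c τ *
      ∏ u ∈ A, ∏ v ∈ (Finset.univ.filter fun u => τ u = a) \ A, c u v true := by
  have h1 : ∏ u ∈ A, ∏ v ∈ (Finset.univ.filter fun u => τ u = a) \ A, c u v true =
      ∏ u, ∏ v, if u ∈ A ∧ v ∈ (Finset.univ.filter fun u => τ u = a) \ A
        then c u v true else 1 := by
    rw [← Finset.prod_subset (Finset.subset_univ A)]
    · refine Finset.prod_congr rfl fun u hu => ?_
      rw [← Finset.prod_subset
        (Finset.subset_univ ((Finset.univ.filter fun u => τ u = a) \ A))]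
      · exact Finset.prod_congr rfl fun v hv => by rw [if_pos ⟨hu, hv⟩]
      · exact fun v _ hv => if_neg fun h => hv h.2
    · exact fun u _ hu => Finset.prod_eq_one fun v _ => if_neg fun h => hu h.1
  rw [h1]
  simp only [pairWeight, ← Finset.prod_mul_distrib]
  refine Finset.prod_congr rfl fun u _ => Finset.prod_congr rfl fun v _ => ?_
  simp only [Finset.mem_sdiff, Finset.mem_filter, Finset.mem_univ, true_and]
  have hAu : u ∈ A → τ u = a := fun h => (Finset.mem_filter.1 (hA h)).2
  have hAv : v ∈ A → τ v = a := fun h => (Finset.mem_filter.1 (hA h)).2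
  have hu := hτ u
  have hv := hτ v
  by_cases h1 : u ∈ A <;> by_cases h2 : v ∈ A
  · simp [h1, h2, hAu h1, hAv h2, hc]
  · simp only [if_pos h1, if_neg h2, hAu h1]
    by_cases h3 : τ v = a
    · simp [h1, h2, h3, hc]
    · have : decide (τ v < a + 1) = decide (τ v < a) := by
        rw [decide_eq_decide]
        omega
      simp only [h3, this, if_false, false_and, and_false, mul_one]
  · simp only [if_neg h1, if_pos h2, hAv h2]
    have : decide (a + 1 < τ u) = decide (a < τ u) := by
      rw [decide_eq_decide]
      omega
    simp [h1, this]
  · simp [h1, h2]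

-- A filling amounts to its merging, where `a + 1` is replaced by `a`, together with the set of
-- boxes that carried `a + 1`. The range of the outer sum depends on `m a` and `m (a + 1)` only
-- through their sum. The common alphabet `T` lets two exponent vectors be compared.
open Classical in
theorem pairSeries_eq_sum_merge (c : ι → ι → Bool → QT) (hc : ∀ u v, c u v false = 1)
    (a : ℕ) (m : ℕ →₀ ℕ) (T : Finset ℕ) (hT : m.support ⊆ T) (ha : a ∈ T) (ha' : a + 1 ∈ T) :
    pairSeries c m = ∑ τ ∈ (Fintype.piFinset fun _ : ι => T).filter (fun τ =>
        (∀ u, τ u ≠ a + 1) ∧ exponent τ a = m a + m (a + 1) ∧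
          ∀ k, k ≠ a → k ≠ a + 1 → exponent τ k = m k),
      pairWeight c τ * ∑ A ∈ (Finset.univ.filter fun u => τ u = a).powersetCard (m (a + 1)),
        ∏ u ∈ A, ∏ v ∈ (Finset.univ.filter fun u => τ u = a) \ A, c u v true := by
  simp only [Finset.mul_sum]
  rw [pairSeries, ← filter_exponent_eq m T hT, Finset.sum_sigma']
  refine Finset.sum_bij'
    (fun σ _ => (⟨fun u => if σ u = a + 1 then a else σ u,
      Finset.univ.filter fun u => σ u = a + 1⟩ : (_ : ι → ℕ) × Finset ι))
    (fun x _ => fun u => if u ∈ x.2 then a + 1 else x.1 u) ?_ ?_ ?_ ?_ ?_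
  · intro σ hσ
    simp only [Finset.mem_filter, Fintype.mem_piFinset] at hσ
    obtain ⟨hσ, rfl⟩ := hσ
    simp only [Finset.mem_sigma, Finset.mem_filter, Fintype.mem_piFinset, Finset.mem_powersetCard,
      exponent_apply, and_true]
    refine ⟨⟨fun u => ?_, fun u => ?_, ?_, fun k hk hk' => ?_⟩, fun u hu => ?_⟩
    · split_ifs
      exacts [ha, hσ u]
    · split_ifs with h
      · omega
      · exact h
    · rw [← Finset.card_union_of_disjoint]
      · congr 1
        ext u
        simp only [Finset.mem_filter, Finset.mem_univ, true_and, Finset.mem_union]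
        split_ifs with h <;> omega
      · refine Finset.disjoint_filter.2 fun u _ h h' => ?_
        omega
    · congr 1
      ext u
      simp only [Finset.mem_filter, Finset.mem_univ, true_and]
      split_ifs with h <;> omega
    · simp only [Finset.mem_filter, Finset.mem_univ, true_and] at hu ⊢
      rw [if_pos hu]
  · rintro ⟨τ, A⟩ h
    simp only [Finset.mem_sigma, Finset.mem_filter, Fintype.mem_piFinset, Finset.mem_powersetCard]
      at h
    obtain ⟨⟨hτ, hτ1, hτa, hτk⟩, hA, hAc⟩ := h
    have hA' : ∀ u ∈ A, τ u = a := fun u hu => (Finset.mem_filter.1 (hA hu)).2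
    simp only [Finset.mem_filter, Fintype.mem_piFinset]
    refine ⟨fun u => ?_, Finsupp.ext fun k => ?_⟩
    · split_ifs
      exacts [ha', hτ u]
    rw [exponent_apply]
    by_cases hk' : k = a + 1
    · subst hk'
      rw [← hAc]
      congr 1
      ext u
      simp only [Finset.mem_filter, Finset.mem_univ, true_and]
      split_ifs with h
      · simp [h]
      · simp [h, hτ1 u]
    by_cases hk : k = a
    · subst hk
      have : (Finset.univ.filter fun u => (if u ∈ A then k + 1 else τ u) = k) =
          (Finset.univ.filter fun u => τ u = k) \ A := by
        ext u
        simp only [Finset.mem_filter, Finset.mem_univ, true_and, Finset.mem_sdiff]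
        split_ifs with h
        · simp [h]
        · simp [h]
      rw [this, Finset.card_sdiff_of_subset hA, hAc, ← exponent_apply, hτa]
      omega
    · rw [← hτk k hk hk', exponent_apply]
      congr 1
      ext u
      simp only [Finset.mem_filter, Finset.mem_univ, true_and]
      split_ifs with h
      · rw [hA' u h]
        omega
      · rfl
  · intro σ _
    funext u
    by_cases h : σ u = a + 1 <;> simp [h]
  · rintro ⟨τ, A⟩ h
    simp only [Finset.mem_sigma, Finset.mem_filter, Fintype.mem_piFinset, Finset.mem_powersetCard]
      at h
    obtain ⟨⟨hτ, hτ1, hτa, hτk⟩, hA, hAc⟩ := h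
    have hA' : ∀ u ∈ A, τ u = a := fun u hu => (Finset.mem_filter.1 (hA hu)).2
    have e1 : (fun u => if (if u ∈ A then a + 1 else τ u) = a + 1 then a
        else if u ∈ A then a + 1 else τ u) = τ := by
      funext u
      by_cases h : u ∈ A
      · simp [h, hA' u h]
      · simp [h, hτ1 u]
    have e2 : (Finset.univ.filter fun u => (if u ∈ A then a + 1 else τ u) = a + 1) = A := by
      ext u
      by_cases h : u ∈ A
      · simp [h]
      · simp [h, hτ1 u]
    simp only [e1, e2]
  · intro σ _
    rw [← pairWeight_raise c hc a]
    · congr 1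
      funext u
      by_cases h : σ u = a + 1 <;> simp [h]
    · intro u
      dsimp only
      split_ifs with h
      · omega
      · exact h
    · intro u hu
      simp only [Finset.mem_filter, Finset.mem_univ, true_and] at hu ⊢
      rw [if_pos hu]

theorem IsStaircase.mono {ι β R : Type*} [LinearOrder β] [CommRing R]
    {ρ : ι → β} {z : ι → ι → R} {Q : R} {S S' : Finset ι} (h : IsStaircase ρ z Q S)
    (hS : S' ⊆ S) : IsStaircase ρ z Q S' := fun u hu v hv huv =>
  ⟨(h u (hS hu) v (hS hv) huv).1, fun u' hu' v' hv' =>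
    (h u (hS hu) v (hS hv) huv).2 u' (hS hu') v' (hS hv')⟩

/-- Exchanging the exponents of two adjacent variables keeps the merged fillings and exchanges the
number of raised boxes with that of unraised ones. The inner sums agree by the two-letter symmetry
on the boxes carrying `a`. -/
theorem isAdjSymmetric_pairSeries {β : Type*} [LinearOrder β] (ρ : ι → β)
    (hρ : Function.Injective ρ) (c : ι → ι → Bool → QT) (hc : ∀ u v, c u v false = 1) (Q : QT)
    (hz : IsStaircase ρ (fun u v => c u v true) Q Finset.univ) :
    IsAdjSymmetric (pairSeries c) := by
  classical
  intro a m m' h1 h2 h3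
  set T := insert a (insert (a + 1) (m.support ∪ m'.support)) with hT
  rw [pairSeries_eq_sum_merge c hc a m T (by intro x; simp [hT]; tauto) (by simp [hT])
    (by simp [hT]), pairSeries_eq_sum_merge c hc a m' T (by intro x; simp [hT]; tauto)
    (by simp [hT]) (by simp [hT])]
  refine Finset.sum_congr ?_ fun τ hτ => ?_
  · ext τ
    simp only [Finset.mem_filter, h1, h2]
    refine and_congr_right fun _ => and_congr_right fun _ => and_congr (by rw [add_comm]) ?_
    exact forall_congr' fun k => forall_congr' fun hk => forall_congr' fun hk' => by
      rw [h3 k hk hk']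
  · rw [h2]
    congr 1
    simp only [Finset.mem_filter, h1, h2] at hτ
    refine sum_powersetCard_two_letters ρ hρ Q (fun u v => c u v true) _
      (hz.mono (Finset.subset_univ _)) ?_
    rw [← exponent_apply, hτ.2.2.1]

end PairWeight

/-! ### Symmetric series and triangular families -/

section Symmetric

/-- Homogeneous of degree `n`. -/
def IsHomogeneousOfDegree (n : ℕ) (F : Series) : Prop := ∀ m, F m ≠ 0 → m.degree = n

/-- The exponent vector with the exponents of `x_a` and `x_{a+1}` exchanged. -/
def swapAdj (a : ℕ) (m : ℕ →₀ ℕ) : ℕ →₀ ℕ := m.equivMapDomain (Equiv.swap a (a + 1))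

theorem swapAdj_left (a : ℕ) (m : ℕ →₀ ℕ) : swapAdj a m a = m (a + 1) := by
  simp [swapAdj, Finsupp.equivMapDomain_apply]

theorem swapAdj_right (a : ℕ) (m : ℕ →₀ ℕ) : swapAdj a m (a + 1) = m a := by
  simp [swapAdj, Finsupp.equivMapDomain_apply]

theorem swapAdj_of_ne (a : ℕ) (m : ℕ →₀ ℕ) (k : ℕ) (h : k ≠ a) (h' : k ≠ a + 1) :
    swapAdj a m k = m k := by
  simp [swapAdj, Finsupp.equivMapDomain_apply, Equiv.swap_apply_of_ne_of_ne h h']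

/-- Renaming variables is an algebra homomorphism, so in this form symmetry passes at once to linear
combinations and to polynomial expressions. -/
theorem isAdjSymmetric_iff_rename (F : Series) : IsAdjSymmetric F ↔
    ∀ a : ℕ, MvPowerSeries.rename (Equiv.swap a (a + 1)).toEmbedding F = F := by
  have key : ∀ a m, (MvPowerSeries.rename (Equiv.swap a (a + 1)).toEmbedding F) (swapAdj a m) =
      F m := fun a m => by
    have := MvPowerSeries.coeff_embDomain_rename (Equiv.swap a (a + 1)).toEmbedding F m
    rw [Finsupp.embDomain_eq_mapDomain] at this
    rw [swapAdj, Finsupp.equivMapDomain_eq_mapDomain]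
    exact this
  have inv : ∀ a m, swapAdj a (swapAdj a m) = m := fun a m => by
    ext k
    simp [swapAdj, Finsupp.equivMapDomain_apply]
  constructor
  · intro h a
    funext m
    have h1 := key a (swapAdj a m)
    rw [inv] at h1
    rw [h1]
    exact (h a m _ (swapAdj_left a m) (swapAdj_right a m) (swapAdj_of_ne a m)).symm
  · intro h a m m' h1 h2 h3
    have e : m' = swapAdj a m := by
      ext k
      by_cases hk : k = a
      · rw [hk, h1, swapAdj_left]
      by_cases hk' : k = a + 1
      · rw [hk', h2, swapAdj_right]
      rw [h3 k hk hk', swapAdj_of_ne a m k hk hk']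
    rw [e, ← key a m, h a]

/-- The weight `∑_k k m_k`. -/
def indexWeight : (ℕ →₀ ℕ) →+ ℕ := Finsupp.weight fun k : ℕ => k

theorem indexWeight_single (k e : ℕ) : indexWeight (Finsupp.single k e) = e * k := by
  simp [indexWeight, Finsupp.weight_single]

theorem indexWeight_swapAdj_lt (a : ℕ) (m : ℕ →₀ ℕ) (h : m a < m (a + 1)) :
    indexWeight (swapAdj a m) < indexWeight m := by
  have e1 : ∀ x : ℕ →₀ ℕ, x = (x.erase a).erase (a + 1) + Finsupp.single a (x a) +
      Finsupp.single (a + 1) (x (a + 1)) := fun x => by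
    ext k
    by_cases hk : k = a
    · subst hk
      simp
    by_cases hk' : k = a + 1
    · subst hk'
      simp
    simp [Finsupp.erase_ne hk, Finsupp.erase_ne hk', Ne.symm hk, Ne.symm hk']
  have e2 : ((swapAdj a m).erase a).erase (a + 1) = (m.erase a).erase (a + 1) := by
    ext k
    by_cases hk : k = a
    · subst hk
      simp
    by_cases hk' : k = a + 1
    · subst hk'
      simp
    rw [Finsupp.erase_ne hk', Finsupp.erase_ne hk', Finsupp.erase_ne hk, Finsupp.erase_ne hk,
      swapAdj_of_ne a m k hk hk']
  rw [e1 (swapAdj a m), e2, swapAdj_left, swapAdj_right]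
  conv_rhs => rw [e1 m]
  simp only [map_add, indexWeight_single]
  nlinarith

/-- Exchanging the exponents at an ascent lowers `indexWeight`, so every exponent vector can be
sorted into a partition without changing its coefficient. -/
theorem IsAdjSymmetric.eq_zero {F : Series} (hF : IsAdjSymmetric F)
    (h : ∀ m : ℕ →₀ ℕ, Antitone m → F m = 0) : F = 0 := by
  have key : ∀ (n : ℕ) (m : ℕ →₀ ℕ), indexWeight m = n → F m = 0 := by
    intro n
    induction n using Nat.strong_induction_on with
    | _ n ih =>
      intro m hm
      by_cases hanti : Antitone m
      · exact h m hanti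
      · have : ∃ a, m a < m (a + 1) := by
          by_contra hcon
          push Not at hcon
          exact hanti (antitone_nat_of_succ_le hcon)
        obtain ⟨a, ha⟩ := this
        rw [hF a m _ (swapAdj_left a m) (swapAdj_right a m) (swapAdj_of_ne a m)]
        exact ih _ (hm ▸ indexWeight_swapAdj_lt a m ha) _ rfl
  funext m
  exact key _ m rfl

theorem lt_degree_of_antitone {m : ℕ →₀ ℕ} (hm : Antitone m) {k : ℕ} (hk : m k ≠ 0) :
    k < m.degree := by
  have h1 : ∑ i ∈ Finset.range (k + 1), 1 ≤ ∑ i ∈ Finset.range (k + 1), m i :=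
    Finset.sum_le_sum fun i hi =>
      (Nat.one_le_iff_ne_zero.2 hk).trans (hm (by rw [Finset.mem_range] at hi; omega))
  have h2 : ∑ i ∈ Finset.range (k + 1), m i ≤ m.degree := by
    rw [Finsupp.degree_apply]
    refine (Finset.sum_le_sum_of_ne_zero fun i _ hi => ?_)
    exact Finsupp.mem_support_iff.2 hi
  simp at h1
  omega

open Classical in
/-- The partitions of `n`, as exponent vectors. -/
def antitoneExponents (n : ℕ) : Finset (ℕ →₀ ℕ) :=
  (Finset.finsuppAntidiag (Finset.range n) n).filter fun m => Antitone m

theorem mem_antitoneExponents {n : ℕ} {m : ℕ →₀ ℕ} :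
    m ∈ antitoneExponents n ↔ Antitone m ∧ m.degree = n := by
  simp only [antitoneExponents, Finset.mem_filter, Finset.mem_finsuppAntidiag']
  constructor
  · rintro ⟨⟨h1, h2⟩, h3⟩
    exact ⟨h3, h1⟩
  · rintro ⟨h1, h2⟩
    refine ⟨⟨h2, fun k hk => ?_⟩, h1⟩
    rw [Finset.mem_range, ← h2]
    exact lt_degree_of_antitone h1 (Finsupp.mem_support_iff.1 hk)

theorem IsAdjSymmetric.sub {F G : Series} (hF : IsAdjSymmetric F) (hG : IsAdjSymmetric G) :
    IsAdjSymmetric (F - G) := by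
  rw [isAdjSymmetric_iff_rename] at *
  exact fun a => by rw [map_sub, hF, hG]

theorem IsAdjSymmetric.sum_smul {ι : Type*} {s : Finset ι} {c : ι → QT} {F : ι → Series}
    (hF : ∀ i ∈ s, IsAdjSymmetric (F i)) : IsAdjSymmetric (∑ i ∈ s, c i • F i) := by
  rw [isAdjSymmetric_iff_rename]
  intro a
  rw [map_sum]
  refine Finset.sum_congr rfl fun i hi => ?_
  rw [map_smul, (isAdjSymmetric_iff_rename _).1 (hF i hi)]

theorem series_sum_smul_apply {ι : Type*} (s : Finset ι) (c : ι → QT) (F : ι → Series)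
    (m : ℕ →₀ ℕ) : (∑ i ∈ s, c i • F i : Series) m = ∑ i ∈ s, c i * F i m := by
  change MvPowerSeries.coeff m (∑ i ∈ s, c i • F i) = _
  rw [map_sum]
  rfl

/-- A triangular family of symmetric series spans the homogeneous symmetric series. -/
theorem mem_of_triangular (W : Submodule QT Series) (n : ℕ) (B : (ℕ →₀ ℕ) → Series)
    (r : (ℕ →₀ ℕ) → ℕ)
    (hB : ∀ m ∈ antitoneExponents n, B m ∈ W ∧ IsAdjSymmetric (B m) ∧
      IsHomogeneousOfDegree n (B m) ∧ B m m ≠ 0 ∧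
      ∀ m' ∈ antitoneExponents n, m' ≠ m → r m' ≤ r m → B m m' = 0)
    (F : Series) (hF : IsAdjSymmetric F) (hFn : IsHomogeneousOfDegree n F) : F ∈ W := by
  classical
  set R := (antitoneExponents n).sup r + 1
  -- All coefficients at partitions of rank below `k` already vanish, and `d` ranks remain. As `R`
  -- exceeds every rank, nothing is left when `k = R`.
  have key : ∀ d k : ℕ, k + d = R → ∀ F : Series, IsAdjSymmetric F → IsHomogeneousOfDegree n F →
      (∀ m ∈ antitoneExponents n, r m < k → F m = 0) → F ∈ W := by
    intro d
    induction d with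
    | zero =>
      intro k hk F hF hFn h0
      have : F = 0 := hF.eq_zero fun m hm => by
        by_contra hne
        have hmem := mem_antitoneExponents.2 ⟨hm, hFn m hne⟩
        refine hne (h0 m hmem ?_)
        have := Finset.le_sup (f := r) hmem
        omega
      rw [this]
      exact W.zero_mem
    | succ d ih =>
      intro k hk F hF hFn h0
      set s := (antitoneExponents n).filter fun m => r m = k with hs
      have hsB : ∀ m ∈ s, m ∈ antitoneExponents n := fun m hm => (Finset.mem_filter.1 hm).1
      -- Subtracting `G` clears rank `k`: members of the family of equal rank do not meet each
      -- other's leading monomials, and none of them meets a smaller rank.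
      set G : Series := ∑ m ∈ s, (F m / B m m) • B m with hG
      have hGW : G ∈ W := W.sum_mem fun m hm => W.smul_mem _ (hB m (hsB m hm)).1
      have hGs : IsAdjSymmetric G := IsAdjSymmetric.sum_smul fun m hm => (hB m (hsB m hm)).2.1
      have hGapp : ∀ m', G m' = ∑ m ∈ s, (F m / B m m) * B m m' :=
        series_sum_smul_apply s _ _
      have hsub : F - G ∈ W := by
        refine ih (k + 1) (by omega) (F - G) (hF.sub hGs) (fun m hm => ?_) fun m hm hrm => ?_
        · by_cases hFm : F m = 0
          · have hGm : G m ≠ 0 := fun h => hm (by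
              change F m - G m = 0
              rw [hFm, h, sub_zero])
            rw [hGapp] at hGm
            obtain ⟨i, hi, hne⟩ := Finset.exists_ne_zero_of_sum_ne_zero hGm
            exact (hB i (hsB i hi)).2.2.1 m (right_ne_zero_of_mul hne)
          · exact hFn m hFm
        · change F m - G m = 0
          rw [hGapp]
          by_cases hk' : r m = k
          · have hms : m ∈ s := Finset.mem_filter.2 ⟨hm, hk'⟩
            rw [Finset.sum_eq_single m]
            · rw [div_mul_cancel₀ _ (hB m hm).2.2.2.1, sub_self]
            · intro i hi hne
              rw [(hB i (hsB i hi)).2.2.2.2 m hm hne.symm, mul_zero]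
              rw [hk', (Finset.mem_filter.1 hi).2]
            · exact fun h => absurd hms h
          · rw [h0 m hm (by omega), Finset.sum_eq_zero, sub_zero]
            intro i hi
            have hri := (Finset.mem_filter.1 hi).2
            rw [(hB i (hsB i hi)).2.2.2.2 m hm _ (by omega), mul_zero]
            rintro rfl
            exact hk' hri
      have := W.add_mem hsub hGW
      rwa [sub_add_cancel] at this
  exact key R 0 (zero_add _) F hF hFn fun m _ h => absurd h (Nat.not_lt_zero _)

end Symmetric

/-! ### Power sums span the symmetric series -/

section PowerSums

theorem isAdjSymmetric_powerSum (k : ℕ+) : IsAdjSymmetric (powerSum k) := by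
  intro a m m' h1 h2 h3
  have hk : (k : ℕ) ≠ 0 := k.ne_zero
  have hcase : ∀ m : ℕ →₀ ℕ, (∃ j, m = Finsupp.single j (k : ℕ)) ↔
      ∃ j, m j = k ∧ ∀ i, i ≠ j → m i = 0 := fun m =>
    exists_congr fun j => by
      constructor
      · rintro rfl
        exact ⟨by simp, fun i hi => by simp [hi.symm]⟩
      · rintro ⟨h, h'⟩
        ext i
        by_cases hi : i = j
        · simp [hi, h]
        · simp [h' i hi, Ne.symm hi]
  have hsw : ∀ m m' : ℕ →₀ ℕ, m' a = m (a + 1) → m' (a + 1) = m a →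
      (∀ k, k ≠ a → k ≠ a + 1 → m' k = m k) →
      (∃ j, m j = k ∧ ∀ i, i ≠ j → m i = 0) → ∃ j, m' j = k ∧ ∀ i, i ≠ j → m' i = 0 := by
    rintro m m' h1 h2 h3 ⟨j, hj, hj'⟩
    refine ⟨Equiv.swap a (a + 1) j, ?_, fun i hi => ?_⟩
    · by_cases e : j = a
      · subst e
        rw [Equiv.swap_apply_left, h2, hj]
      by_cases e' : j = a + 1
      · subst e'
        rw [Equiv.swap_apply_right, h1, hj]
      rw [Equiv.swap_apply_of_ne_of_ne e e', h3 j e e', hj]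
    · by_cases e : i = a
      · subst e
        rw [h1]
        refine hj' _ fun h => hi ?_
        rw [← h, Equiv.swap_apply_right]
      by_cases e' : i = a + 1
      · subst e'
        rw [h2]
        refine hj' _ fun h => hi ?_
        rw [← h, Equiv.swap_apply_left]
      rw [h3 i e e']
      refine hj' _ fun h => hi ?_
      rw [← h, Equiv.swap_apply_of_ne_of_ne e e']
  classical
  unfold powerSum
  refine if_congr ?_ rfl rfl
  rw [hcase, hcase]
  exact ⟨hsw m m' h1 h2 h3, hsw m' m h2.symm h1.symm fun k hk hk' => (h3 k hk hk').symm⟩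

theorem isAdjSymmetric_ofPowerSums (P : MvPolynomial ℕ+ QT) : IsAdjSymmetric (ofPowerSums P) := by
  rw [isAdjSymmetric_iff_rename]
  intro a
  have : (MvPowerSeries.rename (Equiv.swap a (a + 1)).toEmbedding).comp ofPowerSums =
      ofPowerSums := by
    refine MvPolynomial.algHom_ext fun k => ?_
    simp only [AlgHom.comp_apply, ofPowerSums, MvPolynomial.aeval_X]
    exact (isAdjSymmetric_iff_rename _).1 (isAdjSymmetric_powerSum k) a
  exact DFunLike.congr_fun this P

/-- The product of the power sums whose degrees are the nonzero entries of `m`. -/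
def powerSumPoly (m : ℕ →₀ ℕ) : MvPolynomial ℕ+ QT :=
  ∏ i ∈ m.support.attach, MvPolynomial.X (m i).toPNat'

-- Each power sum factor selects a variable, and the coefficient counts the selections that give
-- `m'`. In characteristic zero it vanishes only if there is no selection.
open Classical in
theorem ofPowerSums_powerSumPoly (m m' : ℕ →₀ ℕ) : ofPowerSums (powerSumPoly m) m' =
    (((Finset.finsuppAntidiag m.support.attach m').filter fun l =>
      ∀ i : m.support, ∃ j, l i = Finsupp.single j (m i)).card : QT) := by
  change MvPowerSeries.coeff m' (ofPowerSums (powerSumPoly m)) = _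
  rw [powerSumPoly, map_prod, MvPowerSeries.coeff_prod, Finset.card_filter]
  push_cast
  refine Finset.sum_congr rfl fun l _ => ?_
  simp only [ofPowerSums, MvPolynomial.aeval_X]
  have : ∀ i : m.support, MvPowerSeries.coeff (l i) (powerSum (m i).toPNat') =
      if ∃ j, l i = Finsupp.single j (m i) then (1 : QT) else 0 := fun i => by
    change (if ∃ j, l i = Finsupp.single j ((m i).toPNat' : ℕ) then (1 : QT) else 0) = _
    rw [Nat.toPNat'_coe, if_pos (Nat.pos_of_ne_zero (Finsupp.mem_support_iff.1 i.2))]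
  simp only [this]
  rw [Finset.prod_ite_zero]
  simp

theorem exists_of_ofPowerSums_powerSumPoly_ne_zero {m m' : ℕ →₀ ℕ}
    (h : ofPowerSums (powerSumPoly m) m' ≠ 0) :
    ∃ f : m.support → ℕ, m' = ∑ i, Finsupp.single (f i) (m i) := by
  classical
  rw [ofPowerSums_powerSumPoly, Nat.cast_ne_zero, Finset.card_ne_zero] at h
  obtain ⟨l, hl⟩ := h
  obtain ⟨hl, hl'⟩ := Finset.mem_filter.1 hl
  choose f hf using hl'
  refine ⟨f, ?_⟩
  rw [← (Finset.mem_finsuppAntidiag.1 hl).1, ← Finset.univ_eq_attach]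
  exact Finset.sum_congr rfl fun i _ => hf i

theorem ofPowerSums_powerSumPoly_self (m : ℕ →₀ ℕ) : ofPowerSums (powerSumPoly m) m ≠ 0 := by
  classical
  rw [ofPowerSums_powerSumPoly, Nat.cast_ne_zero, Finset.card_ne_zero]
  refine ⟨Finsupp.equivFunOnFinite.symm fun i => Finsupp.single (i : ℕ) (m i),
    Finset.mem_filter.2 ⟨Finset.mem_finsuppAntidiag.2 ⟨?_, fun i _ => Finset.mem_attach _ _⟩,
      fun i => ⟨i, rfl⟩⟩⟩
  simp only [Finsupp.coe_equivFunOnFinite_symm]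
  rw [Finset.sum_attach m.support fun i => Finsupp.single i (m i)]
  exact Finsupp.sum_single m

theorem mem_lowerSet_iff_lt_card {s : Finset ℕ} (hs : ∀ i ∈ s, ∀ j ≤ i, j ∈ s) (k : ℕ) :
    k ∈ s ↔ k < s.card := by
  constructor
  · intro hk
    have : Finset.range (k + 1) ⊆ s := fun j hj => hs k hk j (by
      rw [Finset.mem_range] at hj
      omega)
    have := Finset.card_le_card this
    rw [Finset.card_range] at this
    omega
  · intro hk
    by_contra hks
    have : s ⊆ Finset.range k := fun j hj => by
      rw [Finset.mem_range]
      by_contra hjk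
      exact hks (hs j hj k (by omega))
    have := Finset.card_le_card this
    rw [Finset.card_range] at this
    omega

/-- A partition is recovered from its conjugate, whose parts are the numbers of parts at least `j`.
-/
theorem antitone_ext {m m' : ℕ →₀ ℕ} (hm : Antitone m) (hm' : Antitone m')
    (h : ∀ j ≠ 0, (m.support.filter fun k => j ≤ m k).card =
      (m'.support.filter fun k => j ≤ m' k).card) : m = m' := by
  have key : ∀ m : ℕ →₀ ℕ, Antitone m → ∀ j ≠ 0, ∀ k,
      j ≤ m k ↔ k < (m.support.filter fun k => j ≤ m k).card := fun m hm j hj k => by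
    rw [← mem_lowerSet_iff_lt_card]
    · simp only [Finset.mem_filter, Finsupp.mem_support_iff]
      constructor
      · intro h
        exact ⟨by omega, h⟩
      · exact fun h => h.2
    · simp only [Finset.mem_filter, Finsupp.mem_support_iff]
      intro i hi l hl
      have := hm hl
      exact ⟨by omega, by omega⟩
  have key2 : ∀ j ≠ 0, ∀ k, j ≤ m k ↔ j ≤ m' k := fun j hj k => by
    rw [key m hm j hj, key m' hm' j hj, h j hj]
  ext k
  have h1 := key2 (m k)
  have h2 := key2 (m' k)
  by_cases e : m k = 0
  · by_cases e' : m' k = 0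
    · omega
    · have := (h2 e' k).2 le_rfl
      omega
  · have := (h1 e k).1 le_rfl
    by_cases e' : m' k = 0
    · omega
    · have := (h2 e' k).2 le_rfl
      omega

/-- The map `f` tells which parts of `m` are added together. If the number of parts does not drop,
`f` is injective, so `m'` has the same parts as `m`, and both are sorted. -/
theorem card_support_lt_of_merge {m m' : ℕ →₀ ℕ} (hm : Antitone m) (hm' : Antitone m')
    (f : m.support → ℕ) (hf : m' = ∑ i, Finsupp.single (f i) (m i)) (hne : m' ≠ m) :
    m'.support.card < m.support.card := by
  classical
  have hval : ∀ k, m' k = ∑ i, if f i = k then m i else 0 := fun k => by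
    rw [hf, Finsupp.finsetSum_apply]
    simp [Finsupp.single_apply]
  have hsub : m'.support = Finset.univ.image f := by
    ext k
    rw [Finsupp.mem_support_iff, hval, Ne, Finset.sum_eq_zero_iff]
    simp only [Finset.mem_univ, Finset.mem_image, true_and, forall_const, not_forall]
    refine exists_congr fun i => ?_
    have := Finsupp.mem_support_iff.1 i.2
    split_ifs with h <;> simp [h, this]
  have hle : m'.support.card ≤ m.support.card := by
    rw [hsub]
    refine Finset.card_image_le.trans ?_
    simp
  refine lt_of_le_of_ne hle fun heq => hne ?_
  have hinj : Function.Injective f := by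
    have : (Finset.univ.image f).card = (Finset.univ : Finset m.support).card := by
      rw [← hsub, heq]
      simp
    exact fun a b h => Finset.card_image_iff.1 this (Finset.mem_coe.2 (Finset.mem_univ a))
      (Finset.mem_coe.2 (Finset.mem_univ b)) h
  have hval' : ∀ i, m' (f i) = m i := fun i => by
    rw [hval, Finset.sum_eq_single i]
    · simp
    · intro b _ hb
      rw [if_neg fun h => hb (hinj h)]
    · simp
  refine antitone_ext hm' hm fun j _ => ?_
  rw [hsub, Finset.filter_image, Finset.card_image_of_injective _ hinj]
  simp only [hval']
  rw [← Finset.card_map (Function.Embedding.subtype _)]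
  congr 1
  ext k
  simp only [Finset.mem_map, Finset.mem_filter, Finset.mem_univ, true_and, Subtype.exists,
    Function.Embedding.coe_subtype]
  constructor
  · rintro ⟨a, ha, h, rfl⟩
    exact ⟨ha, h⟩
  · rintro ⟨ha, h⟩
    exact ⟨k, ha, h, rfl⟩

theorem exists_ofPowerSums_eq {n : ℕ} {F : Series} (hF : IsAdjSymmetric F)
    (hFn : IsHomogeneousOfDegree n F) : ∃ P, ofPowerSums P = F := by
  have hcard : ∀ m ∈ antitoneExponents n, m.support.card ≤ n := fun m hm => by
    have hm := (mem_antitoneExponents.1 hm).2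
    rw [← hm, Finsupp.degree_apply, Finset.card_eq_sum_ones]
    exact Finset.sum_le_sum fun i hi => Nat.one_le_iff_ne_zero.2 (Finsupp.mem_support_iff.1 hi)
  -- The monomials of a product of power sums arise by merging parts, so the family is triangular
  -- for a decreasing number of parts. By `hcard` the subtraction in the rank is not truncated.
  have := mem_of_triangular (LinearMap.range ofPowerSums.toLinearMap) n
    (fun m => ofPowerSums (powerSumPoly m)) (fun m => n - m.support.card) (fun m hm => ?_) F hF hFn
  · obtain ⟨P, hP⟩ := this
    exact ⟨P, hP⟩
  refine ⟨⟨powerSumPoly m, rfl⟩, isAdjSymmetric_ofPowerSums _, fun m' hm' => ?_,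
    ofPowerSums_powerSumPoly_self m, fun m' hm' hne hr => ?_⟩
  · obtain ⟨f, rfl⟩ := exists_of_ofPowerSums_powerSumPoly_ne_zero hm'
    rw [map_sum]
    simp only [Finsupp.degree_single]
    rw [← (mem_antitoneExponents.1 hm).2, Finsupp.degree_apply]
    exact Finset.sum_coe_sort m.support m
  · by_contra h
    obtain ⟨f, hf⟩ := exists_of_ofPowerSums_powerSumPoly_ne_zero h
    have h1 := card_support_lt_of_merge (mem_antitoneExponents.1 hm).1
      (mem_antitoneExponents.1 hm').1 f hf hne
    have h2 := hcard m hm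
    have h3 := hcard m' hm'
    omega

end PowerSums

/-! ### Schur functions: symmetry and triangularity -/

section Tableaux

variable {μ : YoungDiagram} (T : SemistandardYoungTableau μ)

theorem tableauContent_apply (k : ℕ) :
    tableauContent T k = (μ.cells.filter fun c => T c.1 c.2 = k).card := by
  simp [tableauContent, Finsupp.finsetSum_apply, Finsupp.single_apply]

/-- The number of entries smaller than `x` in row `i`. -/
def rowCount (i x : ℕ) : ℕ := ((Finset.range (μ.rowLen i)).filter fun j => T i j < x).card

theorem lt_rowCount (i x j : ℕ) : j < rowCount T i x ↔ (i, j) ∈ μ ∧ T i j < x := by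
  rw [rowCount, ← mem_lowerSet_iff_lt_card, Finset.mem_filter, Finset.mem_range,
    YoungDiagram.mem_iff_lt_rowLen]
  simp only [Finset.mem_filter, Finset.mem_range]
  intro j hj l hl
  refine ⟨by omega, lt_of_le_of_lt (T.row_weak_of_le hl ?_) hj.2⟩
  exact YoungDiagram.mem_iff_lt_rowLen.2 hj.1

theorem rowCount_mono (i : ℕ) {x y : ℕ} (h : x ≤ y) : rowCount T i x ≤ rowCount T i y := by
  by_contra hcon
  push Not at hcon
  obtain ⟨h1, h2⟩ := (lt_rowCount T i x _).1 hcon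
  exact lt_irrefl _ ((lt_rowCount T i y _).2 ⟨h1, by omega⟩)

/-- Interlacing in the Gelfand–Tsetlin pattern of `T`: an entry at most `x` has an entry less than
`x` just below it in its column. -/
theorem rowCount_succ_le (i x : ℕ) : rowCount T (i + 1) (x + 1) ≤ rowCount T i x := by
  by_contra hcon
  push Not at hcon
  obtain ⟨h1, h2⟩ := (lt_rowCount T _ _ _).1 hcon
  refine lt_irrefl _ ((lt_rowCount T i x _).2 ⟨μ.up_left_mem (Nat.le_succ i) le_rfl h1, ?_⟩)
  have := T.col_strict (Nat.lt_add_one i) h1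
  omega

theorem rowCount_eq_zero (i x : ℕ) (hi : μ.colLen 0 ≤ i) : rowCount T i x = 0 := by
  by_contra hcon
  obtain ⟨h1, -⟩ := (lt_rowCount T i x 0).1 (Nat.pos_of_ne_zero hcon)
  rw [YoungDiagram.mem_iff_lt_colLen] at h1
  omega

theorem card_lt_eq_sum_rowCount (x : ℕ) : (μ.cells.filter fun c => T c.1 c.2 < x).card =
    ∑ i ∈ Finset.range (μ.colLen 0), rowCount T i x := by
  rw [Finset.card_eq_sum_card_fiberwise (f := Prod.fst) (t := Finset.range (μ.colLen 0))]
  · refine Finset.sum_congr rfl fun i _ => ?_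
    rw [← Finset.card_range (rowCount T i x), ← Finset.card_image_of_injective
      (Finset.range (rowCount T i x)) (f := fun j => (i, j)) fun a b h => (Prod.mk.inj h).2]
    congr 1
    ext ⟨i', j⟩
    simp only [Finset.mem_filter, YoungDiagram.mem_cells, Finset.mem_image, Finset.mem_range,
      Prod.mk.injEq, lt_rowCount]
    constructor
    · rintro ⟨⟨h1, h2⟩, rfl⟩
      exact ⟨j, ⟨h1, h2⟩, rfl, rfl⟩
    · rintro ⟨j', ⟨h1, h2⟩, rfl, rfl⟩
      exact ⟨⟨h1, h2⟩, rfl⟩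
  · rintro ⟨i, j⟩ h
    have h := (Finset.mem_filter.1 (Finset.mem_coe.1 h)).1
    refine Finset.mem_coe.2 (Finset.mem_range.2 ?_)
    rw [← YoungDiagram.mem_iff_lt_colLen]
    exact μ.up_left_mem le_rfl (Nat.zero_le j) ((YoungDiagram.mem_cells _).1 h)

theorem tableauContent_add_card_lt (x : ℕ) : tableauContent T x +
    (μ.cells.filter fun c => T c.1 c.2 < x).card =
      (μ.cells.filter fun c => T c.1 c.2 < x + 1).card := by
  rw [tableauContent_apply, ← Finset.card_union_of_disjoint]
  · congr 1
    ext c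
    simp only [Finset.mem_union, Finset.mem_filter]
    by_cases hc : c ∈ μ.cells
    · simp only [hc, true_and]
      omega
    · simp [hc]
  · refine Finset.disjoint_filter.2 fun c _ h h' => ?_
    omega

/-- The least number of entries `≤ a` in row `i` which is compatible with the other rows. -/
def bkLower (a i : ℕ) : ℕ := max (rowCount T i a) (rowCount T (i + 1) (a + 2))

/-- The largest number of entries `≤ a` in row `i` which is compatible with the other rows. -/
def bkUpper (a : ℕ) : ℕ → ℕ
  | 0 => rowCount T 0 (a + 2)
  | i + 1 => min (rowCount T (i + 1) (a + 2)) (rowCount T i a)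

theorem bkLower_le (a i : ℕ) : bkLower T a i ≤ rowCount T i (a + 1) :=
  max_le (rowCount_mono T i (by omega)) (rowCount_succ_le T i (a + 1))

theorem le_bkUpper (a i : ℕ) : rowCount T i (a + 1) ≤ bkUpper T a i := by
  cases i with
  | zero => exact rowCount_mono T 0 (by omega)
  | succ i => exact le_min (rowCount_mono T _ (by omega)) (rowCount_succ_le T i a)

theorem bkUpper_le (a i : ℕ) : bkUpper T a i ≤ rowCount T i (a + 2) := by
  cases i with
  | zero => exact le_rfl
  | succ i => exact min_le_left _ _

/-- The number of entries `≤ a` in row `i` of the Bender–Knuth transform of `T`. -/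
def bkThreshold (a i : ℕ) : ℕ := bkLower T a i + bkUpper T a i - rowCount T i (a + 1)

theorem bkThreshold_add (a i : ℕ) :
    bkThreshold T a i + rowCount T i (a + 1) = bkLower T a i + bkUpper T a i := by
  have := bkLower_le T a i
  have := le_bkUpper T a i
  unfold bkThreshold
  omega

theorem bkLower_le_bkThreshold (a i : ℕ) : bkLower T a i ≤ bkThreshold T a i := by
  have := bkThreshold_add T a i
  have := le_bkUpper T a i
  omega

theorem bkThreshold_le_bkUpper (a i : ℕ) : bkThreshold T a i ≤ bkUpper T a i := by
  have := bkThreshold_add T a i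
  have := bkLower_le T a i
  omega

/-- The maximum defining `bkLower` in row `i` and the minimum defining `bkUpper` in row `i + 1` are
taken over the same two counts, so together they give the sum of these counts. -/
theorem sum_bkThreshold (a M : ℕ) :
    ∑ i ∈ Finset.range M, (bkLower T a i + bkUpper T a i) + bkUpper T a M =
      ∑ i ∈ Finset.range M, (rowCount T i a + rowCount T i (a + 2)) + rowCount T M (a + 2) := by
  induction M with
  | zero => simp [bkUpper]
  | succ M ih =>
    rw [Finset.sum_range_succ, Finset.sum_range_succ]
    have : bkLower T a M + bkUpper T a (M + 1) =
        rowCount T M a + rowCount T (M + 1) (a + 2) := by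
      simp only [bkLower, bkUpper]
      omega
    omega

open Classical in
/-- The Bender–Knuth involution, exchanging the numbers of entries `a` and `a + 1`. -/
def benderKnuth (a : ℕ) : SemistandardYoungTableau μ where
  entry i j := if (i, j) ∈ μ ∧ (T i j = a ∨ T i j = a + 1) then
    (if j < bkThreshold T a i then a else a + 1) else T i j
  row_weak' := by
    intro i j1 j2 hj h2
    have h1 : (i, j1) ∈ μ := μ.up_left_mem le_rfl hj.le h2
    have := T.row_weak hj h2
    simp only [h1, h2, true_and]
    split_ifs <;> omega
  col_strict' := by
    intro i1 i2 j hi h2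
    have h1 : (i1, j) ∈ μ := μ.up_left_mem hi.le le_rfl h2
    have h12 := T.col_strict hi h2
    simp only [h1, h2, true_and]
    by_cases e1 : T i1 j = a ∨ T i1 j = a + 1
    · by_cases e2 : T i2 j = a ∨ T i2 j = a + 1
      · have e1' : T i1 j = a := by omega
        have e2' : T i2 j = a + 1 := by omega
        have hi2 : i2 = i1 + 1 := by
          by_contra hne
          have h3 : (i1 + 1, j) ∈ μ := μ.up_left_mem (by omega) le_rfl h2
          have := T.col_strict (Nat.lt_add_one i1) h3
          have := T.col_strict (show i1 + 1 < i2 by omega) h2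
          omega
        subst hi2
        -- A vertical pair `a`, `a + 1` has to stay fixed, and the bounds on the thresholds are made
        -- for this: the entry in row `i1 + 1` is counted in `bkLower` of row `i1`, and the entry
        -- `a` of row `i1` caps `bkUpper` of row `i1 + 1`.
        have k1 : j < bkThreshold T a i1 := by
          refine lt_of_lt_of_le ?_ ((le_max_right _ _).trans (bkLower_le_bkThreshold T a i1))
          exact (lt_rowCount T _ _ _).2 ⟨h2, by omega⟩
        have k2 : ¬ j < bkThreshold T a (i1 + 1) := fun hlt => by
          have := lt_of_lt_of_le hlt
            ((bkThreshold_le_bkUpper T a (i1 + 1)).trans (min_le_right _ _))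
          have := ((lt_rowCount T _ _ _).1 this).2
          omega
        simp [e1', e2', k1, k2]
      · rw [if_pos e1, if_neg e2]
        split_ifs <;> omega
    · rw [if_neg e1]
      split_ifs <;> omega
  zeros' := by
    intro i j h
    rw [if_neg fun h' => h h'.1]
    exact T.zeros h

open Classical in
theorem benderKnuth_apply (a i j : ℕ) : benderKnuth T a i j =
    if (i, j) ∈ μ ∧ (T i j = a ∨ T i j = a + 1) then
      (if j < bkThreshold T a i then a else a + 1) else T i j := rfl

theorem benderKnuth_lt_iff (a i j x : ℕ) (hx : x ≠ a + 1) :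
    benderKnuth T a i j < x ↔ T i j < x := by
  classical
  rw [benderKnuth_apply]
  split_ifs <;> omega

theorem rowCount_benderKnuth (a i x : ℕ) (hx : x ≠ a + 1) :
    rowCount (benderKnuth T a) i x = rowCount T i x := by
  simp only [rowCount, benderKnuth_lt_iff T a _ _ x hx]

theorem rowCount_benderKnuth_succ (a i : ℕ) :
    rowCount (benderKnuth T a) i (a + 1) = bkThreshold T a i := by
  classical
  have key : ∀ j, j < rowCount (benderKnuth T a) i (a + 1) ↔ j < bkThreshold T a i := fun j => by
    rw [lt_rowCount, benderKnuth_apply]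
    have h1 : j < rowCount T i a → j < bkThreshold T a i := fun h =>
      lt_of_lt_of_le h ((le_max_left _ _).trans (bkLower_le_bkThreshold T a i))
    have h2 : j < bkThreshold T a i → j < rowCount T i (a + 2) := fun h =>
      lt_of_lt_of_le h ((bkThreshold_le_bkUpper T a i).trans (bkUpper_le T a i))
    rw [lt_rowCount] at h1 h2
    by_cases hμ : (i, j) ∈ μ
    · simp only [hμ, true_and] at h1 h2 ⊢
      split_ifs with h3 h4
      · simp [h4]
      · simp [h4]
      · constructor
        · intro h
          exact h1 (by omega)
        · intro h
          have := h2 h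
          omega
    · simp only [hμ, false_and, false_iff]
      intro h
      exact hμ (h2 h).1
  have h1 := key (rowCount (benderKnuth T a) i (a + 1))
  have h2 := key (bkThreshold T a i)
  omega

/-- The bounds only involve the counts below `a` and below `a + 2`, which are unchanged. Within each
row the count below `a + 1` is reflected in the same interval twice. -/
theorem benderKnuth_benderKnuth (a : ℕ) : benderKnuth (benderKnuth T a) a = T := by
  classical
  have hlow : ∀ i, bkLower (benderKnuth T a) a i = bkLower T a i := fun i => by
    simp only [bkLower, rowCount_benderKnuth T a _ a (by omega),
      rowCount_benderKnuth T a _ (a + 2) (by omega)]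
  have hup : ∀ i, bkUpper (benderKnuth T a) a i = bkUpper T a i := fun i => by
    cases i <;> simp only [bkUpper, rowCount_benderKnuth T a _ a (by omega),
      rowCount_benderKnuth T a _ (a + 2) (by omega)]
  have hthr : ∀ i, bkThreshold (benderKnuth T a) a i = rowCount T i (a + 1) := fun i => by
    have := bkThreshold_add (benderKnuth T a) a i
    have := bkThreshold_add T a i
    rw [hlow, hup, rowCount_benderKnuth_succ] at *
    omega
  refine SemistandardYoungTableau.ext fun i j => ?_
  rw [benderKnuth_apply, hthr, benderKnuth_apply]
  have h := lt_rowCount T i (a + 1) j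
  by_cases hμ : (i, j) ∈ μ
  · simp only [hμ, true_and] at h ⊢
    simp only [h]
    split_ifs <;> omega
  · simp [hμ]

theorem tableauContent_benderKnuth (a : ℕ) :
    tableauContent (benderKnuth T a) a = tableauContent T (a + 1) ∧
    tableauContent (benderKnuth T a) (a + 1) = tableauContent T a ∧
    ∀ k, k ≠ a → k ≠ a + 1 → tableauContent (benderKnuth T a) k = tableauContent T k := by
  classical
  have hN : ∀ x, x ≠ a + 1 →
      (μ.cells.filter fun c => benderKnuth T a c.1 c.2 < x).card =
        (μ.cells.filter fun c => T c.1 c.2 < x).card := fun x hx => by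
    simp only [benderKnuth_lt_iff T a _ _ x hx]
  -- The reflections, summed over all rows by `sum_bkThreshold`; the boundary terms vanish because
  -- row `μ.colLen 0` is empty. This exchanges the multiplicities of `a` and `a + 1`.
  have hsum : (μ.cells.filter fun c => benderKnuth T a c.1 c.2 < a + 1).card +
      (μ.cells.filter fun c => T c.1 c.2 < a + 1).card =
      (μ.cells.filter fun c => T c.1 c.2 < a).card +
      (μ.cells.filter fun c => T c.1 c.2 < a + 1 + 1).card := by
    simp only [card_lt_eq_sum_rowCount, ← Finset.sum_add_distrib, rowCount_benderKnuth_succ,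
      bkThreshold_add]
    have h1 : _ = ∑ i ∈ Finset.range (μ.colLen 0),
      (rowCount T i a + rowCount T i (a + 1 + 1)) + _ := sum_bkThreshold T a (μ.colLen 0)
    have h2 := rowCount_eq_zero T (μ.colLen 0) (a + 2) le_rfl
    have h3 := bkUpper_le T a (μ.colLen 0)
    omega
  have c1 := tableauContent_add_card_lt T a
  have c2 := tableauContent_add_card_lt T (a + 1)
  have c3 := tableauContent_add_card_lt (benderKnuth T a) a
  have c4 := tableauContent_add_card_lt (benderKnuth T a) (a + 1)
  have h1 := hN a (by omega)
  have h2 := hN (a + 1 + 1) (by omega)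
  refine ⟨by omega, by omega, fun k hk hk' => ?_⟩
  rw [tableauContent_apply, tableauContent_apply]
  congr 1
  ext c
  simp only [Finset.mem_filter]
  refine and_congr_right fun _ => ?_
  rw [benderKnuth_apply]
  split_ifs <;> omega

theorem isAdjSymmetric_schur (μ : YoungDiagram) : IsAdjSymmetric (schur μ) := by
  intro a m m' h1 h2 h3
  have key : ∀ (m m' : ℕ →₀ ℕ), m' a = m (a + 1) → m' (a + 1) = m a →
      (∀ k, k ≠ a → k ≠ a + 1 → m' k = m k) → ∀ T : SemistandardYoungTableau μ,
      tableauContent T = m → tableauContent (benderKnuth T a) = m' := by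
    rintro m m' h1 h2 h3 T rfl
    obtain ⟨e1, e2, e3⟩ := tableauContent_benderKnuth T a
    ext k
    by_cases hk : k = a
    · rw [hk, e1, h1]
    by_cases hk' : k = a + 1
    · rw [hk', e2, h2]
    rw [e3 k hk hk', h3 k hk hk']
  unfold schur
  congr 1
  refine Nat.card_congr
    { toFun := fun T => ⟨benderKnuth T.1 a, key m m' h1 h2 h3 _ T.2⟩
      invFun := fun T => ⟨benderKnuth T.1 a, key m' m h2.symm h1.symm
        (fun k hk hk' => (h3 k hk hk').symm) _ T.2⟩
      left_inv := fun T => Subtype.ext (benderKnuth_benderKnuth T.1 a)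
      right_inv := fun T => Subtype.ext (benderKnuth_benderKnuth T.1 a) }

theorem degree_tableauContent : (tableauContent T).degree = μ.card := by
  simp [tableauContent, map_sum, Finsupp.degree_single]

theorem schur_ne_zero {m : ℕ →₀ ℕ} (h : schur μ m ≠ 0) :
    ∃ T : SemistandardYoungTableau μ, tableauContent T = m := by
  have : Nat.card {T : SemistandardYoungTableau μ // tableauContent T = m} ≠ 0 := fun h0 =>
    h (by simp [schur, h0])
  obtain ⟨T⟩ := (Nat.card_ne_zero.1 this).1
  exact ⟨T.1, T.2⟩

theorem isHomogeneousOfDegree_schur (μ : YoungDiagram) :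
    IsHomogeneousOfDegree μ.card (schur μ) := fun m hm => by
  obtain ⟨T, rfl⟩ := schur_ne_zero hm
  exact degree_tableauContent T

theorem le_entry {i j : ℕ} (h : (i, j) ∈ μ) : i ≤ T i j := by
  induction i with
  | zero => exact Nat.zero_le _
  | succ i ih =>
    have := ih (μ.up_left_mem (Nat.le_succ i) le_rfl h)
    have := T.col_strict (Nat.lt_add_one i) h
    omega

theorem indexWeight_tableauContent : indexWeight (tableauContent T) =
    ∑ c ∈ μ.cells, T c.1 c.2 := by
  simp [tableauContent, map_sum, indexWeight_single]

/-- The diagram whose `i`-th row has length `m i`. -/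
def diagramOf (m : ℕ →₀ ℕ) (hm : Antitone m) : YoungDiagram where
  cells := (m.support ×ˢ Finset.range (m.degree + 1)).filter fun c => c.2 < m c.1
  isLowerSet := by
    rintro ⟨i, j⟩ ⟨i', j'⟩ ⟨hi, hj⟩ h
    simp only [Finset.coe_filter, Finset.mem_product, Finset.mem_range, Set.mem_ofPred_eq,
      Finsupp.mem_support_iff] at h ⊢
    simp only at hi hj
    have := hm hi
    omega

theorem mem_diagramOf (m : ℕ →₀ ℕ) (hm : Antitone m) (i j : ℕ) :
    (i, j) ∈ diagramOf m hm ↔ j < m i := by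
  rw [← YoungDiagram.mem_cells]
  simp only [diagramOf, Finset.mem_filter, Finset.mem_product, Finset.mem_range,
    Finsupp.mem_support_iff]
  have := Finsupp.le_degree i m
  omega

theorem tableauContent_highestWeight (m : ℕ →₀ ℕ) (hm : Antitone m) :
    tableauContent (SemistandardYoungTableau.highestWeight (diagramOf m hm)) = m := by
  ext k
  rw [tableauContent_apply, ← Finset.card_range (m k), ← Finset.card_image_of_injective
    (Finset.range (m k)) (f := fun j => (k, j)) fun a b h => (Prod.mk.inj h).2]
  congr 1
  ext ⟨i, j⟩
  simp only [Finset.mem_filter, YoungDiagram.mem_cells, Finset.mem_image, Finset.mem_range,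
    Prod.mk.injEq]
  rw [SemistandardYoungTableau.highestWeight_apply]
  constructor
  · rintro ⟨h1, h2⟩
    rw [if_pos h1] at h2
    exact ⟨j, by rwa [← h2, ← mem_diagramOf m hm], h2.symm, rfl⟩
  · rintro ⟨j, h, rfl, rfl⟩
    have := (mem_diagramOf m hm k j).2 h
    exact ⟨this, if_pos this⟩

theorem card_diagramOf (m : ℕ →₀ ℕ) (hm : Antitone m) : (diagramOf m hm).card = m.degree := by
  rw [← degree_tableauContent (SemistandardYoungTableau.highestWeight _),
    tableauContent_highestWeight]

/-- The `indexWeight` of the content is the sum of the entries, and an entry of row `i` is at least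
`i`. The minimum is reached only if every entry equals its row index. -/
theorem eq_highestWeight_of_indexWeight_le
    (h : indexWeight (tableauContent T) ≤
      indexWeight (tableauContent (SemistandardYoungTableau.highestWeight μ))) :
    T = SemistandardYoungTableau.highestWeight μ := by
  rw [indexWeight_tableauContent, indexWeight_tableauContent] at h
  have hle : ∀ c ∈ μ.cells, SemistandardYoungTableau.highestWeight μ c.1 c.2 ≤ T c.1 c.2 :=
    fun c hc => by
      rw [SemistandardYoungTableau.highestWeight_apply, if_pos ((YoungDiagram.mem_cells _).1 hc)]
      exact le_entry T ((YoungDiagram.mem_cells _).1 hc)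
  have heq := (Finset.sum_eq_sum_iff_of_le hle).1 (le_antisymm (Finset.sum_le_sum hle) h)
  refine SemistandardYoungTableau.ext fun i j => ?_
  by_cases hc : (i, j) ∈ μ
  · exact (heq (i, j) ((YoungDiagram.mem_cells _).2 hc)).symm
  · rw [T.zeros hc, SemistandardYoungTableau.zeros _ hc]

/-- Schur functions are triangular for `indexWeight`: a monomial of the Schur function of `m` whose
weight does not exceed that of `m` comes from the highest weight tableau, hence is `m` itself. -/
theorem exists_schurSum_eq {n : ℕ} {F : Series} (hF : IsAdjSymmetric F)
    (hFn : IsHomogeneousOfDegree n F) : ∃ K, F = schurSum K := by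
  classical
  have := mem_of_triangular (Submodule.span QT (Set.range schur)) n
    (fun m => if h : Antitone m then schur (diagramOf m h) else 0) indexWeight
    (fun m hm => ?_) F hF hFn
  · obtain ⟨K, hK⟩ := Finsupp.mem_span_range_iff_exists_finsupp.1 this
    exact ⟨K, hK.symm⟩
  obtain ⟨hm, hmn⟩ := mem_antitoneExponents.1 hm
  simp only [hm, dif_pos]
  refine ⟨Submodule.subset_span ⟨_, rfl⟩, isAdjSymmetric_schur _, ?_, ?_, fun m' _ hne hr => ?_⟩
  · rw [← hmn, ← card_diagramOf m hm]
    exact isHomogeneousOfDegree_schur _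
  · have : Nat.card {T : SemistandardYoungTableau (diagramOf m hm) // tableauContent T = m} = 1 := by
      rw [Nat.card_eq_one_iff_unique]
      refine ⟨⟨fun A B => Subtype.ext ?_⟩, ⟨⟨_, tableauContent_highestWeight m hm⟩⟩⟩
      rw [eq_highestWeight_of_indexWeight_le A.1 (by rw [A.2, tableauContent_highestWeight]),
        eq_highestWeight_of_indexWeight_le B.1 (by rw [B.2, tableauContent_highestWeight])]
    simp [schur, this]
  · by_contra h
    obtain ⟨T, rfl⟩ := schur_ne_zero h
    refine hne ?_
    rw [eq_highestWeight_of_indexWeight_le T (by rwa [tableauContent_highestWeight]),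
      tableauContent_highestWeight]

end Tableaux

/-! ### Plethystic evaluation of generating series of fillings -/

section PowerSumSpecialization

/-- The evaluation `p_k ↦ 1 + N u^k`, with `N` an indeterminate. -/
def plethInterpolation : MvPolynomial ℕ+ QT →ₐ[QT] Polynomial (Polynomial QT) :=
  MvPolynomial.aeval fun k : ℕ+ => 1 + Polynomial.X * Polynomial.C ((Polynomial.X : Polynomial QT) ^ (k : ℕ))

theorem eval_plethInterpolation (a : Polynomial QT) (P : MvPolynomial ℕ+ QT) :
    (plethInterpolation P).eval a =
      MvPolynomial.aeval (fun k : ℕ+ => 1 + a * Polynomial.X ^ (k : ℕ)) P := by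
  have : ((Polynomial.aeval a : Polynomial (Polynomial QT) →ₐ[Polynomial QT]
      Polynomial QT).restrictScalars QT).comp plethInterpolation =
      MvPolynomial.aeval (fun k : ℕ+ => 1 + a * Polynomial.X ^ (k : ℕ)) := by
    refine MvPolynomial.algHom_ext fun k => ?_
    simp [plethInterpolation]
  have := DFunLike.congr_fun this P
  simpa [Polynomial.aeval_def] using this

theorem eval_neg_one_plethInterpolation (P : MvPolynomial ℕ+ QT) :
    (plethInterpolation P).eval (-1) = plethOneSubU P := by
  rw [eval_plethInterpolation, plethOneSubU]
  congr 2
  funext k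
  ring

/-- The symmetric polynomial in the first `N` variables. -/
def truncPowerSums (N : ℕ) : MvPolynomial ℕ+ QT →ₐ[QT] MvPolynomial (Fin N) QT :=
  MvPolynomial.aeval fun k : ℕ+ => MvPolynomial.psum (Fin N) QT k

/-- Setting the variables of index at least `N` to zero is an algebra homomorphism, so it suffices
to compare power sums. -/
theorem coeff_truncPowerSums (N : ℕ) (P : MvPolynomial ℕ+ QT) (m : Fin N →₀ ℕ) :
    MvPolynomial.coeff m (truncPowerSums N P) =
      ofPowerSums P (m.embDomain Fin.valEmbedding) := by
  classical
  have : (MvPolynomial.coeToMvPowerSeries.algHom QT).comp (truncPowerSums N) =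
      (MvPowerSeries.killCompl (Fin.valEmbedding : Fin N ↪ ℕ)).comp ofPowerSums := by
    refine MvPolynomial.algHom_ext fun k => ?_
    simp only [AlgHom.comp_apply, truncPowerSums, ofPowerSums, MvPolynomial.aeval_X,
      MvPolynomial.coeToMvPowerSeries.algHom_apply, Algebra.algebraMap_self, MvPowerSeries.map_id,
      RingHom.id_apply]
    ext m
    rw [MvPowerSeries.coeff_killCompl, MvPolynomial.coeff_coe]
    have e1 : MvPowerSeries.coeff (m.embDomain Fin.valEmbedding) (powerSum k) =
        if ∃ j : ℕ, m.embDomain Fin.valEmbedding = Finsupp.single j (k : ℕ) then (1 : QT) else 0 :=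
      if_congr Iff.rfl rfl rfl
    rw [e1, MvPolynomial.psum, MvPolynomial.coeff_sum]
    simp only [MvPolynomial.coeff_X_pow]
    by_cases h : ∃ j : ℕ, m.embDomain Fin.valEmbedding = Finsupp.single j (k : ℕ)
    · rw [if_pos h]
      obtain ⟨j, hj⟩ := h
      have hjr : j ∈ Set.range (Fin.valEmbedding : Fin N ↪ ℕ) := by
        by_contra hn
        have h1 := Finsupp.embDomain_of_notMem_range Fin.valEmbedding m j hn
        rw [hj, Finsupp.single_eq_same] at h1
        exact k.ne_zero h1
      obtain ⟨i, rfl⟩ := hjr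
      rw [← Finsupp.embDomain_single] at hj
      have hm := Finsupp.embDomain_injective _ hj
      rw [Finset.sum_eq_single i]
      · rw [if_pos hm.symm]
      · intro b _ hb
        rw [hm, if_neg]
        intro h
        rw [Finsupp.single_left_inj k.ne_zero] at h
        exact hb h
      · simp
    · rw [if_neg h]
      refine Finset.sum_eq_zero fun i _ => if_neg fun hi => h ⟨i, ?_⟩
      rw [← hi, Finsupp.embDomain_single]
      rfl
  have := congrArg (MvPowerSeries.coeff m) (DFunLike.congr_fun this P)
  simp only [AlgHom.comp_apply, MvPolynomial.coeToMvPowerSeries.algHom_apply,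
    Algebra.algebraMap_self, MvPowerSeries.map_id, RingHom.id_apply,
    MvPowerSeries.coeff_killCompl, MvPolynomial.coeff_coe] at this
  exact this

/-- On the variables `1, u, …, u`, with `N` copies of `u`, the power sum `p_k` takes the value `1 +
N u^k`. -/
theorem aeval_truncPowerSums (N : ℕ) (P : MvPolynomial ℕ+ QT) :
    MvPolynomial.aeval (fun i : Fin (N + 1) => if i = 0 then (1 : Polynomial QT) else Polynomial.X)
      (truncPowerSums (N + 1) P) = (plethInterpolation P).eval (N : Polynomial QT) := by
  rw [eval_plethInterpolation]
  have : (MvPolynomial.aeval (fun i : Fin (N + 1) =>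
      if i = 0 then (1 : Polynomial QT) else Polynomial.X)).comp (truncPowerSums (N + 1)) =
      MvPolynomial.aeval fun k : ℕ+ => 1 + (N : Polynomial QT) * Polynomial.X ^ (k : ℕ) := by
    refine MvPolynomial.algHom_ext fun k => ?_
    simp [truncPowerSums, MvPolynomial.psum, Fin.sum_univ_succ]
  exact DFunLike.congr_fun this P

end PowerSumSpecialization

/-! ### Super-fillings: one barred letter, and continuation in the number of letters -/

section Super

variable {ι : Type*} [Fintype ι]

theorem truncPowerSums_eq_of_pairSeries [DecidableEq ι] (c : ι → ι → Bool → QT)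
    (P : MvPolynomial ℕ+ QT) (hP : ofPowerSums P = pairSeries c) (N : ℕ) :
    truncPowerSums N P = ∑ σ : ι → Fin N, MvPolynomial.monomial (∑ u, Finsupp.single (σ u) 1)
      (pairWeight c fun u => (σ u : ℕ)) := by
  classical
  refine MvPolynomial.ext _ _ fun m => ?_
  rw [coeff_truncPowerSums, hP, MvPolynomial.coeff_sum, pairSeries,
    ← filter_exponent_eq _ (Finset.range N)]
  · simp only [MvPolynomial.coeff_monomial]
    rw [← Finset.sum_filter]
    have hexp : ∀ σ : ι → Fin N, exponent (fun u => (σ u : ℕ)) =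
        (∑ u, Finsupp.single (σ u) 1 : Fin N →₀ ℕ).embDomain Fin.valEmbedding := fun σ => by
      rw [Finsupp.embDomain_eq_mapDomain, Finsupp.mapDomain_finsetSum]
      simp [exponent, Finsupp.mapDomain_single]
    symm
    refine Finset.sum_bij (fun σ _ => fun u => (σ u : ℕ)) ?_ ?_ ?_ ?_
    · intro σ hσ
      simp only [Finset.mem_filter, Finset.mem_univ, true_and] at hσ
      simp only [Finset.mem_filter, Fintype.mem_piFinset, Finset.mem_range]
      exact ⟨fun u => (σ u).2, by rw [hexp, hσ]⟩
    · intro σ _ σ' _ h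
      funext u
      exact Fin.ext (congrFun h u)
    · intro σ hσ
      simp only [Finset.mem_filter, Fintype.mem_piFinset, Finset.mem_range] at hσ
      refine ⟨fun u => ⟨σ u, hσ.1 u⟩, ?_, rfl⟩
      simp only [Finset.mem_filter, Finset.mem_univ, true_and]
      refine Finsupp.embDomain_injective Fin.valEmbedding ?_
      rw [← hexp]
      exact hσ.2
    · intro σ _
      rfl
  · intro k hk
    rw [Finsupp.support_embDomain, Finset.mem_map] at hk
    obtain ⟨i, -, rfl⟩ := hk
    exact Finset.mem_range.2 i.2

theorem eval_plethInterpolation_of_pairSeries [DecidableEq ι] (c : ι → ι → Bool → QT)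
    (P : MvPolynomial ℕ+ QT) (hP : ofPowerSums P = pairSeries c) (N : ℕ) :
    (plethInterpolation P).eval (N : Polynomial QT) =
      ∑ σ ∈ Fintype.piFinset fun _ : ι => Finset.range (N + 1),
        Polynomial.C (pairWeight c σ) *
          ∏ u, if σ u = 0 then (1 : Polynomial QT) else Polynomial.X := by
  rw [← aeval_truncPowerSums, truncPowerSums_eq_of_pairSeries c P hP, map_sum]
  refine Finset.sum_bij (fun σ _ => fun u => (σ u : ℕ)) ?_ ?_ ?_ ?_
  · intro σ _
    simp only [Fintype.mem_piFinset, Finset.mem_range]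
    exact fun u => (σ u).2
  · intro σ _ σ' _ h
    funext u
    exact Fin.ext (congrFun h u)
  · intro σ hσ
    simp only [Fintype.mem_piFinset, Finset.mem_range] at hσ
    exact ⟨fun u => ⟨σ u, hσ u⟩, Finset.mem_univ _, rfl⟩
  · intro σ _
    rw [MvPolynomial.aeval_monomial]
    congr 1
    rw [Finsupp.prod_fintype _ _ (fun i => pow_zero _)]
    simp only [Finsupp.finsetSum_apply, ← Finset.prod_pow_eq_pow_sum]
    rw [Finset.prod_comm]
    refine Finset.prod_congr rfl fun u _ => ?_
    rw [Finset.prod_eq_single (σ u)]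
    · rw [Finsupp.single_eq_same, pow_one]
      exact if_congr (by rw [Fin.ext_iff]; rfl) rfl rfl
    · intro b _ hb
      simp [hb.symm]
    · simp

/-- The comparison of letters in the super-alphabet in which the letter `1` is barred. -/
def superGT (a b : ℕ) : Bool := decide (b < a ∨ a = 1 ∧ b = 1)

variable {K : Type*} [CommRing K]

/-- The weight of a super-filling: the letters `0` have weight `1`, the barred letters `1` have
weight `-u` and the other letters have weight `u`. -/
def superWeight (c : ι → ι → Bool → K) (τ : ι → ℕ) : Polynomial K :=
  Polynomial.C (∏ u, ∏ v, c u v (superGT (τ u) (τ v))) *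
    ∏ u, if τ u = 0 then (1 : Polynomial K) else if τ u = 1 then -Polynomial.X else Polynomial.X

/-- The generating function of the super-fillings with `N` ordinary letters of weight `u`. -/
def superSum [DecidableEq ι] (c : ι → ι → Bool → K) (N : ℕ) : Polynomial K :=
  ∑ τ ∈ Fintype.piFinset fun _ : ι => Finset.range (N + 2), superWeight c τ

/-- Exchange of the letters `1` and `2`. -/
def flipLetter (a : ℕ) : ℕ := if a = 1 then 2 else if a = 2 then 1 else a

theorem flipLetter_flipLetter (a : ℕ) : flipLetter (flipLetter a) = a := by
  unfold flipLetter
  split_ifs <;> omega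

/-- The barred `1` exceeds exactly `0` and itself, which are also the letters below `2`. As first
letters of a comparison, `1` and `2` behave alike. -/
theorem superGT_flipLetter_left (a b : ℕ) : superGT (flipLetter a) b = superGT a b := by
  unfold superGT flipLetter
  rw [decide_eq_decide]
  split_ifs <;> omega

theorem superGT_flipLetter_right (a b : ℕ) (ha : a ≠ 1) (ha' : a ≠ 2) :
    superGT a (flipLetter b) = superGT a b := by
  unfold superGT flipLetter
  rw [decide_eq_decide]
  split_ifs <;> omega

/-- Nontrivial weights occur only for pairs with `ρ u < ρ v`. No box before `w` carries `1` or `2`,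
so no comparison notices the exchange at `w`; only the sign of one factor changes. -/
theorem superWeight_flip [DecidableEq ι] {β : Type*} [LinearOrder β] (ρ : ι → β)
    (c : ι → ι → Bool → K) (hc : ∀ u v b, ¬ ρ u < ρ v → c u v b = 1) (τ : ι → ℕ) (w : ι)
    (hw : τ w = 1 ∨ τ w = 2) (hmin : ∀ u, τ u = 1 ∨ τ u = 2 → ρ w ≤ ρ u) :
    superWeight c (Function.update τ w (flipLetter (τ w))) = -superWeight c τ := by
  unfold superWeight
  rw [← mul_neg]
  congr 1
  · congr 1
    refine Finset.prod_congr rfl fun u _ => Finset.prod_congr rfl fun v _ => ?_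
    by_cases huv : ρ u < ρ v
    swap
    · rw [hc u v _ huv, hc u v _ huv]
    congr 1
    by_cases hu : u = w
    · have hv : v ≠ w := by
        rintro rfl
        rw [hu] at huv
        exact lt_irrefl _ huv
      subst hu
      rw [Function.update_self, Function.update_of_ne hv, superGT_flipLetter_left]
    · rw [Function.update_of_ne hu]
      by_cases hv : v = w
      · subst hv
        rw [Function.update_self, superGT_flipLetter_right]
        · exact fun h => absurd (hmin u (Or.inl h)) (not_le.2 huv)
        · exact fun h => absurd (hmin u (Or.inr h)) (not_le.2 huv)
      · rw [Function.update_of_ne hv]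
  · rw [← Finset.mul_prod_erase _ _ (Finset.mem_univ w),
      ← Finset.mul_prod_erase _ _ (Finset.mem_univ w), ← neg_mul]
    congr 1
    · rw [Function.update_self]
      rcases hw with h | h <;> simp [h, flipLetter]
    · refine Finset.prod_congr rfl fun u hu => ?_
      rw [Function.update_of_ne (Finset.ne_of_mem_erase hu)]

theorem superWeight_comp (c : ι → ι → Bool → K) (τ : ι → ℕ) (φ : ℕ → ℕ)
    (hlt : ∀ u v, φ (τ u) < φ (τ v) ↔ τ u < τ v) (h0 : ∀ u, φ (τ u) = 0 ↔ τ u = 0)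
    (h1 : ∀ u, φ (τ u) = 1 ↔ τ u = 1) : superWeight c (fun u => φ (τ u)) = superWeight c τ := by
  simp only [superWeight, superGT, hlt, h0, h1]

/-- The barred letter cancels one ordinary letter: flipping the first `1` or `2` is a sign-reversing
involution. The surviving fillings use `0` and letters at least `3`, and a shift by two identifies
them with ordinary fillings. -/
theorem superSum_succ [DecidableEq ι] {β : Type*} [LinearOrder β] (ρ : ι → β)
    (c : ι → ι → Bool → K) (hc : ∀ u v b, ¬ ρ u < ρ v → c u v b = 1) (N : ℕ) :
    superSum c (N + 1) = ∑ σ ∈ Fintype.piFinset fun _ : ι => Finset.range (N + 1),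
        Polynomial.C (pairWeight c σ) *
          ∏ u, if σ u = 0 then (1 : Polynomial K) else Polynomial.X := by
  classical
  rcases isEmpty_or_nonempty ι with hι | hι
  · simp [superSum, superWeight, pairWeight]
  have hfirst : ∀ S : Finset ι, ∃ w : ι, S.Nonempty → w ∈ S ∧ ∀ u ∈ S, ρ w ≤ ρ u := fun S => by
    by_cases hS : S.Nonempty
    · obtain ⟨w, h1, h2⟩ := Finset.exists_min_image S ρ hS
      exact ⟨w, fun _ => ⟨h1, h2⟩⟩
    · exact ⟨hι.some, fun h => absurd h hS⟩
  choose first hfirst using hfirst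
  set S : (ι → ℕ) → Finset ι := fun τ => Finset.univ.filter fun u => τ u = 1 ∨ τ u = 2 with hS
  have hmemS : ∀ τ u, u ∈ S τ ↔ τ u = 1 ∨ τ u = 2 := fun τ u => by simp [hS]
  set flip : (ι → ℕ) → ι → ℕ := fun τ =>
    Function.update τ (first (S τ)) (flipLetter (τ (first (S τ)))) with hflip
  have hflipS : ∀ τ, (S τ).Nonempty → S (flip τ) = S τ := fun τ hτ => by
    have hw := (hmemS τ _).1 (hfirst _ hτ).1
    ext u
    rw [hmemS, hmemS]
    simp only [hflip]
    by_cases hu : u = first (S τ)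
    · rw [hu, Function.update_self]
      unfold flipLetter
      split_ifs <;> omega
    · rw [Function.update_of_ne hu]
  rw [superSum, ← Finset.sum_filter_add_sum_filter_not _ fun τ => (S τ).Nonempty]
  have hcancel : ∑ τ ∈ (Fintype.piFinset fun _ : ι => Finset.range (N + 1 + 2)).filter
      (fun τ => (S τ).Nonempty), superWeight c τ = 0 := by
    refine Finset.sum_involution (fun τ _ => flip τ) ?_ ?_ ?_ ?_
    · intro τ hτ
      have hne := (Finset.mem_filter.1 hτ).2
      rw [hflip]
      rw [superWeight_flip ρ c hc τ _ ((hmemS τ _).1 (hfirst _ hne).1)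
        fun u hu => (hfirst _ hne).2 u ((hmemS τ u).2 hu)]
      exact add_neg_cancel _
    · intro τ hτ _ heq
      have hne := (Finset.mem_filter.1 hτ).2
      have hw := (hmemS τ _).1 (hfirst _ hne).1
      have := congrFun heq (first (S τ))
      simp only [hflip, Function.update_self] at this
      unfold flipLetter at this
      split_ifs at this <;> omega
    · intro τ hτ
      obtain ⟨h1, hne⟩ := Finset.mem_filter.1 hτ
      have hw := (hmemS τ _).1 (hfirst _ hne).1
      refine Finset.mem_filter.2 ⟨?_, by rw [hflipS τ hne]; exact hne⟩
      simp only [Fintype.mem_piFinset, Finset.mem_range] at h1 ⊢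
      intro u
      by_cases hu : u = first (S τ)
      · rw [hu]
        simp only [hflip, Function.update_self]
        unfold flipLetter
        split_ifs <;> omega
      · simp only [hflip]
        rw [Function.update_of_ne hu]
        exact h1 u
    · intro τ hτ
      have hne := (Finset.mem_filter.1 hτ).2
      have h1 := hflipS τ hne
      change Function.update (flip τ) (first (S (flip τ))) _ = τ
      rw [h1]
      simp only [hflip, Function.update_self, flipLetter_flipLetter, Function.update_idem,
        Function.update_eq_self]
  rw [hcancel, zero_add]
  have hφ0 : ∀ x : ℕ, (if x = 0 then 0 else x + 2) = 0 ↔ x = 0 := fun x => by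
    by_cases h : x = 0 <;> simp [h]
  symm
  refine Finset.sum_bij (fun σ _ => fun u => if σ u = 0 then 0 else σ u + 2) ?_ ?_ ?_ ?_
  · intro σ hσ
    simp only [Fintype.mem_piFinset, Finset.mem_range] at hσ
    refine Finset.mem_filter.2 ⟨?_, ?_⟩
    · simp only [Fintype.mem_piFinset, Finset.mem_range]
      intro u
      have := hσ u
      split_ifs <;> omega
    · rintro ⟨u, hu⟩
      rw [hmemS] at hu
      by_cases h : σ u = 0 <;> simp [h] at hu
  · intro σ _ σ' _ h
    funext u
    have := congrFun h u
    split_ifs at this <;> omega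
  · intro τ hτ
    obtain ⟨h1, h2⟩ := Finset.mem_filter.1 hτ
    simp only [Fintype.mem_piFinset, Finset.mem_range] at h1
    have h3 : ∀ u, τ u ≠ 1 ∧ τ u ≠ 2 := fun u => by
      constructor <;> exact fun h => h2 ⟨u, (hmemS τ u).2 (by omega)⟩
    refine ⟨fun u => τ u - 2, ?_, ?_⟩
    · simp only [Fintype.mem_piFinset, Finset.mem_range]
      intro u
      have := h1 u
      omega
    · funext u
      have := h3 u
      dsimp only
      split_ifs <;> omega
  · intro σ _
    unfold superWeight pairWeight
    congr 1
    · congr 1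
      refine Finset.prod_congr rfl fun u _ => Finset.prod_congr rfl fun v _ => ?_
      congr 1
      unfold superGT
      rw [decide_eq_decide]
      by_cases h : σ u = 0 <;> by_cases h' : σ v = 0 <;> simp [h, h']
      omega
    · refine Finset.prod_congr rfl fun u _ => ?_
      by_cases h : σ u = 0
      · simp [h]
      · rw [if_neg h, if_neg (by rwa [hφ0]), if_neg (by dsimp only; rw [if_neg h]; omega)]

/-- The letters of a super-filling other than `0` and `1`. -/
def upperLetters (τ : ι → ℕ) : Finset ℕ := (Finset.univ.image τ).filter fun x => 2 ≤ x

theorem mem_upperLetters (τ : ι → ℕ) (x : ℕ) : x ∈ upperLetters τ ↔ 2 ≤ x ∧ ∃ u, τ u = x := by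
  simp [upperLetters, and_comm]

theorem card_upperLetters_le (τ : ι → ℕ) : (upperLetters τ).card ≤ Fintype.card ι :=
  (Finset.card_filter_le _ _).trans Finset.card_image_le

/-- The sum over the super-fillings whose upper letters are the elements of `A`. -/
def superSumOn [DecidableEq ι] (c : ι → ι → Bool → K) (A : Finset ℕ) : Polynomial K :=
  ∑ τ ∈ (Fintype.piFinset fun _ : ι => Finset.range 2 ∪ A).filter fun τ => upperLetters τ = A,
    superWeight c τ

/-- The weight depends only on the order of the letters and on which of them are `0` and `1`, so the
upper letters can be standardised by the increasing relabelling `φ`. -/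
theorem superSumOn_eq [DecidableEq ι] (c : ι → ι → Bool → K) (A : Finset ℕ)
    (hA : ∀ x ∈ A, 2 ≤ x) : superSumOn c A = superSumOn c (Finset.Ico 2 (2 + A.card)) := by
  classical
  set φ : ℕ → ℕ := fun x => if x < 2 then x else
    if h : x - 2 < A.card then A.orderEmbOfFin rfl ⟨x - 2, h⟩ else 0 with hφ
  have hφlow : ∀ x, x < 2 → φ x = x := fun x hx => by
    rw [hφ]
    exact if_pos hx
  have hφhigh : ∀ x (h2 : 2 ≤ x) (h : x < 2 + A.card),
      φ x = A.orderEmbOfFin rfl ⟨x - 2, by omega⟩ := fun x h2 h => by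
    rw [hφ]
    dsimp only
    rw [if_neg (by omega), dif_pos (by omega)]
  have hφmem : ∀ x, 2 ≤ x → x < 2 + A.card → φ x ∈ A := fun x h2 h => by
    rw [hφhigh x h2 h]
    exact Finset.orderEmbOfFin_mem _ _ _
  have hφlt : ∀ x y, x < 2 + A.card → y < 2 + A.card → x < y → φ x < φ y := fun x y hx hy hxy => by
    by_cases hy2 : y < 2
    · rw [hφlow y hy2, hφlow x (by omega)]
      exact hxy
    · have h1 := hA _ (hφmem y (by omega) hy)
      by_cases hx2 : x < 2
      · rw [hφlow x hx2]
        omega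
      · rw [hφhigh x (by omega) hx, hφhigh y (by omega) hy]
        refine (A.orderEmbOfFin rfl).lt_iff_lt.2 ?_
        rw [Fin.lt_def]
        dsimp only
        omega
  have hφiff : ∀ x y, x < 2 + A.card → y < 2 + A.card → (φ x < φ y ↔ x < y) :=
    fun x y hx hy => by
      refine ⟨fun h => ?_, hφlt x y hx hy⟩
      by_contra hcon
      rcases Nat.lt_or_ge y x with h' | h'
      · exact absurd (hφlt y x hy hx h') (by omega)
      · have : x = y := by omega
        rw [this] at h
        omega
  have hφ2 : ∀ x, x < 2 + A.card → (2 ≤ φ x ↔ 2 ≤ x) := fun x hx => by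
    by_cases hx2 : x < 2
    · rw [hφlow x hx2]
    · have := hA _ (hφmem x (by omega) hx)
      omega
  have hbound : ∀ τ : ι → ℕ,
      τ ∈ Fintype.piFinset (fun _ : ι => Finset.range 2 ∪ Finset.Ico 2 (2 + A.card)) →
      ∀ u, τ u < 2 + A.card := fun τ hτ u => by
    have := (Fintype.mem_piFinset.1 hτ) u
    simp only [Finset.mem_union, Finset.mem_range, Finset.mem_Ico] at this
    omega
  have hsurj : ∀ y ∈ Finset.range 2 ∪ A, ∃ x, x < 2 + A.card ∧ φ x = y := fun y hy => by
    rcases Finset.mem_union.1 hy with h | h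
    · rw [Finset.mem_range] at h
      exact ⟨y, by omega, hφlow y h⟩
    · have : y ∈ Set.range (A.orderEmbOfFin rfl) := by
        rw [Finset.range_orderEmbOfFin]
        exact h
      obtain ⟨i, rfl⟩ := this
      refine ⟨i + 2, by omega, ?_⟩
      rw [hφhigh _ (by omega) (by omega)]
      congr 1
  have hinj : ∀ x y, x < 2 + A.card → y < 2 + A.card → φ x = φ y → x = y :=
    fun x y hx hy h => by
      have h1 := hφiff x y hx hy
      have h2 := hφiff y x hy hx
      omega
  symm
  refine Finset.sum_bij (fun τ _ => fun u => φ (τ u)) ?_ ?_ ?_ ?_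
  · intro τ hτ
    obtain ⟨h1, h2⟩ := Finset.mem_filter.1 hτ
    have hb := hbound τ h1
    refine Finset.mem_filter.2 ⟨Fintype.mem_piFinset.2 fun u => ?_, ?_⟩
    · by_cases hu : τ u < 2
      · rw [hφlow _ hu]
        exact Finset.mem_union_left _ (Finset.mem_range.2 hu)
      · exact Finset.mem_union_right _ (hφmem _ (by omega) (hb u))
    · ext y
      rw [mem_upperLetters]
      constructor
      · rintro ⟨hy, u, rfl⟩
        exact hφmem _ ((hφ2 _ (hb u)).1 hy) (hb u)
      · intro hy
        refine ⟨hA y hy, ?_⟩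
        obtain ⟨x, hx, rfl⟩ := hsurj y (Finset.mem_union_right _ hy)
        have hx2 : x ∈ upperLetters τ := by
          rw [h2, Finset.mem_Ico]
          exact ⟨(hφ2 x hx).1 (hA _ hy), hx⟩
        obtain ⟨u, rfl⟩ := ((mem_upperLetters τ x).1 hx2).2
        exact ⟨u, rfl⟩
  · intro τ hτ τ' hτ' h
    funext u
    exact hinj _ _ (hbound τ (Finset.mem_filter.1 hτ).1 u)
      (hbound τ' (Finset.mem_filter.1 hτ').1 u) (congrFun h u)
  · intro τ hτ
    obtain ⟨h1, h2⟩ := Finset.mem_filter.1 hτ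
    have := fun u => hsurj (τ u) ((Fintype.mem_piFinset.1 h1) u)
    choose τ' hτ' hττ' using this
    refine ⟨τ', Finset.mem_filter.2 ⟨Fintype.mem_piFinset.2 fun u => ?_, ?_⟩, funext hττ'⟩
    · have := hτ' u
      simp only [Finset.mem_union, Finset.mem_range, Finset.mem_Ico]
      omega
    · ext x
      rw [mem_upperLetters, Finset.mem_Ico]
      constructor
      · rintro ⟨hx, u, rfl⟩
        exact ⟨hx, hτ' u⟩
      · rintro ⟨hx, hx'⟩
        refine ⟨hx, ?_⟩
        have hx2 := hφmem x hx hx'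
        rw [← h2] at hx2
        obtain ⟨u, hu⟩ := ((mem_upperLetters τ _).1 hx2).2
        exact ⟨u, hinj _ _ (hτ' u) hx' (by rw [hττ', hu])⟩
  · intro τ hτ
    have hb := hbound τ (Finset.mem_filter.1 hτ).1
    refine (superWeight_comp c τ φ (fun u v => hφiff _ _ (hb u) (hb v)) (fun u => ?_)
      fun u => ?_).symm
    · have := hφ2 _ (hb u)
      by_cases hu : τ u < 2
      · rw [hφlow _ hu]
      · omega
    · have := hφ2 _ (hb u)
      by_cases hu : τ u < 2
      · rw [hφlow _ hu]
      · omega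

/-- Super-fillings are sorted by their set of upper letters, which has at most as many elements as
there are boxes. The number `N` then enters through binomial coefficients of bounded lower index,
hence polynomially. -/
theorem superSum_eq_sum_choose [DecidableEq ι] (c : ι → ι → Bool → K) (N : ℕ) :
    superSum c N = ∑ k ∈ Finset.range (Fintype.card ι + 1),
      (N.choose k : Polynomial K) * superSumOn c (Finset.Ico 2 (2 + k)) := by
  classical
  have h1 : superSum c N = ∑ A ∈ (Finset.Ico 2 (N + 2)).powerset,
      superSumOn c (Finset.Ico 2 (2 + A.card)) := by
    rw [superSum, ← Finset.sum_fiberwise_of_maps_to (g := upperLetters)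
      (t := (Finset.Ico 2 (N + 2)).powerset)]
    · refine Finset.sum_congr rfl fun A hA => ?_
      rw [Finset.mem_powerset] at hA
      rw [← superSumOn_eq c A fun x hx => (Finset.mem_Ico.1 (hA hx)).1, superSumOn]
      refine Finset.sum_congr ?_ fun _ _ => rfl
      ext τ
      simp only [Finset.mem_filter, Fintype.mem_piFinset, Finset.mem_range, Finset.mem_union]
      constructor
      · rintro ⟨h, rfl⟩
        refine ⟨fun u => ?_, rfl⟩
        rw [mem_upperLetters]
        by_cases hu : τ u < 2
        · exact Or.inl hu
        · exact Or.inr ⟨by omega, u, rfl⟩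
      · rintro ⟨h, rfl⟩
        refine ⟨fun u => ?_, rfl⟩
        rcases h u with h | h
        · omega
        · have := Finset.mem_Ico.1 (hA h)
          omega
    · intro τ hτ
      simp only [Fintype.mem_piFinset, Finset.mem_range] at hτ
      rw [Finset.mem_powerset]
      intro x hx
      obtain ⟨hx, u, rfl⟩ := (mem_upperLetters τ x).1 hx
      exact Finset.mem_Ico.2 ⟨hx, hτ u⟩
  have h0 : ∀ k, Fintype.card ι < k → superSumOn c (Finset.Ico 2 (2 + k)) = 0 := fun k hk => by
    refine Finset.sum_eq_zero fun τ hτ => ?_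
    have := card_upperLetters_le τ
    rw [(Finset.mem_filter.1 hτ).2, Nat.card_Ico] at this
    omega
  rw [h1, Finset.sum_powerset_apply_card fun k => superSumOn c (Finset.Ico 2 (2 + k))]
  simp only [Nat.card_Ico, Nat.add_sub_cancel, nsmul_eq_mul]
  have hM : ∀ (f : ℕ → Polynomial K) (a b : ℕ), (∀ k, a ≤ k → f k = 0) → (∀ k, b ≤ k → f k = 0) →
      ∑ k ∈ Finset.range a, f k = ∑ k ∈ Finset.range b, f k := fun f a b ha hb => by
    have e1 := Finset.sum_subset (f := f) (Finset.range_subset_range.2 (le_max_left a b))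
      fun k _ hk => ha k (by simpa using hk)
    have e2 := Finset.sum_subset (f := f) (Finset.range_subset_range.2 (le_max_right a b))
      fun k _ hk => hb k (by simpa using hk)
    exact e1.trans e2.symm
  refine hM _ _ _ (fun k hk => ?_) fun k hk => ?_
  · rw [Nat.choose_eq_zero_of_lt (by omega), Nat.cast_zero, zero_mul]
  · rw [h0 k (by omega), mul_zero]

/-- The letter `0` exceeds nothing and the barred `1` exceeds both `0` and itself. Every comparison
is thus decided by its first letter, and the sum factors over the boxes. -/
theorem superSum_zero [DecidableEq ι] (c : ι → ι → Bool → K) : superSum c 0 =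
    ∏ u, (Polynomial.C (∏ v, c u v false) - Polynomial.X * Polynomial.C (∏ v, c u v true)) := by
  have h1 : ∀ τ ∈ Fintype.piFinset fun _ : ι => Finset.range 2, superWeight c τ =
      ∏ u, if τ u = 0 then Polynomial.C (∏ v, c u v false)
        else -Polynomial.X * Polynomial.C (∏ v, c u v true) := fun τ hτ => by
    simp only [Fintype.mem_piFinset, Finset.mem_range] at hτ
    rw [superWeight, map_prod, ← Finset.prod_mul_distrib]
    refine Finset.prod_congr rfl fun u _ => ?_
    have hu := hτ u
    by_cases h : τ u = 0
    · have : ∀ v, superGT (τ u) (τ v) = false := fun v => by simp [superGT, h]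
      simp [h, superGT]
    · have h' : τ u = 1 := by omega
      have : ∀ v, superGT (τ u) (τ v) = true := fun v => by
        have := hτ v
        simp only [superGT, decide_eq_true_eq]
        omega
      simp only [this]
      rw [if_neg h, if_neg h, if_pos h']
      exact mul_comm _ _
  rw [superSum, Finset.sum_congr rfl h1]
  have := Finset.prod_univ_sum (fun _ : ι => Finset.range 2) fun u x =>
    if x = 0 then Polynomial.C (∏ v, c u v false)
        else -Polynomial.X * Polynomial.C (∏ v, c u v true)
  rw [← this]
  refine Finset.prod_congr rfl fun u _ => ?_
  rw [Finset.sum_range_succ, Finset.sum_range_one]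
  simp only [if_true, one_ne_zero, if_false]
  ring

theorem exists_choose_polynomial (k : ℕ) : ∃ p : Polynomial (Polynomial QT),
    ∀ N : ℕ, p.eval (N : Polynomial QT) = (N.choose k : Polynomial QT) := by
  refine ⟨descPochhammer (Polynomial QT) k *
    Polynomial.C (Polynomial.C ((k.factorial : QT)⁻¹)), fun N => ?_⟩
  rw [Polynomial.eval_mul, Polynomial.eval_C, descPochhammer_eval_eq_descFactorial,
    Nat.descFactorial_eq_factorial_mul_choose, Nat.cast_mul]
  have h : (k.factorial : QT) ≠ 0 := Nat.cast_ne_zero.2 (Nat.factorial_ne_zero k)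
  have h2 : (k.factorial : Polynomial QT) * Polynomial.C ((k.factorial : QT)⁻¹) = 1 := by
    rw [← Polynomial.C_eq_natCast, ← Polynomial.C_mul, mul_inv_cancel₀ h, Polynomial.C_1]
  rw [mul_right_comm, h2, one_mul]

/-- The evaluation at `1 - u` of a symmetric series of fillings with pair weights. -/
theorem plethOneSubU_of_pairSeries {β : Type*} [LinearOrder β] (ρ : ι → β)
    (c : ι → ι → Bool → QT) (hc : ∀ u v b, ¬ ρ u < ρ v → c u v b = 1)
    (P : MvPolynomial ℕ+ QT) (hP : ofPowerSums P = pairSeries c) :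
    plethOneSubU P =
      ∏ u, (Polynomial.C (∏ v, c u v false) - Polynomial.X * Polynomial.C (∏ v, c u v true)) := by
  classical
  choose p hp using exists_choose_polynomial
  set g : Polynomial (Polynomial QT) := ∑ k ∈ Finset.range (Fintype.card ι + 1),
    p k * Polynomial.C (superSumOn c (Finset.Ico 2 (2 + k))) with hg
  have hgN : ∀ N : ℕ, g.eval (N : Polynomial QT) = superSum c N := fun N => by
    rw [superSum_eq_sum_choose, hg, Polynomial.eval_finsetSum]
    refine Finset.sum_congr rfl fun k _ => ?_
    rw [Polynomial.eval_mul, Polynomial.eval_C, hp]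
  -- Two polynomials that agree at all natural numbers. The shift by one is the letter cancelled by
  -- the barred letter, so `-1` on the left corresponds to `superSum c 0` on the right.
  have heq : plethInterpolation P = g.comp (Polynomial.X + 1) := by
    refine Polynomial.eq_of_infinite_eval_eq _ _ ?_
    refine Set.Infinite.mono (s := Set.range fun N : ℕ => (N : Polynomial QT)) ?_
      (Set.infinite_range_of_injective Nat.cast_injective)
    rintro _ ⟨N, rfl⟩
    change Polynomial.eval _ _ = Polynomial.eval _ _
    rw [eval_plethInterpolation_of_pairSeries c P hP, ← superSum_succ ρ c hc, ← hgN,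
      Polynomial.eval_comp]
    simp
  have h0 := hgN 0
  rw [← eval_neg_one_plethInterpolation, heq, Polynomial.eval_comp, ← superSum_zero, ← h0]
  simp

/-- The evaluation at `1 - u` depends only on the symmetric series. -/
theorem plethOneSubU_eq_of_ofPowerSums_eq {P P' : MvPolynomial ℕ+ QT}
    (h : ofPowerSums P = ofPowerSums P') : plethOneSubU P = plethOneSubU P' := by
  -- Algebraic independence of the power sums is not needed: the series determines all truncations,
  -- hence the interpolating polynomial at every natural number.
  have heq : plethInterpolation P = plethInterpolation P' := by
    refine Polynomial.eq_of_infinite_eval_eq _ _ ?_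
    refine Set.Infinite.mono (s := Set.range fun N : ℕ => (N : Polynomial QT)) ?_
      (Set.infinite_range_of_injective Nat.cast_injective)
    rintro _ ⟨N, rfl⟩
    change Polynomial.eval _ _ = Polynomial.eval _ _
    rw [← aeval_truncPowerSums, ← aeval_truncPowerSums]
    congr 1
    refine MvPolynomial.ext _ _ fun m => ?_
    rw [coeff_truncPowerSums, coeff_truncPowerSums, h]
  rw [← eval_neg_one_plethInterpolation, ← eval_neg_one_plethInterpolation, heq]

end Super

/-! ### The Macdonald polynomial as a series of fillings with pair weights -/

section Macdonald

/-- The position of a box in the reading order. -/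
def readingPos (u : ℕ × ℕ) : ℕᵒᵈ ×ₗ ℕ := toLex (OrderDual.toDual u.1, u.2)

theorem readingPos_lt (u v : ℕ × ℕ) :
    readingPos u < readingPos v ↔ v.1 < u.1 ∨ (u.1 = v.1 ∧ u.2 < v.2) := by
  simp [readingPos, Prod.Lex.toLex_lt_toLex]

theorem readingPos_injective : Function.Injective readingPos := fun u v h => by
  simpa [readingPos, Prod.ext_iff] using h

theorem readingPos_le (u v : ℕ × ℕ) :
    readingPos u ≤ readingPos v ↔ v.1 < u.1 ∨ (u.1 = v.1 ∧ u.2 ≤ v.2) := by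
  simp [readingPos, Prod.Lex.toLex_le_toLex]

/-- `u` attacks `v` and precedes it in the reading order. -/
def AttacksAfter (u v : ℕ × ℕ) : Prop := (u.1 = v.1 ∧ u.2 < v.2) ∨ (u.1 = v.1 + 1 ∧ v.2 < u.2)

/-- `u` is the box immediately above `v`. -/
def IsAbove (u v : ℕ × ℕ) : Prop := u.1 = v.1 + 1 ∧ u.2 = v.2

theorem attack_and_precedes_iff (u v : ℕ × ℕ) : Attack u v ∧ Precedes u v ↔ AttacksAfter u v := by
  have : u = v ↔ u.1 = v.1 ∧ u.2 = v.2 := Prod.ext_iff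
  have : v = u ↔ v.1 = u.1 ∧ v.2 = u.2 := Prod.ext_iff
  unfold Attack AttacksDown Precedes AttacksAfter
  grind

/-- The weight of a descent at `u`. -/
def descentWeight (μ : YoungDiagram) (u : ℕ × ℕ) : QT := q⁻¹ ^ arm μ u * t ^ (leg μ u + 1)

open Classical in
/-- The pair weights of the Macdonald polynomial. -/
def macdonaldPair (μ : YoungDiagram) (u v : ℕ × ℕ) (b : Bool) : QT :=
  if b then (if AttacksAfter u v then q else 1) * (if IsAbove u v then descentWeight μ u else 1)
  else 1

theorem macdonaldPair_eq_one (μ : YoungDiagram) (u v : ℕ × ℕ) (b : Bool)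
    (h : ¬ readingPos u < readingPos v) : macdonaldPair μ u v b = 1 := by
  rw [readingPos_lt] at h
  unfold macdonaldPair
  split_ifs with h1 h2 h3 h3
  any_goals simp
  all_goals
    unfold AttacksAfter IsAbove at *
    omega

theorem prod_isAbove_eq {μ : YoungDiagram} (σ : Filling μ) (u : {c // c ∈ μ.cells}) [DecidableRel IsAbove]
    [Decidable (u ∈ descents σ)] (y : QT) :
    (∏ v : {c // c ∈ μ.cells}, if σ v < σ u then (if IsAbove u.1 v.1 then y else 1) else 1) =
      if u ∈ descents σ then y else 1 := by
  classical
  by_cases h : u ∈ descents σ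
  · rw [if_pos h]
    obtain ⟨v, h1, h2, h3⟩ := (Finset.mem_filter.1 h).2
    rw [Finset.prod_eq_single v]
    · rw [if_pos h3, if_pos ⟨h1, h2⟩]
    · intro w _ hw
      split_ifs with h4 h5
      · refine absurd (Subtype.ext (Prod.ext ?_ ?_)) hw
        · have := h5.1
          omega
        · have := h5.2
          omega
      · rfl
      · rfl
    · simp
  · rw [if_neg h]
    refine Finset.prod_eq_one fun v _ => ?_
    split_ifs with h4 h5
    · exact absurd (Finset.mem_filter.2 ⟨Finset.mem_univ _, v, h5.1, h5.2, h4⟩) h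
    · rfl
    · rfl

theorem q_ne_zero : q ≠ 0 := by
  unfold q
  rw [Ne, FaithfulSMul.algebraMap_eq_zero_iff]
  exact MvPolynomial.X_ne_zero 0

theorem pairWeight_macdonaldPair {μ : YoungDiagram} (σ : Filling μ) :
    pairWeight (fun u v => macdonaldPair μ u.1 v.1) σ = q ^ inv σ * t ^ maj σ := by
  classical
  have h1 : ∀ u v : {c // c ∈ μ.cells}, macdonaldPair μ u.1 v.1 (decide (σ v < σ u)) =
      (if AttacksAfter u.1 v.1 ∧ σ v < σ u then q else 1) *
        (if σ v < σ u then (if IsAbove u.1 v.1 then descentWeight μ u.1 else 1) else 1) :=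
    fun u v => by
      unfold macdonaldPair
      by_cases h : σ v < σ u
      · simp only [h, decide_true, if_true, and_true]
      · simp [h]
  simp only [pairWeight, h1, Finset.prod_mul_distrib]
  have h2 : (∏ u : {c // c ∈ μ.cells}, ∏ v : {c // c ∈ μ.cells},
      if AttacksAfter u.1 v.1 ∧ σ v < σ u then q else 1) = q ^ (inversions σ).card := by
    rw [← Finset.prod_product', ← Finset.prod_filter, Finset.prod_const]
    congr 2
    ext p
    simp only [inversions, Finset.mem_filter, Finset.univ_product_univ, Finset.mem_univ, true_and,
      ← attack_and_precedes_iff, and_assoc]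
  have h3 : (∏ u : {c // c ∈ μ.cells}, ∏ v : {c // c ∈ μ.cells},
      if σ v < σ u then (if IsAbove u.1 v.1 then descentWeight μ u.1 else 1) else 1) =
        q⁻¹ ^ (∑ u ∈ descents σ, arm μ u) * t ^ maj σ := by
    simp only [prod_isAbove_eq]
    rw [Finset.prod_ite_mem, Finset.univ_inter]
    simp only [descentWeight]
    rw [Finset.prod_mul_distrib, Finset.prod_pow_eq_pow_sum, Finset.prod_pow_eq_pow_sum]
    rfl
  rw [h2, h3, ← mul_assoc]
  congr 1
  rw [inv, zpow_sub₀ q_ne_zero, ← Nat.cast_sum, zpow_natCast, zpow_natCast, inv_pow, div_eq_mul_inv]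

theorem macdonald_eq_pairSeries (μ : YoungDiagram) :
    macdonald μ = pairSeries fun u v : {c // c ∈ μ.cells} => macdonaldPair μ u.1 v.1 := by
  funext m
  exact Finset.sum_congr (by ext σ; simp only [Finset.mem_filter, Fintype.mem_piFinset]; rfl) fun σ _ => (pairWeight_macdonaldPair σ).symm

/-- Between `u` and the box just below it, the reading order runs through the rest of the row of `u`
and the beginning of the next row. Two boxes of this window attack each other unless they are its
two ends, so descent weights sit only on maximal windows and everything strictly nested has weight
`q`. -/
theorem isStaircase_macdonaldPair (μ : YoungDiagram) :
    IsStaircase (fun u : {c // c ∈ μ.cells} => readingPos u.1)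
      (fun u v => macdonaldPair μ u.1 v.1 true) q Finset.univ := by
  rintro ⟨u, hu⟩ - ⟨v, hv⟩ - h
  refine ⟨?_, ?_⟩
  · by_contra hlt
    exact h (macdonaldPair_eq_one μ u v true hlt)
  · rintro ⟨u', hu'⟩ - ⟨v', hv'⟩ - h1 h2 h3 h4
    rw [readingPos_le] at h1 h3
    rw [readingPos_lt] at h2
    have h5 : ¬ (u' = u ∧ v' = v) := by
      rintro ⟨rfl, rfl⟩
      simp at h4
    simp only [Prod.ext_iff] at h5
    have h6 : AttacksAfter u v ∨ IsAbove u v := by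
      by_contra hcon
      push Not at hcon
      exact h (by simp [macdonaldPair, hcon.1, hcon.2])
    have h7 : AttacksAfter u' v' ∧ ¬ IsAbove u' v' := by
      simp only [AttacksAfter, IsAbove] at *
      omega
    simp [macdonaldPair, h7.1, h7.2]

theorem isAdjSymmetric_macdonald (μ : YoungDiagram) : IsAdjSymmetric (macdonald μ) := by
  rw [macdonald_eq_pairSeries]
  exact isAdjSymmetric_pairSeries (fun u : {c // c ∈ μ.cells} => readingPos u.1)
    (readingPos_injective.comp Subtype.val_injective) _ (fun u v => rfl) q
    (isStaircase_macdonaldPair μ)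

theorem isHomogeneousOfDegree_macdonald (μ : YoungDiagram) :
    IsHomogeneousOfDegree μ.card (macdonald μ) := by
  intro m hm
  obtain ⟨σ, hσ, -⟩ := Finset.exists_ne_zero_of_sum_ne_zero hm
  rw [← (Finset.mem_filter.1 hσ).2]
  change (exponent σ).degree = _
  rw [degree_exponent, Fintype.card_coe]

theorem exists_ofPowerSums_macdonald (μ : YoungDiagram) : ∃ P, ofPowerSums P = macdonald μ :=
  exists_ofPowerSums_eq (isAdjSymmetric_macdonald μ) (isHomogeneousOfDegree_macdonald μ)

/-- The arm counts the boxes to the right. The row below, if there is one, contains all `u.2`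
positions strictly to the left. -/
theorem card_attacksAfter (μ : YoungDiagram) (u : ℕ × ℕ) (hu : u ∈ μ.cells)
    [DecidablePred (AttacksAfter u)] : (μ.cells.filter (AttacksAfter u)).card =
      arm μ u + if u.1 = 0 then 0 else u.2 := by
  classical
  obtain ⟨i, j⟩ := u
  have hu' : (i, j) ∈ μ := (YoungDiagram.mem_cells _).1 hu
  have e : μ.cells.filter (AttacksAfter (i, j)) =
      (Finset.Ico (j + 1) (μ.rowLen i)).image (fun k => (i, k)) ∪
        (if i = 0 then ∅ else (Finset.range j).image fun k => (i - 1, k)) := by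
    ext ⟨i', j'⟩
    simp only [Finset.mem_filter, YoungDiagram.mem_cells, AttacksAfter, Finset.mem_union,
      Finset.mem_image, Finset.mem_Ico, Prod.mk.injEq]
    constructor
    · rintro ⟨h, h' | h'⟩
      · refine Or.inl ⟨j', ⟨h'.2, ?_⟩, h'.1, rfl⟩
        rw [← YoungDiagram.mem_iff_lt_rowLen, h'.1]
        exact h
      · refine Or.inr ?_
        rw [if_neg (by omega), Finset.mem_image]
        exact ⟨j', Finset.mem_range.2 h'.2, by rw [Prod.mk.injEq]; omega⟩
    · rintro (⟨k, hk, rfl, rfl⟩ | h)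
      · exact ⟨YoungDiagram.mem_iff_lt_rowLen.2 hk.2, Or.inl ⟨rfl, hk.1⟩⟩
      · split_ifs at h with hi
        · simp at h
        · obtain ⟨k, hk, h⟩ := Finset.mem_image.1 h
          rw [Finset.mem_range] at hk
          rw [Prod.mk.injEq] at h
          refine ⟨μ.up_left_mem (by omega) (by omega) hu', Or.inr ⟨by omega, by omega⟩⟩
  rw [e, Finset.card_union_of_disjoint]
  · rw [Finset.card_image_of_injective _ fun a b h => (Prod.mk.inj h).2, Nat.card_Ico]
    congr 1
    split_ifs
    · rfl
    · rw [Finset.card_image_of_injective _ fun a b h => (Prod.mk.inj h).2, Finset.card_range]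
  · rw [Finset.disjoint_left]
    intro x hx hx'
    obtain ⟨k, -, rfl⟩ := Finset.mem_image.1 hx
    split_ifs at hx' with hi
    · simp at hx'
    · obtain ⟨k', -, h⟩ := Finset.mem_image.1 hx'
      rw [Prod.mk.injEq] at h
      omega

/-- Above the bottom row, the factor `q ^ arm` from the boxes to the right cancels against the `q⁻¹
^ arm` of the descent weight. -/
theorem prod_macdonaldPair (μ : YoungDiagram) (u : ℕ × ℕ) (hu : u ∈ μ.cells) :
    ∏ v ∈ μ.cells, macdonaldPair μ u v true =
      if u.1 = 0 then q ^ arm μ u else q ^ u.2 * t ^ (leg μ u + 1) := by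
  classical
  simp only [macdonaldPair, if_true]
  rw [Finset.prod_mul_distrib, ← Finset.prod_filter, Finset.prod_const, card_attacksAfter μ u hu]
  obtain ⟨i, j⟩ := u
  have hu' : (i, j) ∈ μ := (YoungDiagram.mem_cells _).1 hu
  by_cases hi : i = 0
  · rw [if_pos hi, if_pos hi, add_zero, Finset.prod_eq_one, mul_one]
    intro v _
    rw [if_neg]
    unfold IsAbove
    simp only
    omega
  · rw [if_neg hi, if_neg hi, Finset.prod_eq_single (i - 1, j)]
    · rw [if_pos ⟨by dsimp only; omega, rfl⟩, descentWeight, pow_add, inv_pow]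
      have := pow_ne_zero (arm μ (i, j)) q_ne_zero
      field_simp
    · rintro ⟨i', j'⟩ _ hne
      rw [if_neg]
      unfold IsAbove
      simp only [Ne, Prod.mk.injEq] at hne ⊢
      omega
    · exact fun h => absurd ((YoungDiagram.mem_cells _).2
        (μ.up_left_mem (Nat.sub_le i 1) le_rfl hu')) h

/-- The evaluation of a Macdonald polynomial at `1 - u`. -/
theorem plethOneSubU_of_macdonald (μ : YoungDiagram) (P : MvPolynomial ℕ+ QT)
    (hP : ofPowerSums P = macdonald μ) : plethOneSubU P =
      ∏ c ∈ μ.cells, (1 - Polynomial.X * Polynomial.C (q ^ c.2 * t ^ c.1)) := by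
  classical
  rw [macdonald_eq_pairSeries] at hP
  rw [plethOneSubU_of_pairSeries (fun u : {c // c ∈ μ.cells} => readingPos u.1) _
    (fun u v b h => macdonaldPair_eq_one μ u.1 v.1 b h) P hP]
  have h1 : ∀ u : {c // c ∈ μ.cells}, (∏ v : {c // c ∈ μ.cells}, macdonaldPair μ u.1 v.1 false) = 1 :=
    fun u => Finset.prod_eq_one fun v _ => rfl
  have h2 : ∀ u : {c // c ∈ μ.cells}, (∏ v : {c // c ∈ μ.cells}, macdonaldPair μ u.1 v.1 true) =
      if u.1.1 = 0 then q ^ arm μ u.1 else q ^ u.1.2 * t ^ (leg μ u.1 + 1) := fun u => by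
    rw [← prod_macdonaldPair μ u.1 u.2]
    exact Finset.prod_coe_sort μ.cells fun v => macdonaldPair μ u.1 v true
  simp only [h1, h2, Polynomial.C_1]
  rw [Finset.prod_coe_sort μ.cells fun u => (1 - Polynomial.X * Polynomial.C
    (if u.1 = 0 then q ^ arm μ u else q ^ u.2 * t ^ (leg μ u + 1)))]
  -- Reversing the bottom row turns arms into column indices. Reversing the part of each column
  -- above the bottom row turns `leg + 1` into the row index.
  set φ : ℕ × ℕ → ℕ × ℕ := fun c =>
    if c.1 = 0 then (0, μ.rowLen 0 - (c.2 + 1)) else (μ.colLen c.2 - c.1, c.2) with hφ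
  have hmem : ∀ c ∈ μ.cells, c.2 < μ.rowLen c.1 ∧ c.1 < μ.colLen c.2 := fun c hc => by
    have hc : (c.1, c.2) ∈ μ := (YoungDiagram.mem_cells _).1 hc
    exact ⟨YoungDiagram.mem_iff_lt_rowLen.1 hc, YoungDiagram.mem_iff_lt_colLen.1 hc⟩
  have hφmem : ∀ c ∈ μ.cells, φ c ∈ μ.cells := fun c hc => by
    obtain ⟨h1, h2⟩ := hmem c hc
    rw [hφ]
    dsimp only
    split_ifs with h
    · rw [h] at h1
      exact (YoungDiagram.mem_cells _).2 (YoungDiagram.mem_iff_lt_rowLen.2 (by omega))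
    · exact (YoungDiagram.mem_cells _).2 (YoungDiagram.mem_iff_lt_colLen.2 (by omega))
  have hφφ : ∀ c ∈ μ.cells, φ (φ c) = c := fun c hc => by
    obtain ⟨h1, h2⟩ := hmem c hc
    obtain ⟨i, j⟩ := c
    simp only at h1 h2
    by_cases h : i = 0
    · subst h
      simp only [hφ, if_true, Prod.mk.injEq, true_and]
      omega
    · simp only [hφ, h, if_false]
      rw [if_neg (by omega), Prod.mk.injEq]
      omega
  refine Finset.prod_nbij' φ φ hφmem hφmem hφφ hφφ fun c hc => ?_
  obtain ⟨h1, h2⟩ := hmem c hc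
  by_cases h : c.1 = 0
  · simp only [hφ, h, if_true, arm, pow_zero, mul_one]
  · simp only [hφ, h, if_false, leg]
    rw [show μ.colLen c.2 - (c.1 + 1) + 1 = μ.colLen c.2 - c.1 by omega]

end Macdonald

/-! ### Schur functions at `1 - u` -/

section SchurEvaluation

open Classical in
/-- The pair weights imposing the conditions of semistandard tableaux. -/
def schurPair (u v : ℕ × ℕ) (b : Bool) : QT :=
  (if u.1 = v.1 ∧ u.2 < v.2 ∧ b = true then 0 else 1) *
    (if u.2 = v.2 ∧ v.1 < u.1 ∧ b = false then 0 else 1)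

theorem schurPair_eq_one (u v : ℕ × ℕ) (b : Bool) (h : ¬ readingPos u < readingPos v) :
    schurPair u v b = 1 := by
  rw [readingPos_lt] at h
  unfold schurPair
  rw [if_neg (by omega), if_neg (by omega), mul_one]

/-- The filling is a semistandard tableau. -/
def IsSemistandard {μ : YoungDiagram} (σ : Filling μ) : Prop :=
  ∀ u v : {c // c ∈ μ.cells}, (u.1.1 = v.1.1 → u.1.2 < v.1.2 → σ u ≤ σ v) ∧
    (u.1.2 = v.1.2 → v.1.1 < u.1.1 → σ v < σ u)

open Classical in
theorem pairWeight_schurPair {μ : YoungDiagram} (σ : Filling μ) :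
    pairWeight (fun u v => schurPair u.1 v.1) σ = if IsSemistandard σ then 1 else 0 := by
  split_ifs with h
  · refine Finset.prod_eq_one fun u _ => Finset.prod_eq_one fun v _ => ?_
    have := h u v
    simp only [schurPair, decide_eq_true_eq, decide_eq_false_iff_not]
    rw [if_neg (by grind), if_neg (by grind), mul_one]
  · have : ∃ u v : {c // c ∈ μ.cells}, schurPair u.1 v.1 (decide (σ v < σ u)) = 0 := by
      by_contra hcon
      push Not at hcon
      refine h fun u v => ?_
      have := hcon u v
      simp only [schurPair, decide_eq_true_eq, decide_eq_false_iff_not, ne_eq, mul_eq_zero,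
        ite_eq_left_iff, one_ne_zero, imp_false, not_not] at this
      constructor
      · intro h1 h2
        by_contra h3
        exact this (Or.inl ⟨h1, h2, by omega⟩)
      · intro h1 h2
        by_contra h3
        exact this (Or.inr ⟨h1, h2, h3⟩)
    obtain ⟨u, v, huv⟩ := this
    exact Finset.prod_eq_zero (Finset.mem_univ u) (Finset.prod_eq_zero (Finset.mem_univ v) huv)

/-- Semistandard tableaux are semistandard fillings. -/
def tableauEquiv (μ : YoungDiagram) (m : ℕ →₀ ℕ) :
    {T : SemistandardYoungTableau μ // tableauContent T = m} ≃
      {σ : Filling μ // IsSemistandard σ ∧ content σ = m} where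
  toFun T := ⟨fun u => T.1 u.1.1 u.1.2, fun u v => by
      constructor
      · intro h h'
        change T.1 u.1.1 u.1.2 ≤ T.1 v.1.1 v.1.2
        rw [h]
        exact T.1.row_weak h' ((YoungDiagram.mem_cells _).1 v.2)
      · intro h h'
        change T.1 v.1.1 v.1.2 < T.1 u.1.1 u.1.2
        rw [← h]
        exact T.1.col_strict h' ((YoungDiagram.mem_cells _).1 u.2), by
      refine Eq.trans ?_ T.2
      exact Finset.sum_coe_sort μ.cells fun c => Finsupp.single (T.1 c.1 c.2) 1⟩
  invFun σ := ⟨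
    { entry := fun i j => if h : (i, j) ∈ μ.cells then σ.1 ⟨(i, j), h⟩ else 0
      row_weak' := by
        intro i j1 j2 hj h
        have h1 : (i, j1) ∈ μ := μ.up_left_mem le_rfl hj.le h
        rw [dif_pos ((YoungDiagram.mem_cells _).2 h), dif_pos ((YoungDiagram.mem_cells _).2 h1)]
        exact (σ.2.1 _ _).1 rfl hj
      col_strict' := by
        intro i1 i2 j hi h
        have h1 : (i1, j) ∈ μ := μ.up_left_mem hi.le le_rfl h
        rw [dif_pos ((YoungDiagram.mem_cells _).2 h), dif_pos ((YoungDiagram.mem_cells _).2 h1)]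
        exact (σ.2.1 _ _).2 rfl hi
      zeros' := by
        intro i j h
        exact dif_neg h }, by
      refine Eq.trans ?_ σ.2.2
      rw [tableauContent, ← Finset.sum_coe_sort]
      refine Finset.sum_congr rfl fun u _ => ?_
      congr 1
      exact dif_pos u.2⟩
  left_inv T := by
    refine Subtype.ext (SemistandardYoungTableau.ext fun i j => ?_)
    change (if h : (i, j) ∈ μ.cells then T.1 i j else 0) = T.1 i j
    split_ifs with h
    · rfl
    · exact (T.1.zeros h).symm
  right_inv σ := by
    refine Subtype.ext (funext fun u => ?_)
    exact dif_pos u.2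

/-- This form serves the evaluation at `1 - u`. It does not give symmetry through
`isAdjSymmetric_pairSeries`, since the weights at `false` are not all `1`. -/
theorem schur_eq_pairSeries (μ : YoungDiagram) :
    schur μ = pairSeries fun u v : {c // c ∈ μ.cells} => schurPair u.1 v.1 := by
  classical
  funext m
  rw [schur, Nat.card_congr (tableauEquiv μ m), pairSeries]
  simp only [pairWeight_schurPair]
  rw [Finset.sum_boole, Nat.subtype_card]
  intro σ
  simp only [Finset.mem_filter, Fintype.mem_piFinset]
  constructor
  · rintro ⟨⟨-, h⟩, h'⟩
    exact ⟨h', h⟩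
  · rintro ⟨h, rfl⟩
    exact ⟨⟨mem_support_exponent σ, rfl⟩, h⟩

theorem prod_schurPair_false (μ : YoungDiagram) (u : ℕ × ℕ) (hu : u ∈ μ.cells) :
    ∏ v ∈ μ.cells, schurPair u v false = if u.1 = 0 then 1 else 0 := by
  have hu' : (u.1, u.2) ∈ μ := (YoungDiagram.mem_cells _).1 hu
  split_ifs with h
  · refine Finset.prod_eq_one fun v _ => ?_
    unfold schurPair
    rw [if_neg (by simp), if_neg (by omega), mul_one]
  · refine Finset.prod_eq_zero (i := (0, u.2)) ((YoungDiagram.mem_cells _).2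
      (μ.up_left_mem (Nat.zero_le _) le_rfl hu')) ?_
    unfold schurPair
    rw [if_pos (c := u.2 = _ ∧ _) ⟨rfl, Nat.pos_of_ne_zero h, rfl⟩, mul_zero]

theorem prod_schurPair_true (μ : YoungDiagram) (u : ℕ × ℕ) :
    ∏ v ∈ μ.cells, schurPair u v true = if u.2 + 1 < μ.rowLen u.1 then 0 else 1 := by
  split_ifs with h
  · refine Finset.prod_eq_zero (i := (u.1, u.2 + 1)) ((YoungDiagram.mem_cells _).2
      (YoungDiagram.mem_iff_lt_rowLen.2 h)) ?_
    unfold schurPair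
    rw [if_pos (c := u.1 = _ ∧ _) ⟨rfl, Nat.lt_succ_self _, rfl⟩, zero_mul]
  · refine Finset.prod_eq_one fun v hv => ?_
    have hv' : (v.1, v.2) ∈ μ := (YoungDiagram.mem_cells _).1 hv
    rw [YoungDiagram.mem_iff_lt_rowLen] at hv'
    unfold schurPair
    rw [if_neg, if_neg (by simp), mul_one]
    rintro ⟨h1, h2, -⟩
    rw [h1] at h
    omega

theorem exists_ofPowerSums_schur (μ : YoungDiagram) : ∃ P, ofPowerSums P = schur μ :=
  exists_ofPowerSums_eq (isAdjSymmetric_schur μ) (isHomogeneousOfDegree_schur μ)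

/-- The letter `0` can only stand in the bottom row, and the barred letter only at the end of a row;
the two terms of each factor record these possibilities. -/
theorem plethOneSubU_of_schur (μ : YoungDiagram) (P : MvPolynomial ℕ+ QT)
    (hP : ofPowerSums P = schur μ) : plethOneSubU P =
      ∏ c ∈ μ.cells, ((if c.1 = 0 then 1 else 0) -
        if c.2 + 1 < μ.rowLen c.1 then 0 else Polynomial.X) := by
  classical
  rw [schur_eq_pairSeries] at hP
  rw [plethOneSubU_of_pairSeries (fun u : {c // c ∈ μ.cells} => readingPos u.1) _
    (fun u v b h => schurPair_eq_one u.1 v.1 b h) P hP]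
  refine Eq.trans ?_ (Finset.prod_coe_sort μ.cells fun c : ℕ × ℕ =>
    (if c.1 = 0 then 1 else 0) - if c.2 + 1 < μ.rowLen c.1 then 0 else (Polynomial.X : Polynomial QT))
  refine Finset.prod_congr rfl fun u _ => ?_
  have h1 := (Finset.prod_coe_sort μ.cells fun v => schurPair u.1 v false).trans
    (prod_schurPair_false μ u.1 u.2)
  have h2 := (Finset.prod_coe_sort μ.cells fun v => schurPair u.1 v true).trans
    (prod_schurPair_true μ u.1)
  rw [h1, h2]
  split_ifs <;> simp

theorem mem_hook (n s : ℕ) (h : s < n) (i j : ℕ) :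
    (i, j) ∈ hook n s h ↔ (i = 0 ∧ j < n - s) ∨ (1 ≤ i ∧ i ≤ s ∧ j = 0) := by
  rw [hook, YoungDiagram.mem_ofRowLens]
  cases i with
  | zero => simp
  | succ i =>
    simp only [List.length_cons, List.length_replicate, List.getElem_cons_succ,
      List.getElem_replicate]
    constructor
    · rintro ⟨h1, h2⟩
      omega
    · rintro (h' | h')
      · omega
      · exact ⟨by omega, by omega⟩

theorem cells_hook (n s : ℕ) (h : s < n) : (hook n s h).cells =
    (Finset.range (n - s)).image (fun j => (0, j)) ∪ (Finset.Icc 1 s).image fun i => (i, 0) := by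
  ext ⟨i, j⟩
  rw [YoungDiagram.mem_cells, mem_hook]
  simp only [Finset.mem_union, Finset.mem_image, Finset.mem_range, Finset.mem_Icc, Prod.mk.injEq]
  constructor
  · rintro (⟨rfl, h⟩ | ⟨h1, h2, rfl⟩)
    · exact Or.inl ⟨j, h, rfl, rfl⟩
    · exact Or.inr ⟨i, ⟨h1, h2⟩, rfl, rfl⟩
  · rintro (⟨k, h, rfl, rfl⟩ | ⟨k, h, rfl, rfl⟩)
    · exact Or.inl ⟨rfl, h⟩
    · exact Or.inr ⟨h.1, h.2, rfl⟩

theorem disjoint_hook (n s : ℕ) : Disjoint ((Finset.range (n - s)).image fun j => ((0 : ℕ), j))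
    ((Finset.Icc 1 s).image fun i => (i, 0)) := by
  rw [Finset.disjoint_left]
  intro x hx hx'
  obtain ⟨k, -, rfl⟩ := Finset.mem_image.1 hx
  obtain ⟨k', h, h'⟩ := Finset.mem_image.1 hx'
  rw [Finset.mem_Icc] at h
  rw [Prod.mk.injEq] at h'
  omega

theorem card_hook (n s : ℕ) (h : s < n) : (hook n s h).card = n := by
  rw [YoungDiagram.card, cells_hook, Finset.card_union_of_disjoint (disjoint_hook n s),
    Finset.card_image_of_injective _ fun a b h => (Prod.mk.inj h).2,
    Finset.card_image_of_injective _ fun a b h => (Prod.mk.inj h).1]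
  simp
  omega

theorem hook_injective (n : ℕ) : Function.Injective fun s : Fin n => hook n s s.2 := fun s s' h => by
  have key : ∀ i, (i, 0) ∈ hook n s s.2 ↔ (i, 0) ∈ hook n s' s'.2 := fun i => by
    have h : hook n s s.2 = hook n s' s'.2 := h
    rw [h]
  have h1 := key s
  have h2 := key s'
  rw [mem_hook, mem_hook] at h1 h2
  have := s.2
  have := s'.2
  refine Fin.ext ?_
  omega

theorem rowLen_hook_zero (n s : ℕ) (h : s < n) : (hook n s h).rowLen 0 = n - s := by
  have key : ∀ j, j < (hook n s h).rowLen 0 ↔ j < n - s := fun j => by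
    rw [← YoungDiagram.mem_iff_lt_rowLen, mem_hook]
    omega
  have h1 := key ((hook n s h).rowLen 0)
  have h2 := key (n - s)
  omega

/-- In the bottom row the last box gives `1 - u` and the others give `1`. Each of the `s` boxes
above is alone in its row and gives `-u`. -/
theorem prod_cells_hook (n s : ℕ) (h : s < n) :
    ∏ c ∈ (hook n s h).cells, ((if c.1 = 0 then 1 else 0) -
        if c.2 + 1 < (hook n s h).rowLen c.1 then 0 else (Polynomial.X : Polynomial QT)) =
      (1 - Polynomial.X) * (-Polynomial.X) ^ s := by
  rw [cells_hook, Finset.prod_union (disjoint_hook n s),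
    Finset.prod_image fun a _ b _ h => (Prod.mk.inj h).2,
    Finset.prod_image fun a _ b _ h => (Prod.mk.inj h).1]
  congr 1
  · simp only [rowLen_hook_zero]
    rw [Finset.prod_eq_single (n - s - 1)]
    · rw [if_pos trivial, if_neg (by omega)]
    · intro j hj hne
      rw [Finset.mem_range] at hj
      rw [if_pos trivial, if_pos (by omega), sub_zero]
    · intro hn
      exact absurd (Finset.mem_range.2 (by omega)) hn
  · rw [Finset.prod_congr rfl (g := fun _ => -Polynomial.X), Finset.prod_const, Nat.card_Icc,
      Nat.add_sub_cancel]
    intro i hi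
    rw [Finset.mem_Icc] at hi
    rw [if_neg (by omega), if_neg, zero_sub]
    rw [← YoungDiagram.mem_iff_lt_rowLen, mem_hook]
    omega

/-- If `(1, 1)` is a box, then `(1, 0)` is neither in the bottom row nor the last of its row, and
its factor is zero. Otherwise the shape is a hook. -/
theorem eq_hook_or_prod_eq_zero (μ : YoungDiagram) (hμ : μ.card ≠ 0) :
    (∃ s : Fin μ.card, μ = hook μ.card s s.2) ∨
    ∏ c ∈ μ.cells, ((if c.1 = 0 then 1 else 0) -
        if c.2 + 1 < μ.rowLen c.1 then 0 else (Polynomial.X : Polynomial QT)) = 0 := by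
  by_cases h1 : (1, 1) ∈ μ
  · refine Or.inr (Finset.prod_eq_zero (i := (1, 0)) ((YoungDiagram.mem_cells _).2
      (μ.up_left_mem le_rfl (Nat.zero_le 1) h1)) ?_)
    rw [YoungDiagram.mem_iff_lt_rowLen] at h1
    rw [if_neg one_ne_zero, if_pos h1, sub_zero]
  · left
    have h00 : (0, 0) ∈ μ := by
      obtain ⟨⟨i, j⟩, hc⟩ := Finset.card_ne_zero.1 hμ
      exact μ.up_left_mem (Nat.zero_le i) (Nat.zero_le j) ((YoungDiagram.mem_cells _).1 hc)
    have hrow : 0 < μ.rowLen 0 := YoungDiagram.mem_iff_lt_rowLen.1 h00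
    have hcol : 0 < μ.colLen 0 := YoungDiagram.mem_iff_lt_colLen.1 h00
    set a := μ.rowLen 0
    set s := μ.colLen 0 - 1 with hs
    have hlt : s < a + s := by omega
    have hμs : μ = hook (a + s) s hlt := by
      refine YoungDiagram.ext ?_
      ext ⟨i, j⟩
      rw [YoungDiagram.mem_cells, YoungDiagram.mem_cells, mem_hook]
      constructor
      · intro h
        have hj : 1 ≤ i → j = 0 := fun hi => by
          by_contra hj
          exact h1 (μ.up_left_mem hi (Nat.one_le_iff_ne_zero.2 hj) h)
        by_cases hi : i = 0
        · subst hi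
          have := YoungDiagram.mem_iff_lt_rowLen.1 h
          exact Or.inl ⟨rfl, by omega⟩
        · have hj := hj (by omega)
          subst hj
          have := YoungDiagram.mem_iff_lt_colLen.1 h
          exact Or.inr ⟨by omega, by omega, rfl⟩
      · rintro (⟨rfl, h⟩ | ⟨h, h', rfl⟩)
        · exact YoungDiagram.mem_iff_lt_rowLen.2 (by omega)
        · exact YoungDiagram.mem_iff_lt_colLen.2 (by omega)
    have hcard : μ.card = a + s := by
      conv_lhs => rw [hμs]
      exact card_hook _ _ _
    refine ⟨⟨s, by omega⟩, ?_⟩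
    simp only [hcard]
    exact hμs

/-- The evaluation at `1 - u` of a Schur expansion, in positive degree. -/
theorem plethOneSubU_of_schurSum (n : ℕ) (hn : n ≠ 0) (K : YoungDiagram →₀ QT)
    (P : MvPolynomial ℕ+ QT)
    (hP : ofPowerSums P = ∑ μ ∈ K.support.filter (fun μ => μ.card = n), K μ • schur μ) :
    plethOneSubU P = (1 - Polynomial.X) *
      ∑ s : Fin n, Polynomial.C (K (hook n s s.2)) * (-Polynomial.X) ^ (s : ℕ) := by
  classical
  choose S hS using exists_ofPowerSums_schur
  set D := K.support.filter (fun μ => μ.card = n) with hD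
  have h1 : plethOneSubU P = ∑ μ ∈ D, K μ • plethOneSubU (S μ) := by
    rw [plethOneSubU_eq_of_ofPowerSums_eq (P' := ∑ μ ∈ D, K μ • S μ)]
    · rw [map_sum]
      exact Finset.sum_congr rfl fun μ _ => map_smul _ _ _
    · rw [hP, map_sum]
      refine Finset.sum_congr rfl fun μ _ => ?_
      rw [map_smul, hS]
  have h2 : ∀ s : Fin n, plethOneSubU (S (hook n s s.2)) =
      (1 - Polynomial.X) * (-Polynomial.X) ^ (s : ℕ) := fun s => by
    rw [plethOneSubU_of_schur _ _ (hS _), prod_cells_hook]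
  set H : Finset YoungDiagram := Finset.univ.image fun s : Fin n => hook n s s.2 with hH
  have h3 : ∑ μ ∈ D, K μ • plethOneSubU (S μ) = ∑ μ ∈ H, K μ • plethOneSubU (S μ) := by
    rw [← Finset.sum_subset (Finset.inter_subset_left (s₁ := D) (s₂ := H)),
      ← Finset.sum_subset (Finset.inter_subset_right (s₁ := D) (s₂ := H))]
    · intro μ hμ hμ'
      obtain ⟨s, -, rfl⟩ := Finset.mem_image.1 hμ
      have : K (hook n s s.2) = 0 := by
        by_contra h
        exact hμ' (Finset.mem_inter.2 ⟨Finset.mem_filter.2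
          ⟨Finsupp.mem_support_iff.2 h, card_hook _ _ _⟩, hμ⟩)
      rw [this, zero_smul]
    · intro μ hμ hμ'
      have hcard := (Finset.mem_filter.1 hμ).2
      rcases eq_hook_or_prod_eq_zero μ (by omega) with ⟨s, hs⟩ | h
      · refine absurd (Finset.mem_inter.2 ⟨hμ, Finset.mem_image.2
          ⟨⟨s, by rw [← hcard]; exact s.2⟩, Finset.mem_univ _, ?_⟩⟩) hμ'
        subst hcard
        exact hs.symm
      · rw [plethOneSubU_of_schur _ _ (hS _), h, smul_zero]
  rw [h1, h3, hH, Finset.sum_image fun s _ s' _ h => hook_injective n h, Finset.mul_sum]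
  refine Finset.sum_congr rfl fun s _ => ?_
  rw [h2, Polynomial.smul_eq_C_mul]
  ring

end SchurEvaluation

/-! ### Cumulants -/

section Cumulants

variable {α R : Type*} [DecidableEq α] [CommRing R]

/-- The set partitions of `V`, as sets of blocks. -/
def setPartitions (V : Finset α) : Finset (Finset (Finset α)) :=
  V.powerset.powerset.filter fun p => ∅ ∉ p ∧ ∀ x ∈ V, ∃ B ∈ p, x ∈ B ∧ ∀ B' ∈ p, x ∈ B' → B' = B

theorem mem_setPartitions {V : Finset α} {p : Finset (Finset α)} : p ∈ setPartitions V ↔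
    (∀ B ∈ p, B ⊆ V) ∧ ∅ ∉ p ∧ ∀ x ∈ V, ∃ B ∈ p, x ∈ B ∧ ∀ B' ∈ p, x ∈ B' → B' = B := by
  simp [setPartitions, Finset.subset_iff]

theorem sum_finpartition (V : Finset α) (F : Finset (Finset α) → R) :
    ∑ π : Finpartition V, F π.parts = ∑ p ∈ setPartitions V, F p := by
  refine Finset.sum_bij (fun π _ => π.parts) ?_ ?_ ?_ ?_
  · intro π _
    refine mem_setPartitions.2 ⟨fun B hB => π.subset hB, π.empty_notMem_parts, fun x hx => ?_⟩
    obtain ⟨B, hB, hxB⟩ := π.exists_mem hx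
    exact ⟨B, hB, hxB, fun B' hB' hx' => π.eq_of_mem_parts hB' hB hx' hxB⟩
  · intro π _ π' _ h
    exact Finpartition.ext h
  · intro p hp
    obtain ⟨h1, h2, h3⟩ := mem_setPartitions.1 hp
    refine ⟨Finpartition.ofExistsUnique p h1 (fun x hx => ?_) h2, Finset.mem_univ _, rfl⟩
    obtain ⟨B, hB, hxB, hu⟩ := h3 x hx
    exact ⟨B, ⟨hB, hxB⟩, fun B' hB' => hu B' hB'.1 hB'.2⟩
  · intro π _
    rfl

theorem eq_of_mem_setPartitions {V : Finset α} {p : Finset (Finset α)} (hp : p ∈ setPartitions V)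
    {B B' : Finset α} (hB : B ∈ p) (hB' : B' ∈ p) {x : α} (hx : x ∈ B) (hx' : x ∈ B') : B = B' := by
  obtain ⟨h1, -, h3⟩ := mem_setPartitions.1 hp
  obtain ⟨D, -, -, hD⟩ := h3 x (h1 B hB hx)
  rw [hD B hB hx, hD B' hB' hx']

theorem insert_mem_setPartitions {V : Finset α} {p : Finset (Finset α)} {B : Finset α}
    (hB : B ⊆ V) (hne : V \ B ≠ ∅) (hp : p ∈ setPartitions B) :
    insert (V \ B) p ∈ setPartitions V ∧ V \ B ∉ p := by
  obtain ⟨h1, h2, h3⟩ := mem_setPartitions.1 hp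
  have hnot : V \ B ∉ p := fun h => by
    obtain ⟨x, hx⟩ := Finset.nonempty_iff_ne_empty.2 hne
    exact (Finset.mem_sdiff.1 hx).2 (h1 _ h hx)
  refine ⟨mem_setPartitions.2 ⟨fun D hD => ?_, ?_, fun x hx => ?_⟩, hnot⟩
  · rcases Finset.mem_insert.1 hD with rfl | hD
    · exact Finset.sdiff_subset
    · exact (h1 D hD).trans hB
  · intro h
    rcases Finset.mem_insert.1 h with h | h
    · exact hne h.symm
    · exact h2 h
  · by_cases hxB : x ∈ B
    · obtain ⟨D, hD, hxD, hu⟩ := h3 x hxB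
      refine ⟨D, Finset.mem_insert_of_mem hD, hxD, fun D' hD' hx' => ?_⟩
      rcases Finset.mem_insert.1 hD' with rfl | hD'
      · exact absurd hxB (Finset.mem_sdiff.1 hx').2
      · exact hu D' hD' hx'
    · refine ⟨V \ B, Finset.mem_insert_self _ _, Finset.mem_sdiff.2 ⟨hx, hxB⟩, fun D' hD' hx' => ?_⟩
      rcases Finset.mem_insert.1 hD' with rfl | hD'
      · rfl
      · exact absurd (h1 D' hD' hx') hxB

theorem erase_mem_setPartitions {V : Finset α} {p : Finset (Finset α)} {D : Finset α}
    (hp : p ∈ setPartitions V) (hD : D ∈ p) : p.erase D ∈ setPartitions (V \ D) := by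
  obtain ⟨h1, h2, h3⟩ := mem_setPartitions.1 hp
  refine mem_setPartitions.2 ⟨fun B hB x hx => ?_, fun h => h2 (Finset.mem_of_mem_erase h),
    fun x hx => ?_⟩
  · obtain ⟨hne, hB⟩ := Finset.mem_erase.1 hB
    exact Finset.mem_sdiff.2 ⟨h1 B hB hx, fun h => hne (eq_of_mem_setPartitions hp hB hD hx h)⟩
  · obtain ⟨hxV, hxD⟩ := Finset.mem_sdiff.1 hx
    obtain ⟨B, hB, hxB, hu⟩ := h3 x hxV
    exact ⟨B, Finset.mem_erase.2 ⟨fun h => hxD (h ▸ hxB), hB⟩, hxB,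
      fun B' hB' hx' => hu B' (Finset.mem_of_mem_erase hB') hx'⟩

/-- The coefficient of a set partition with `k` blocks in the cumulant. -/
def mobiusCoeff (R : Type*) [CommRing R] (k : ℕ) : R := (-1) ^ (k - 1) * ((k - 1).factorial : R)

/-- The cumulant of the restriction of `Z` to the subsets of `V`. -/
def cumulantOn (Z : Finset α → R) (V : Finset α) : R :=
  ∑ p ∈ setPartitions V, mobiusCoeff R p.card * ∏ B ∈ p, Z B

theorem cumulant_eq_cumulantOn [Fintype α] (Z : Finset α → R) :
    cumulant Z = cumulantOn Z Finset.univ :=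
  sum_finpartition Finset.univ fun p => mobiusCoeff R p.card * ∏ B ∈ p, Z B

/-- For `k ≥ 2` the two terms are opposite, as `(k - 1)! = (k - 1) (k - 2)!`. At `k = 1` the factor
`k - 1` removes the meaningless value of `mobiusCoeff` at `0`. -/
theorem mobiusCoeff_add (k : ℕ) (hk : k ≠ 0) :
    mobiusCoeff R k + ((k - 1 : ℕ) : R) * mobiusCoeff R (k - 1) = if k = 1 then 1 else 0 := by
  obtain ⟨k, rfl⟩ := Nat.exists_eq_succ_of_ne_zero hk
  cases k with
  | zero => simp [mobiusCoeff]
  | succ k =>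
    simp only [mobiusCoeff, Nat.succ_eq_add_one, Nat.add_sub_cancel, Nat.factorial_succ]
    rw [if_neg (by omega)]
    push_cast
    ring

theorem card_filter_notMem_of_mem_setPartitions {V : Finset α} {p : Finset (Finset α)}
    (hp : p ∈ setPartitions V) {v : α} (hv : v ∈ V) :
    (p.filter fun D => v ∉ D).card = p.card - 1 := by
  obtain ⟨-, -, h3⟩ := mem_setPartitions.1 hp
  obtain ⟨B, hB, hvB, hu⟩ := h3 v hv
  have : p.filter (fun D => v ∉ D) = p.erase B := by
    ext D
    simp only [Finset.mem_filter, Finset.mem_erase]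
    constructor
    · rintro ⟨hD, hvD⟩
      exact ⟨fun h => hvD (h ▸ hvB), hD⟩
    · rintro ⟨hne, hD⟩
      exact ⟨hD, fun h => hne (hu D hD h)⟩
  rw [this, Finset.card_erase_of_mem hB]

theorem sum_setPartitions_card_one (V : Finset α) (hV : V ≠ ∅) (Z : Finset α → R) :
    ∑ p ∈ setPartitions V, (if p.card = 1 then 1 else 0) * ∏ B ∈ p, Z B = Z V := by
  rw [Finset.sum_eq_single {V}]
  · simp
  · intro p hp hne
    obtain ⟨h1, h2, h3⟩ := mem_setPartitions.1 hp
    rw [if_neg, zero_mul]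
    intro hc
    obtain ⟨B, rfl⟩ := Finset.card_eq_one.1 hc
    refine hne ?_
    congr 1
    refine Finset.Subset.antisymm (h1 B (Finset.mem_singleton_self B)) fun x hx => ?_
    obtain ⟨D, hD, hxD, -⟩ := h3 x hx
    rwa [Finset.mem_singleton.1 hD] at hxD
  · intro h
    refine absurd (mem_setPartitions.2 ⟨by simp, by simpa using hV.symm, fun x hx => ?_⟩) h
    exact ⟨V, Finset.mem_singleton_self V, hx, fun B hB _ => Finset.mem_singleton.1 hB⟩

/-- The cumulants determine the moments. -/
theorem moment_eq_sum_cumulantOn (Z : Finset α → R) (hZ : Z ∅ = 1) (V : Finset α) {v : α}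
    (hv : v ∈ V) :
    Z V = ∑ B ∈ V.powerset.filter fun B => v ∈ B, cumulantOn Z B * Z (V \ B) := by
  have hVne : V ≠ ∅ := Finset.ne_empty_of_mem hv
  have hVmem : V ∈ V.powerset.filter fun B => v ∈ B :=
    Finset.mem_filter.2 ⟨Finset.mem_powerset_self V, hv⟩
  rw [← Finset.add_sum_erase _ _ hVmem, Finset.sdiff_self, hZ, mul_one]
  -- Adjoining the block `V \ B` to a set partition of `B` gives a set partition of `V` with a
  -- marked block avoiding `v`. A partition with `k` blocks admits `k - 1` marks, and
  -- `mobiusCoeff_add` then leaves only the partition with one block.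
  have key : ∑ B ∈ (V.powerset.filter fun B => v ∈ B).erase V, cumulantOn Z B * Z (V \ B) =
      ∑ p ∈ setPartitions V, ((p.card - 1 : ℕ) : R) * mobiusCoeff R (p.card - 1) *
        ∏ B ∈ p, Z B := by
    have h1 : ∀ p ∈ setPartitions V, ((p.card - 1 : ℕ) : R) * mobiusCoeff R (p.card - 1) *
        ∏ B ∈ p, Z B = ∑ D ∈ p.filter fun D => v ∉ D,
          mobiusCoeff R (p.card - 1) * ∏ B ∈ p, Z B := fun p hp => by
      rw [Finset.sum_const, card_filter_notMem_of_mem_setPartitions hp hv, nsmul_eq_mul, mul_assoc]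
    rw [Finset.sum_congr rfl h1]
    simp only [cumulantOn, Finset.sum_mul]
    rw [Finset.sum_sigma', Finset.sum_sigma']
    have hB : ∀ B ∈ (V.powerset.filter fun B => v ∈ B).erase V,
        B ⊆ V ∧ v ∈ B ∧ V \ B ≠ ∅ := fun B hB => by
      obtain ⟨h1, h2⟩ := Finset.mem_erase.1 hB
      obtain ⟨h2, h3⟩ := Finset.mem_filter.1 h2
      rw [Finset.mem_powerset] at h2
      refine ⟨h2, h3, fun h => h1 ?_⟩
      exact Finset.Subset.antisymm h2 (Finset.sdiff_eq_empty_iff_subset.1 h)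
    refine Finset.sum_bij'
      (fun x _ => (⟨insert (V \ x.1) x.2, V \ x.1⟩ : (_ : Finset (Finset α)) × Finset α))
      (fun x _ => (⟨V \ x.2, x.1.erase x.2⟩ : (_ : Finset α) × Finset (Finset α))) ?_ ?_ ?_ ?_ ?_
    · rintro ⟨B, p⟩ h
      obtain ⟨h1, h2⟩ := Finset.mem_sigma.1 h
      obtain ⟨hBV, hvB, hne⟩ := hB B h1
      refine Finset.mem_sigma.2 ⟨(insert_mem_setPartitions hBV hne h2).1, Finset.mem_filter.2
        ⟨Finset.mem_insert_self _ _, fun h => (Finset.mem_sdiff.1 h).2 hvB⟩⟩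
    · rintro ⟨p, D⟩ h
      obtain ⟨h1, h2⟩ := Finset.mem_sigma.1 h
      obtain ⟨hDp, hvD⟩ := Finset.mem_filter.1 h2
      obtain ⟨k1, k2, -⟩ := mem_setPartitions.1 h1
      refine Finset.mem_sigma.2 ⟨Finset.mem_erase.2 ⟨fun h => ?_, Finset.mem_filter.2
        ⟨Finset.mem_powerset.2 Finset.sdiff_subset, Finset.mem_sdiff.2 ⟨hv, hvD⟩⟩⟩,
        erase_mem_setPartitions h1 hDp⟩
      have : D = ∅ := by
        have h : V \ D = V := h
        rw [Finset.sdiff_eq_self_iff_disjoint] at h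
        exact Finset.disjoint_self_iff_empty D |>.1 (h.mono_left (k1 D hDp))
      exact k2 (this ▸ hDp)
    · rintro ⟨B, p⟩ h
      obtain ⟨h1, h2⟩ := Finset.mem_sigma.1 h
      obtain ⟨hBV, hvB, hne⟩ := hB B h1
      have e1 : V \ (V \ B) = B := Finset.sdiff_sdiff_eq_self hBV
      have e2 := Finset.erase_insert (insert_mem_setPartitions hBV hne h2).2
      simp only [e1, e2]
    · rintro ⟨p, D⟩ h
      obtain ⟨h1, h2⟩ := Finset.mem_sigma.1 h
      obtain ⟨hDp, hvD⟩ := Finset.mem_filter.1 h2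
      have e1 : V \ (V \ D) = D := Finset.sdiff_sdiff_eq_self ((mem_setPartitions.1 h1).1 D hDp)
      have e2 := Finset.insert_erase hDp
      simp only [e1, e2]
    · rintro ⟨B, p⟩ h
      obtain ⟨h1, h2⟩ := Finset.mem_sigma.1 h
      obtain ⟨hBV, hvB, hne⟩ := hB B h1
      have hnot := (insert_mem_setPartitions hBV hne h2).2
      dsimp only
      rw [Finset.card_insert_of_notMem hnot, Finset.prod_insert hnot, Nat.add_sub_cancel]
      ring
  rw [key, cumulantOn, ← Finset.sum_add_distrib]
  conv_lhs => rw [← sum_setPartitions_card_one V hVne Z]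
  refine Finset.sum_congr rfl fun p hp => ?_
  have hp0 : p.card ≠ 0 := fun h => by
    obtain ⟨B, hB, -⟩ := (mem_setPartitions.1 hp).2.2 v hv
    exact Finset.ne_empty_of_mem hB (Finset.card_eq_zero.1 h)
  rw [← mobiusCoeff_add p.card hp0]
  ring

theorem sum_nested_subsets (U : Finset α) (w : α) (F : Finset α → Finset α → Finset α → R) :
    ∑ A ∈ U.powerset.filter (fun A => w ∈ A), ∑ B ∈ A.powerset.filter (fun B => w ∈ B),
      F B (A \ B) (U \ A) = ∑ B ∈ U.powerset.filter (fun B => w ∈ B), ∑ A ∈ (U \ B).powerset,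
        F B A ((U \ B) \ A) := by
  rw [Finset.sum_sigma', Finset.sum_sigma']
  refine Finset.sum_bij' (fun x _ => (⟨x.2, x.1 \ x.2⟩ : (_ : Finset α) × Finset α))
    (fun x _ => (⟨x.1 ∪ x.2, x.1⟩ : (_ : Finset α) × Finset α)) ?_ ?_ ?_ ?_ ?_
  · rintro ⟨A, B⟩ h
    simp only [Finset.mem_sigma, Finset.mem_filter, Finset.mem_powerset] at h ⊢
    exact ⟨⟨h.2.1.trans h.1.1, h.2.2⟩, Finset.sdiff_subset_sdiff h.1.1 le_rfl⟩
  · rintro ⟨B, A⟩ h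
    simp only [Finset.mem_sigma, Finset.mem_filter, Finset.mem_powerset] at h ⊢
    exact ⟨⟨Finset.union_subset h.1.1 (h.2.trans Finset.sdiff_subset),
      Finset.mem_union_left _ h.1.2⟩, Finset.subset_union_left, h.1.2⟩
  · rintro ⟨A, B⟩ h
    simp only [Finset.mem_sigma, Finset.mem_filter, Finset.mem_powerset] at h
    simp only [Finset.union_sdiff_of_subset h.2.1]
  · rintro ⟨B, A⟩ h
    simp only [Finset.mem_sigma, Finset.mem_filter, Finset.mem_powerset] at h
    have : (B ∪ A) \ B = A :=
      Finset.union_sdiff_cancel_left (Finset.disjoint_sdiff.mono_right h.2)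
    simp only [this]
  · rintro ⟨A, B⟩ h
    simp only [Finset.mem_sigma, Finset.mem_filter, Finset.mem_powerset] at h
    dsimp only
    rw [Finset.sdiff_sdiff_left', ← Finset.sdiff_union_distrib, Finset.union_sdiff_of_subset h.2.1]

theorem sum_disjoint_subsets (U : Finset α) (w : α) (F : Finset α → Finset α → R) :
    ∑ A ∈ U.powerset.filter (fun A => w ∉ A), ∑ B ∈ (U \ A).powerset.filter (fun B => w ∈ B),
      F A B = ∑ B ∈ U.powerset.filter (fun B => w ∈ B), ∑ A ∈ (U \ B).powerset, F A B := by
  rw [Finset.sum_sigma', Finset.sum_sigma']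
  refine Finset.sum_bij' (fun x _ => (⟨x.2, x.1⟩ : (_ : Finset α) × Finset α))
    (fun x _ => (⟨x.2, x.1⟩ : (_ : Finset α) × Finset α)) ?_ ?_ (fun _ _ => rfl)
    (fun _ _ => rfl) (fun _ _ => rfl)
  · rintro ⟨A, B⟩ h
    simp only [Finset.mem_sigma, Finset.mem_filter, Finset.mem_powerset, Finset.subset_sdiff] at h ⊢
    exact ⟨⟨h.2.1.1, h.2.2⟩, h.1.1, h.2.1.2.symm⟩
  · rintro ⟨B, A⟩ h
    simp only [Finset.mem_sigma, Finset.mem_filter, Finset.mem_powerset, Finset.subset_sdiff] at h ⊢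
    exact ⟨⟨h.2.1, fun hw => Finset.disjoint_left.1 h.2.2 hw h.1.2⟩, ⟨h.1.1, h.2.2.symm⟩, h.1.2⟩

theorem moment_insert_eq_sum (Z : Finset α → R) (hZ : Z ∅ = 1) (v : α) (U : Finset α)
    (hv : v ∉ U) :
    Z (insert v U) = ∑ A ∈ U.powerset, cumulantOn Z (insert v A) * Z (U \ A) := by
  rw [moment_eq_sum_cumulantOn Z hZ (insert v U) (Finset.mem_insert_self v U)]
  symm
  refine Finset.sum_bij' (fun A _ => insert v A) (fun B _ => B.erase v) ?_ ?_ ?_ ?_ ?_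
  · intro A hA
    rw [Finset.mem_powerset] at hA
    exact Finset.mem_filter.2 ⟨Finset.mem_powerset.2 (Finset.insert_subset_insert v hA),
      Finset.mem_insert_self v A⟩
  · intro B hB
    obtain ⟨h1, h2⟩ := Finset.mem_filter.1 hB
    rw [Finset.mem_powerset] at h1 ⊢
    rwa [← Finset.subset_insert_iff]
  · intro A hA
    rw [Finset.mem_powerset] at hA
    exact Finset.erase_insert fun h => hv (hA h)
  · intro B hB
    exact Finset.insert_erase (Finset.mem_filter.1 hB).2
  · intro A hA
    rw [Finset.insert_sdiff_insert, Finset.sdiff_insert_of_notMem hv]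

/-- The recursion for the cumulants of a function of graph type. -/
theorem cumulantOn_insert (Z : Finset α → R) (hZ : Z ∅ = 1) (v : α) (ζ : R) (m : Finset α → R)
    (hm : ∀ U B : Finset α, B ⊆ U → m U = m B * m (U \ B))
    (hZv : ∀ U : Finset α, v ∉ U → Z (insert v U) = ζ * m U * Z U) (w : α) :
    ∀ (n : ℕ) (U : Finset α), U.card = n → v ∉ U → w ∈ U → cumulantOn Z (insert v U) =
      ∑ B ∈ U.powerset.filter fun B => w ∈ B,
        (m B - 1) * cumulantOn Z B * cumulantOn Z (insert v (U \ B)) := by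
  intro n
  induction n using Nat.strong_induction_on with
  | _ n ih =>
    intro U hn hv hw
    set C := cumulantOn Z with hC
    have hsub : ∀ A : Finset α, A ⊆ U → v ∉ A := fun A hA h => hv (hA h)
    have h2 : ∀ A : Finset α, A ⊆ U → ∑ A' ∈ A.powerset, C (insert v A') * Z (A \ A') =
        ζ * m A * Z A := fun A hA => by
      rw [← moment_insert_eq_sum Z hZ v A (hsub A hA), hZv A (hsub A hA)]
    -- The right-hand side is convolved with `Z`. Since `m U = m B * m (U \ B)`, the factor `m B -
    -- 1` becomes the difference `m U - m (U \ B)`.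
    have ha : ∑ A ∈ U.powerset.filter (fun A => w ∈ A),
        (∑ B ∈ A.powerset.filter (fun B => w ∈ B), (m B - 1) * C B * C (insert v (A \ B))) *
          Z (U \ A) = ∑ B ∈ U.powerset.filter (fun B => w ∈ B),
            ζ * (m U - m (U \ B)) * C B * Z (U \ B) := by
      simp only [Finset.sum_mul]
      rw [sum_nested_subsets U w fun B A D => (m B - 1) * C B * C (insert v A) * Z D]
      refine Finset.sum_congr rfl fun B hB => ?_
      have hBU := Finset.mem_powerset.1 (Finset.mem_filter.1 hB).1
      simp only [mul_assoc]
      rw [← Finset.mul_sum, ← Finset.mul_sum, h2 (U \ B) Finset.sdiff_subset, hm U B hBU]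
      ring
    have hb : ∑ A ∈ U.powerset.filter (fun A => w ∉ A), C (insert v A) * Z (U \ A) =
        ∑ B ∈ U.powerset.filter (fun B => w ∈ B), ζ * m (U \ B) * C B * Z (U \ B) := by
      have : ∀ A ∈ U.powerset.filter (fun A => w ∉ A), C (insert v A) * Z (U \ A) =
          ∑ B ∈ (U \ A).powerset.filter (fun B => w ∈ B),
            C B * (C (insert v A) * Z ((U \ B) \ A)) := fun A hA => by
        rw [moment_eq_sum_cumulantOn Z hZ (U \ A)
          (Finset.mem_sdiff.2 ⟨hw, (Finset.mem_filter.1 hA).2⟩), Finset.mul_sum]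
        refine Finset.sum_congr rfl fun B _ => ?_
        rw [sdiff_right_comm]
        ring
      rw [Finset.sum_congr rfl this,
        sum_disjoint_subsets U w fun A B => C B * (C (insert v A) * Z ((U \ B) \ A))]
      refine Finset.sum_congr rfl fun B _ => ?_
      rw [← Finset.mul_sum, h2 (U \ B) Finset.sdiff_subset]
      ring
    -- The full convolution of `A ↦ C (insert v A)` with `Z` is `ζ * m U * Z U`. Without the part `w
    -- ∉ A`, computed in `hb`, it equals the sum in `ha`.
    have hc : ∑ A ∈ U.powerset.filter (fun A => w ∈ A), C (insert v A) * Z (U \ A) =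
        ∑ A ∈ U.powerset.filter (fun A => w ∈ A),
        (∑ B ∈ A.powerset.filter (fun B => w ∈ B), (m B - 1) * C B * C (insert v (A \ B))) *
          Z (U \ A) := by
      have h3 := h2 U le_rfl
      rw [← Finset.sum_filter_add_sum_filter_not _ fun A => w ∈ A, hb,
        moment_eq_sum_cumulantOn Z hZ U hw, Finset.mul_sum] at h3
      rw [ha, eq_sub_of_add_eq h3, ← Finset.sum_sub_distrib]
      refine Finset.sum_congr rfl fun B _ => ?_
      ring
    have hU : U ∈ U.powerset.filter fun A => w ∈ A :=
      Finset.mem_filter.2 ⟨Finset.mem_powerset_self U, hw⟩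
    rw [← Finset.add_sum_erase _ _ hU, ← Finset.add_sum_erase _ _ hU, Finset.sdiff_self, hZ,
      mul_one, mul_one] at hc
    -- The terms `A ≠ U` agree by induction, so the convolution identity reduces to its term `A =
    -- U`, where `Z ∅ = 1`.
    have hrest : ∑ A ∈ (U.powerset.filter fun A => w ∈ A).erase U, C (insert v A) * Z (U \ A) =
        ∑ A ∈ (U.powerset.filter fun A => w ∈ A).erase U,
        (∑ B ∈ A.powerset.filter (fun B => w ∈ B), (m B - 1) * C B * C (insert v (A \ B))) *
          Z (U \ A) := by
      refine Finset.sum_congr rfl fun A hA => ?_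
      obtain ⟨hne, hA⟩ := Finset.mem_erase.1 hA
      obtain ⟨hAU, hwA⟩ := Finset.mem_filter.1 hA
      rw [Finset.mem_powerset] at hAU
      have hlt : A.card < n := hn ▸ Finset.card_lt_card (Finset.ssubset_iff_subset_ne.2 ⟨hAU, hne⟩)
      rw [ih A.card hlt A rfl (hsub A hAU) hwA]
    rw [hrest] at hc
    exact add_right_cancel hc

end Cumulants

/-! ### Rooted trees as parent functions -/

section ParentFunctions

set_option linter.unusedSectionVars false

/-- `x` is reached from `y` by iterating `f`. -/
def Below {α : Type*} (f : α → α) (y x : α) : Prop := ∃ n : ℕ, f^[n] y = x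

theorem Below.refl {α : Type*} (f : α → α) (x : α) : Below f x x := ⟨0, rfl⟩

theorem below_of_apply {α : Type*} {f : α → α} {y x : α} (h : Below f (f y) x) : Below f y x := by
  obtain ⟨n, hn⟩ := h
  exact ⟨n + 1, hn⟩

theorem Below.apply_of_ne {α : Type*} {f : α → α} {y x : α} (h : Below f y x) (hne : y ≠ x) :
    Below f (f y) x := by
  obtain ⟨n, hn⟩ := h
  cases n with
  | zero => exact absurd hn hne
  | succ n => exact ⟨n, hn⟩

theorem Below.trans {α : Type*} {f : α → α} {z y x : α} (h : Below f z y) (h' : Below f y x) :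
    Below f z x := by
  obtain ⟨n, rfl⟩ := h
  obtain ⟨k, rfl⟩ := h'
  exact ⟨k + n, Function.iterate_add_apply f k n z⟩

theorem Below.eq_of_fixed {α : Type*} {f : α → α} {y x : α} (h : Below f y x) (hy : f y = y) :
    y = x := by
  obtain ⟨n, hn⟩ := h
  rw [Function.iterate_fixed hy] at hn
  exact hn

theorem Below.mem_of_closed {α : Type*} {f : α → α} {y x : α} (h : Below f y x) {S : Set α}
    (hS : ∀ z ∈ S, f z ∈ S) (hy : y ∈ S) : x ∈ S := by
  obtain ⟨n, rfl⟩ := h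
  induction n generalizing y with
  | zero => exact hy
  | succ n ih => exact ih (hS y hy)

theorem Below.congr_of_closed {α : Type*} {f g : α → α} {y x : α} (h : Below f y x) {S : Set α}
    (hS : ∀ z ∈ S, f z ∈ S) (hfg : ∀ z ∈ S, g z = f z) (hy : y ∈ S) : Below g y x := by
  obtain ⟨n, rfl⟩ := h
  induction n generalizing y with
  | zero => exact Below.refl _ _
  | succ n ih =>
    refine below_of_apply ?_
    rw [hfg y hy]
    exact ih (hS y hy)

/-- Before its iterates reach the fixed point `v`, they pass through a unique preimage of `v`. -/
theorem exists_below_preimage {α : Type*} {f : α → α} {w v : α} (h : Below f w v) (hw : w ≠ v) :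
    ∃ i, i ≠ v ∧ Below f w i ∧ f i = v := by
  obtain ⟨n, hn⟩ := h
  induction n generalizing w with
  | zero => exact absurd hn hw
  | succ n ih =>
    by_cases hfw : f w = v
    · exact ⟨w, hw, Below.refl _ _, hfw⟩
    · obtain ⟨i, h1, h2, h3⟩ := ih hfw hn
      exact ⟨i, h1, below_of_apply h2, h3⟩

/-- Such an `i` is the last iterate of `w` before the fixed point `v`: the root of the branch that
contains `w`. -/
theorem below_preimage_unique {α : Type*} {f : α → α} {w v i i' : α} (hv : f v = v)
    (hi : i ≠ v) (hwi : Below f w i) (hfi : f i = v)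
    (hi' : i' ≠ v) (hwi' : Below f w i') (hfi' : f i' = v) : i = i' := by
  obtain ⟨n, hn⟩ := hwi
  induction n generalizing w with
  | zero =>
    by_contra hne
    obtain rfl : w = i := hn
    have := hwi'.apply_of_ne hne
    rw [hfi] at this
    exact hi' (this.eq_of_fixed hv).symm
  | succ n ih =>
    by_cases hw : w = i'
    · subst hw
      have h : Below f (f w) i := ⟨n, hn⟩
      rw [hfi'] at h
      exact absurd (h.eq_of_fixed hv).symm hi
    · exact ih (hwi'.apply_of_ne hw) hn

variable {α R : Type*} [Fintype α] [LinearOrder α] [CommRing R]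

/-- `f` is the parent function of a tree on `V` rooted at `v`; it fixes `v` and everything outside
of `V`. -/
structure IsParentFun (V : Finset α) (v : α) (f : α → α) : Prop where
  apply_of_notMem : ∀ x ∉ V, f x = x
  apply_root : f v = v
  apply_mem : ∀ x ∈ V, f x ∈ V
  below_root : ∀ x ∈ V, Below f x v

open Classical in
/-- The parent functions of the trees on `V` rooted at `v`. -/
def parentFuns (V : Finset α) (v : α) : Finset (α → α) :=
  Finset.univ.filter (IsParentFun V v)

theorem mem_parentFuns {V : Finset α} {v : α} {f : α → α} :
    f ∈ parentFuns V v ↔ IsParentFun V v f := by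
  simp [parentFuns]

open Classical in
/-- The contribution of the vertex `x` to the weight of a tree with vertices `V`. -/
def vertexWeight (Q : R) (G : Multigraph α) (V : Finset α) (f : α → α) (x : α) : R :=
  (∑ k ∈ Finset.range (G s(x, f x)), Q ^ k) *
    Q ^ ∑ y ∈ V.filter fun y => y < x ∧ Below f y x, G s(f x, y)

/-- The weighted number of trees on `V` rooted at `v`. -/
def treeSum (Q : R) (G : Multigraph α) (V : Finset α) (v : α) : R :=
  ∑ f ∈ parentFuns V v, ∏ x ∈ V.erase v, vertexWeight Q G V f x

/-- Hang the tree `f₁` on `B` with root `i` below the vertex `v` of the tree `f₂`. -/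
def graft (B : Finset α) (i v : α) (f₁ f₂ : α → α) (x : α) : α :=
  if x ∈ B then if x = i then v else f₁ x else f₂ x

/-! ### Grafting a branch at the root -/

section Graft

variable {U B : Finset α} {v i : α} {f₁ f₂ : α → α} (hv : v ∉ U) (hB : B ⊆ U) (hi : i ∈ B)
  (h₁ : IsParentFun B i f₁) (h₂ : IsParentFun (insert v (U \ B)) v f₂)

include hv hB h₂ in
theorem graft_apply_root : graft B i v f₁ f₂ v = v := by
  rw [graft, if_neg fun h => hv (hB h), h₂.apply_root]

include hi in
theorem graft_apply_branch : graft B i v f₁ f₂ i = v := by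
  rw [graft, if_pos hi, if_pos rfl]

theorem graft_apply_of_mem {x : α} (hx : x ∈ B) (hxi : x ≠ i) : graft B i v f₁ f₂ x = f₁ x := by
  rw [graft, if_pos hx, if_neg hxi]

theorem graft_apply_of_notMem {x : α} (hx : x ∉ B) : graft B i v f₁ f₂ x = f₂ x := by
  rw [graft, if_neg hx]

include hv hB h₂ in
theorem apply_notMem_of_notMem {x : α} (hx : x ∉ B) : f₂ x ∉ B := by
  by_cases hxV : x ∈ insert v (U \ B)
  · have := h₂.apply_mem x hxV
    intro h
    rcases Finset.mem_insert.1 this with h' | h'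
    · exact hv (hB (h' ▸ h))
    · exact (Finset.mem_sdiff.1 h').2 h
  · rwa [h₂.apply_of_notMem x hxV]

include hv hB h₂ in
theorem not_below_graft_of_notMem {x y : α} (hy : y ∉ B) (hx : x ∈ B) :
    ¬ Below (graft B i v f₁ f₂) y x := fun h => by
  refine (h.mem_of_closed (S := {z | z ∉ B}) (fun z hz => ?_) hy) hx
  rw [Set.mem_ofPred_eq, graft_apply_of_notMem hz]
  exact apply_notMem_of_notMem hv hB h₂ hz

include hv hB h₂ in
theorem below_graft_iff_of_notMem {x y : α} (hy : y ∉ B) :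
    Below (graft B i v f₁ f₂) y x ↔ Below f₂ y x := by
  have h : ∀ z ∈ {z | z ∉ B}, f₂ z ∈ {z | z ∉ B} := fun z hz => apply_notMem_of_notMem hv hB h₂ hz
  constructor
  · intro hb
    refine hb.congr_of_closed (S := {z | z ∉ B}) (fun z hz => ?_)
      (fun z hz => (graft_apply_of_notMem hz).symm) hy
    rw [graft_apply_of_notMem hz]
    exact h z hz
  · intro hb
    exact hb.congr_of_closed (S := {z | z ∉ B}) h (fun z hz => graft_apply_of_notMem hz) hy

include hv hB h₁ h₂ in
theorem below_graft_iff_of_mem {x y : α} (hy : y ∈ B) (hx : x ∈ B) :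
    Below (graft B i v f₁ f₂) y x ↔ Below f₁ y x := by
  have hvB : v ∉ B := fun h => hv (hB h)
  constructor
  · rintro ⟨n, hn⟩
    induction n generalizing y with
    | zero => exact ⟨0, hn⟩
    | succ n ih =>
      by_cases hyi : y = i
      · have h : Below (graft B i v f₁ f₂) (graft B i v f₁ f₂ y) x := ⟨n, hn⟩
        rw [hyi, graft_apply_branch (hyi ▸ hy)] at h
        exact absurd ((h.eq_of_fixed (graft_apply_root hv hB h₂)) ▸ hx) hvB
      · rw [Function.iterate_succ_apply, graft_apply_of_mem hy hyi] at hn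
        exact below_of_apply (ih (h₁.apply_mem y hy) hn)
  · rintro ⟨n, hn⟩
    induction n generalizing y with
    | zero => exact ⟨0, hn⟩
    | succ n ih =>
      by_cases hyi : y = i
      · subst hyi
        rw [Function.iterate_fixed h₁.apply_root] at hn
        exact ⟨0, hn⟩
      · refine below_of_apply ?_
        rw [graft_apply_of_mem hy hyi]
        exact ih (h₁.apply_mem y hy) hn

include h₁ in
theorem not_below_graft_of_mem {x y : α} (hy : y ∈ B) (hx : x ∉ B) (hxv : x ≠ v)
    (hgv : graft B i v f₁ f₂ v = v) : ¬ Below (graft B i v f₁ f₂) y x := by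
  rintro ⟨n, hn⟩
  induction n generalizing y with
  | zero => exact hx (hn ▸ hy)
  | succ n ih =>
    by_cases hyi : y = i
    · have h : Below (graft B i v f₁ f₂) (graft B i v f₁ f₂ y) x := ⟨n, hn⟩
      rw [hyi, graft_apply_branch (hyi ▸ hy)] at h
      exact hxv (h.eq_of_fixed hgv).symm
    · rw [Function.iterate_succ_apply, graft_apply_of_mem hy hyi] at hn
      exact ih (h₁.apply_mem y hy) hn

include hv hB hi h₁ h₂ in
theorem isParentFun_graft : IsParentFun (insert v U) v (graft B i v f₁ f₂) := by
  refine ⟨fun x hx => ?_, graft_apply_root hv hB h₂, fun x hx => ?_, fun x hx => ?_⟩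
  · rw [Finset.mem_insert, not_or] at hx
    rw [graft_apply_of_notMem fun h => hx.2 (hB h)]
    refine h₂.apply_of_notMem x fun h => ?_
    rcases Finset.mem_insert.1 h with h | h
    · exact hx.1 h
    · exact hx.2 (Finset.mem_sdiff.1 h).1
  · by_cases hxB : x ∈ B
    · by_cases hxi : x = i
      · rw [hxi, graft_apply_branch hi]
        exact Finset.mem_insert_self _ _
      · rw [graft_apply_of_mem hxB hxi]
        exact Finset.mem_insert_of_mem (hB (h₁.apply_mem x hxB))
    · rw [graft_apply_of_notMem hxB]
      refine Finset.insert_subset_insert v Finset.sdiff_subset (h₂.apply_mem x ?_)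
      rcases Finset.mem_insert.1 hx with h | h
      · exact h ▸ Finset.mem_insert_self _ _
      · exact Finset.mem_insert_of_mem (Finset.mem_sdiff.2 ⟨h, hxB⟩)
  · by_cases hxB : x ∈ B
    · refine ((below_graft_iff_of_mem hv hB h₁ h₂ hxB hi).2 (h₁.below_root x hxB)).trans ?_
      refine below_of_apply ?_
      rw [graft_apply_branch hi]
      exact Below.refl _ _
    · rw [below_graft_iff_of_notMem hv hB h₂ hxB]
      refine h₂.below_root x ?_
      rcases Finset.mem_insert.1 hx with h | h
      · exact h ▸ Finset.mem_insert_self _ _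
      · exact Finset.mem_insert_of_mem (Finset.mem_sdiff.2 ⟨h, hxB⟩)

-- Vertices other than `i` keep their parent and their descendants, hence their weight. The vertex
-- `i` now hangs below `v` and has all of `B` as descendants, which produces the new factor.
open Classical in
include hv hB hi h₁ h₂ in
theorem prod_vertexWeight_graft (Q : R) (G : Multigraph α) :
    ∏ x ∈ (insert v U).erase v, vertexWeight Q G (insert v U) (graft B i v f₁ f₂) x =
      ((∑ k ∈ Finset.range (G s(v, i)), Q ^ k) * Q ^ ∑ j ∈ B.filter (· < i), G s(v, j)) *
        (∏ x ∈ B.erase i, vertexWeight Q G B f₁ x) *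
        ∏ x ∈ (insert v (U \ B)).erase v, vertexWeight Q G (insert v (U \ B)) f₂ x := by
  have hvB : v ∉ B := fun h => hv (hB h)
  rw [Finset.erase_insert hv, Finset.erase_insert fun h => hv (Finset.mem_sdiff.1 h).1,
    ← Finset.prod_sdiff hB, mul_comm, ← Finset.mul_prod_erase B _ hi]
  have hfil : ∀ x ∈ B, ((insert v U).filter fun y => y < x ∧ Below (graft B i v f₁ f₂) y x) =
      B.filter fun y => y < x ∧ Below f₁ y x := fun x hx => by
    ext y
    simp only [Finset.mem_filter]
    by_cases hy : y ∈ B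
    · rw [below_graft_iff_of_mem hv hB h₁ h₂ hy hx]
      simp [hy, hB hy]
    · simp [hy, not_below_graft_of_notMem hv hB h₂ hy hx]
  have hfil' : ∀ x ∈ U \ B,
      ((insert v U).filter fun y => y < x ∧ Below (graft B i v f₁ f₂) y x) =
      (insert v (U \ B)).filter fun y => y < x ∧ Below f₂ y x := fun x hx => by
    obtain ⟨hxU, hxB⟩ := Finset.mem_sdiff.1 hx
    ext y
    simp only [Finset.mem_filter]
    by_cases hy : y ∈ B
    · have h3 : y ∉ insert v (U \ B) := by
        simp only [Finset.mem_insert, Finset.mem_sdiff, hy, not_true, and_false, or_false]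
        exact fun h => hvB (h ▸ hy)
      have hxv : x ≠ v := fun h => hv (h ▸ hxU)
      have h4 := not_below_graft_of_mem h₁ hy hxB hxv
        (graft_apply_root (i := i) (f₁ := f₁) hv hB h₂)
      simp [h3, h4]
    · rw [below_graft_iff_of_notMem hv hB h₂ hy]
      simp [hy]
  congr 1
  · congr 1
    · rw [vertexWeight, graft_apply_branch hi, hfil i hi, Sym2.eq_swap (a := v) (b := i)]
      congr 3
      refine Finset.filter_congr fun y hy => ?_
      exact and_iff_left (h₁.below_root y hy)
    · refine Finset.prod_congr rfl fun x hx => ?_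
      obtain ⟨hxi, hxB⟩ := Finset.mem_erase.1 hx
      rw [vertexWeight, vertexWeight, graft_apply_of_mem hxB hxi, hfil x hxB]
  · refine Finset.prod_congr rfl fun x hx => ?_
    rw [vertexWeight, vertexWeight, graft_apply_of_notMem (Finset.mem_sdiff.1 hx).2, hfil' x hx]

end Graft

/-- The grafted tree determines `i` as the child of `v` above `w`, then `B` as the set of vertices
below `i`, and then both functions. -/
theorem graft_injective {U B B' : Finset α} {v w i i' : α} {f₁ f₂ f₁' f₂' : α → α} (hv : v ∉ U)
    (hB : B ⊆ U) (hi : i ∈ B) (hw : w ∈ B) (h₁ : IsParentFun B i f₁)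
    (h₂ : IsParentFun (insert v (U \ B)) v f₂) (hB' : B' ⊆ U) (hi' : i' ∈ B') (hw' : w ∈ B')
    (h₁' : IsParentFun B' i' f₁') (h₂' : IsParentFun (insert v (U \ B')) v f₂')
    (h : graft B i v f₁ f₂ = graft B' i' v f₁' f₂') : B = B' ∧ i = i' ∧ f₁ = f₁' ∧ f₂ = f₂' := by
  have hiv : i ≠ v := fun h => hv (hB (h ▸ hi))
  have hiv' : i' ≠ v := fun h => hv (hB' (h ▸ hi'))
  have hbel : ∀ y, y ∈ B ↔ Below (graft B i v f₁ f₂) y i := fun y => by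
    by_cases hy : y ∈ B
    · simp only [hy, below_graft_iff_of_mem hv hB h₁ h₂ hy hi, h₁.below_root y hy]
    · simp only [hy, not_below_graft_of_notMem hv hB h₂ hy hi]
  have hbel' : ∀ y, y ∈ B' ↔ Below (graft B' i' v f₁' f₂') y i' := fun y => by
    by_cases hy : y ∈ B'
    · simp only [hy, below_graft_iff_of_mem hv hB' h₁' h₂' hy hi', h₁'.below_root y hy]
    · simp only [hy, not_below_graft_of_notMem hv hB' h₂' hy hi']
  have e1 : i = i' := by
    refine below_preimage_unique (graft_apply_root (i := i) (f₁ := f₁) hv hB h₂) hiv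
      ((hbel w).1 hw) (graft_apply_branch hi) hiv' ?_ ?_
    · rw [h]
      exact (hbel' w).1 hw'
    · rw [h]
      exact graft_apply_branch hi'
  subst e1
  have e2 : B = B' := by
    ext y
    rw [hbel, hbel', h]
  subst e2
  refine ⟨rfl, rfl, funext fun x => ?_, funext fun x => ?_⟩
  · by_cases hx : x ∈ B
    · by_cases hxi : x = i
      · rw [hxi, h₁.apply_root, h₁'.apply_root]
      · rw [← graft_apply_of_mem (v := v) (f₁ := f₁) (f₂ := f₂) hx hxi, h, graft_apply_of_mem hx hxi]
    · rw [h₁.apply_of_notMem x hx, h₁'.apply_of_notMem x hx]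
  · by_cases hx : x ∈ B
    · have h3 : x ∉ insert v (U \ B) := by
        simp only [Finset.mem_insert, Finset.mem_sdiff, hx, not_true, and_false, or_false]
        exact fun h => hv (hB (h ▸ hx))
      rw [h₂.apply_of_notMem x h3, h₂'.apply_of_notMem x h3]
    · rw [← graft_apply_of_notMem (i := i) (v := v) (f₁ := f₁) (f₂ := f₂) hx, h,
        graft_apply_of_notMem hx]

open Classical in
theorem exists_graft_eq {U : Finset α} {v w : α} {f : α → α} (hv : v ∉ U) (hw : w ∈ U)
    (hf : IsParentFun (insert v U) v f) : ∃ B ⊆ U, w ∈ B ∧ ∃ i ∈ B, ∃ f₁ f₂ : α → α,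
      IsParentFun B i f₁ ∧ IsParentFun (insert v (U \ B)) v f₂ ∧ graft B i v f₁ f₂ = f := by
  obtain ⟨i, hiv, hwi, hfi⟩ := exists_below_preimage
    (hf.below_root w (Finset.mem_insert_of_mem hw)) (fun h => hv (h ▸ hw))
  have hwB : w ∈ U.filter fun y => Below f y i := Finset.mem_filter.2 ⟨hw, hwi⟩
  have hiU : i ∈ U := by
    have : i ∈ (insert v U : Finset α) := hwi.mem_of_closed (S := (insert v U : Finset α))
      (fun z hz => hf.apply_mem z hz) (Finset.mem_insert_of_mem hw)
    exact (Finset.mem_insert.1 this).resolve_left hiv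
  have hvB : ¬ Below f v i := fun h => hiv (h.eq_of_fixed hf.apply_root).symm
  have hU : ∀ x ∈ U, f x ≠ v → f x ∈ U := fun x hx hne =>
    (Finset.mem_insert.1 (hf.apply_mem x (Finset.mem_insert_of_mem hx))).resolve_left hne
  set B := U.filter fun y => Below f y i with hB
  have hmem : ∀ {x}, x ∈ B ↔ x ∈ U ∧ Below f x i := Finset.mem_filter
  have hiB : i ∈ B := hmem.2 ⟨hiU, Below.refl _ _⟩
  have hstep : ∀ x ∈ B, x ≠ i → f x ∈ B := fun x hx hxi => by
    obtain ⟨h1, h2⟩ := hmem.1 hx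
    have h3 := h2.apply_of_ne hxi
    exact hmem.2 ⟨hU x h1 fun h => hvB (h ▸ h3), h3⟩
  have hcl : ∀ x ∈ insert v (U \ B), f x ∈ insert v (U \ B) := fun x hx => by
    by_cases hfx : f x = v
    · rw [hfx]
      exact Finset.mem_insert_self _ _
    · rcases Finset.mem_insert.1 hx with rfl | hx
      · exact absurd hf.apply_root hfx
      · obtain ⟨h1, h2⟩ := Finset.mem_sdiff.1 hx
        refine Finset.mem_insert_of_mem (Finset.mem_sdiff.2 ⟨hU x h1 hfx, fun h => ?_⟩)
        exact h2 (hmem.2 ⟨h1, below_of_apply (hmem.1 h).2⟩)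
  have hnB : ∀ x ∈ insert v (U \ B), x ∉ B := fun x hx => by
    rcases Finset.mem_insert.1 hx with rfl | hx
    · exact fun h => hvB (hmem.1 h).2
    · exact (Finset.mem_sdiff.1 hx).2
  refine ⟨B, Finset.filter_subset _ _, hwB, i, hiB, fun x => if x ∈ B ∧ x ≠ i then f x else x,
    fun x => if x ∈ B then x else f x, ⟨fun x hx => ?_, ?_, fun x hx => ?_, fun x hx => ?_⟩,
    ⟨fun x hx => ?_, ?_, fun x hx => ?_, fun x hx => ?_⟩, funext fun x => ?_⟩
  · exact if_neg fun h => hx h.1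
  · exact if_neg fun h => h.2 rfl
  · split_ifs with h
    · exact hstep x hx h.2
    · exact hx
  · obtain ⟨n, hn⟩ := (hmem.1 hx).2
    induction n generalizing x with
    | zero => exact ⟨0, hn⟩
    | succ n ih =>
      by_cases hxi : x = i
      · rw [hxi]
        exact Below.refl _ _
      · refine below_of_apply ?_
        rw [if_pos ⟨hx, hxi⟩]
        exact ih (f x) (hstep x hx hxi) hn
  · split_ifs with h
    · rfl
    · refine hf.apply_of_notMem x fun hx' => hx ?_
      rcases Finset.mem_insert.1 hx' with rfl | hx'
      · exact Finset.mem_insert_self _ _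
      · exact Finset.mem_insert_of_mem (Finset.mem_sdiff.2 ⟨hx', h⟩)
  · rw [if_neg (hnB v (Finset.mem_insert_self _ _)), hf.apply_root]
  · rw [if_neg (hnB x hx)]
    exact hcl x hx
  · have hx' : x ∈ insert v U := Finset.insert_subset_insert v Finset.sdiff_subset hx
    exact (hf.below_root x hx').congr_of_closed (S := (insert v (U \ B) : Finset α))
      (fun z hz => hcl z hz) (fun z hz => if_neg (hnB z hz)) hx
  · unfold graft
    by_cases hx : x ∈ B
    · by_cases hxi : x = i
      · rw [if_pos hx, if_pos hxi, hxi, hfi]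
      · rw [if_pos hx, if_neg hxi]
        exact if_pos ⟨hx, hxi⟩
    · rw [if_neg hx]
      exact if_neg hx

/-- Cutting the branch which contains `w` off the root `v`. -/
theorem treeSum_insert (Q : R) (G : Multigraph α) {U : Finset α} {v w : α} (hv : v ∉ U)
    (hw : w ∈ U) : treeSum Q G (insert v U) v = ∑ B ∈ U.powerset.filter fun B => w ∈ B, ∑ i ∈ B,
      ((∑ k ∈ Finset.range (G s(v, i)), Q ^ k) * Q ^ ∑ j ∈ B.filter (· < i), G s(v, j)) *
        treeSum Q G B i * treeSum Q G (insert v (U \ B)) v := by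
  simp only [treeSum, mul_assoc, Finset.sum_mul_sum]
  simp only [Finset.mul_sum]
  simp only [Finset.sum_sigma']
  symm
  refine Finset.sum_bij (fun x _ => graft x.1 x.2.1 v x.2.2.1 x.2.2.2) ?_ ?_ ?_ ?_
  · rintro ⟨B, i, f₁, f₂⟩ h
    simp only [Finset.mem_sigma, Finset.mem_filter, Finset.mem_powerset, mem_parentFuns] at h
    exact mem_parentFuns.2 (isParentFun_graft hv h.1.1 h.2.1 h.2.2.1 h.2.2.2)
  · rintro ⟨B, i, f₁, f₂⟩ h ⟨B', i', f₁', f₂'⟩ h' hg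
    simp only [Finset.mem_sigma, Finset.mem_filter, Finset.mem_powerset, mem_parentFuns] at h h'
    obtain ⟨rfl, rfl, rfl, rfl⟩ := graft_injective hv h.1.1 h.2.1 h.1.2 h.2.2.1 h.2.2.2
      h'.1.1 h'.2.1 h'.1.2 h'.2.2.1 h'.2.2.2 hg
    rfl
  · intro f hf
    obtain ⟨B, hB, hwB, i, hi, f₁, f₂, h₁, h₂, rfl⟩ := exists_graft_eq hv hw (mem_parentFuns.1 hf)
    refine ⟨⟨B, i, f₁, f₂⟩, ?_, rfl⟩
    simp only [Finset.mem_sigma, Finset.mem_filter, Finset.mem_powerset, mem_parentFuns]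
    exact ⟨⟨hB, hwB⟩, hi, h₁, h₂⟩
  · rintro ⟨B, i, f₁, f₂⟩ h
    simp only [Finset.mem_sigma, Finset.mem_filter, Finset.mem_powerset, mem_parentFuns] at h
    rw [prod_vertexWeight_graft hv h.1.1 h.2.1 h.2.2.1 h.2.2.2]
    ring

theorem treeSum_singleton (Q : R) (G : Multigraph α) (v : α) : treeSum Q G {v} v = 1 := by
  have : parentFuns {v} v = {id} := by
    ext f
    rw [mem_parentFuns, Finset.mem_singleton]
    constructor
    · intro h
      funext x
      by_cases hx : x = v
      · rw [hx, h.apply_root, id]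
      · exact h.apply_of_notMem x (by simpa using hx)
    · rintro rfl
      exact ⟨fun _ _ => rfl, rfl, fun _ h => h, fun x hx => ⟨0, Finset.mem_singleton.1 hx⟩⟩
  simp [treeSum, this]

/-- After multiplication by `Q - 1`, the term of `i` is the difference of the powers of `Q` with
exponents the sums of `a` over `j ≤ i` and over `j < i`. -/
theorem sum_geom_telescope (Q : R) (a : α → ℕ) (B : Finset α) :
    (Q - 1) * ∑ i ∈ B, (∑ k ∈ Finset.range (a i), Q ^ k) * Q ^ ∑ j ∈ B.filter (· < i), a j =
      Q ^ (∑ i ∈ B, a i) - 1 := by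
  induction B using Finset.induction_on_max with
  | empty => simp
  | insert m B hm ih =>
    have hmB : m ∉ B := fun h => lt_irrefl _ (hm m h)
    rw [Finset.sum_insert hmB, Finset.sum_insert hmB]
    have h1 : (insert m B).filter (· < m) = B := by
      ext j
      simp only [Finset.mem_filter, Finset.mem_insert]
      exact ⟨fun h => h.1.resolve_left h.2.ne, fun h => ⟨Or.inr h, hm j h⟩⟩
    have h2 : ∀ i ∈ B, (insert m B).filter (· < i) = B.filter (· < i) := fun i hi => by
      rw [Finset.filter_insert, if_neg (hm i hi).le.not_gt]
    have h3 : ∑ i ∈ B, (∑ k ∈ Finset.range (a i), Q ^ k) *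
        Q ^ ∑ j ∈ (insert m B).filter (· < i), a j =
        ∑ i ∈ B, (∑ k ∈ Finset.range (a i), Q ^ k) * Q ^ ∑ j ∈ B.filter (· < i), a j :=
      Finset.sum_congr rfl fun i hi => by rw [h2 i hi]
    rw [h1, h3, mul_add, ih, ← mul_assoc,
      mul_geom_sum, pow_add]
    ring

theorem sum_sym2_insert (G : Multigraph α) {v : α} {U : Finset α} (hv : v ∉ U) :
    ∑ e ∈ (insert v U).sym2, G e = G s(v, v) + ∑ j ∈ U, G s(v, j) + ∑ e ∈ U.sym2, G e := by
  rw [Finset.sym2_insert, Finset.sum_union, Finset.sum_image, Finset.sum_insert hv]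
  · intro x _ y _ h
    exact Sym2.congr_right.1 h
  · rw [Finset.disjoint_left]
    intro e he he'
    obtain ⟨b, -, rfl⟩ := Finset.mem_image.1 he
    exact hv (Finset.mk_mem_sym2_iff.1 he').1

theorem cumulantOn_singleton {β : Type*} [DecidableEq β] (Z : Finset β → R) (hZ : Z ∅ = 1) (v : β) :
    cumulantOn Z {v} = Z {v} := by
  rw [moment_eq_sum_cumulantOn Z hZ {v} (Finset.mem_singleton_self v)]
  have : ({v} : Finset β).powerset.filter (fun B => v ∈ B) = {{v}} := by
    ext B
    simp only [Finset.mem_filter, Finset.mem_powerset, Finset.mem_singleton,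
      Finset.subset_singleton_iff]
    constructor
    · rintro ⟨rfl | rfl, h⟩
      · simp at h
      · rfl
    · rintro rfl
      simp
  rw [this, Finset.sum_singleton, Finset.sdiff_self, hZ, mul_one]

/-- The cumulant of the function `B ↦ Q ^ (number of edges inside B)` counts trees. -/
theorem cumulantOn_pow_edges (Q : R) (G : Multigraph α) : ∀ (n : ℕ) (U : Finset α) (v : α),
    U.card = n → v ∉ U → cumulantOn (fun B => Q ^ ∑ e ∈ B.sym2, G e) (insert v U) =
      (Q - 1) ^ n * Q ^ (∑ x ∈ insert v U, G s(x, x)) * treeSum Q G (insert v U) v := by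
  intro n
  induction n using Nat.strong_induction_on with
  | _ n ih =>
    intro U v hn hv
    rcases U.eq_empty_or_nonempty with rfl | ⟨w, hw⟩
    · obtain rfl : n = 0 := by simpa using hn.symm
      rw [insert_empty_eq, cumulantOn_singleton _ (by simp), treeSum_singleton]
      simp [Sym2.diag]
    -- Here `m B` is `Q` to the number of edges between `v` and `B`, and the loops at `v` give `ζ`.
    · rw [cumulantOn_insert (fun B => Q ^ ∑ e ∈ B.sym2, G e) (by simp) v (Q ^ G s(v, v))
        (fun B => Q ^ ∑ j ∈ B, G s(v, j)) (fun U B hB => by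
          rw [← pow_add, add_comm, Finset.sum_sdiff hB])
        (fun U hU => by rw [sum_sym2_insert G hU, pow_add, pow_add]) w n U hn hv hw,
        treeSum_insert Q G hv hw, Finset.mul_sum]
      refine Finset.sum_congr rfl fun B hB => ?_
      obtain ⟨hBU, hwB⟩ := Finset.mem_filter.1 hB
      rw [Finset.mem_powerset] at hBU
      have hBc : 0 < B.card := Finset.card_pos.2 ⟨w, hwB⟩
      have hcard : (U \ B).card + B.card = n := by
        rw [← hn, Finset.card_sdiff_add_card_eq_card hBU]
      have hvB : v ∉ U \ B := fun h => hv (Finset.mem_sdiff.1 h).1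
      rw [ih (U \ B).card (by omega) (U \ B) v rfl hvB, ← sum_geom_telescope, Finset.mul_sum,
        Finset.sum_mul, Finset.sum_mul, Finset.mul_sum]
      refine Finset.sum_congr rfl fun i hi => ?_
      -- The cumulant of `B` has no preferred root, so each term of the telescoping sum may use
      -- trees rooted at its own `i`. This is why the induction quantifies over the root.
      have hBi := ih (B.card - 1) (by omega) (B.erase i) i (Finset.card_erase_of_mem hi)
        (Finset.notMem_erase i B)
      rw [Finset.insert_erase hi] at hBi
      rw [hBi, Finset.sum_insert hv, Finset.sum_insert hvB, ← Finset.sum_sdiff hBU, ← hcard,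
        show (U \ B).card + B.card = (U \ B).card + (B.card - 1) + 1 by omega]
      ring

end ParentFunctions

/-! ### Spanning trees and parent functions -/

section SpanningTrees

set_option linter.unusedSectionVars false

/-- If the two points differed, `x` would be periodic; a periodic point whose orbit reaches the
fixed point `v` is `v`. -/
theorem below_of_closed_pair {α : Type*} {f : α → α} {x y v : α} (hv : f v = v)
    (hxy : Below f x y) (hyx : Below f y x) (hx : Below f x v) : x = y := by
  obtain ⟨a, ha⟩ := hxy
  obtain ⟨b, hb⟩ := hyx
  obtain ⟨n, hn⟩ := hx
  by_cases ha0 : a = 0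
  · subst ha0
    exact ha
  have hper : f^[b + a] x = x := by rw [Function.iterate_add_apply, ha, hb]
  have hpern : f^[(b + a) * n] x = x := by
    rw [Function.iterate_mul, Function.iterate_fixed hper]
  have hle : n ≤ (b + a) * n := Nat.le_mul_of_pos_left n (by omega)
  have hxv : x = v := by
    rw [← Nat.sub_add_cancel hle, Function.iterate_add_apply, hn, Function.iterate_fixed hv] at hpern
    exact hpern.symm
  rw [hxv, Function.iterate_fixed hv] at ha
  rw [hxv, ha]

variable {α : Type*} [Fintype α] [LinearOrder α]

/-- The graph which joins each vertex to its parent. -/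
def parentGraph (f : α → α) : SimpleGraph α where
  Adj x y := x ≠ y ∧ (f x = y ∨ f y = x)
  symm := ⟨fun _ _ h => ⟨h.1.symm, h.2.symm⟩⟩
  loopless := ⟨fun _ h => h.1 rfl⟩

variable {f : α → α} {v : α} (hf : IsParentFun Finset.univ v f)

include hf

theorem IsParentFun.below (x : α) : Below f x v := hf.below_root x (Finset.mem_univ x)

theorem IsParentFun.apply_ne {x : α} (hx : x ≠ v) : f x ≠ x := fun h =>
  hx ((hf.below x).eq_of_fixed h)

theorem IsParentFun.antisymm {x y : α} (hxy : Below f x y) (hyx : Below f y x) : x = y :=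
  below_of_closed_pair hf.apply_root hxy hyx (hf.below x)

theorem IsParentFun.adj_apply {x : α} (hx : x ≠ v) : (parentGraph f).Adj x (f x) :=
  ⟨(hf.apply_ne hx).symm, Or.inl rfl⟩

/-- Paths in a tree are unique, so this explicit path identifies ancestors with iterates of the
parent function. -/
theorem IsParentFun.exists_path (y : α) : ∃ p : (parentGraph f).Walk y v,
    p.IsPath ∧ ∀ x, x ∈ p.support ↔ Below f y x := by
  obtain ⟨n, hn⟩ := hf.below y
  have base : ∃ p : (parentGraph f).Walk v v, p.IsPath ∧ ∀ x, x ∈ p.support ↔ Below f v x := by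
    refine ⟨SimpleGraph.Walk.nil, SimpleGraph.Walk.IsPath.nil, fun x => ?_⟩
    rw [SimpleGraph.Walk.support_nil, List.mem_singleton]
    exact ⟨fun h => h ▸ Below.refl _ _, fun h => (h.eq_of_fixed hf.apply_root).symm⟩
  induction n generalizing y with
  | zero =>
    obtain rfl : y = v := hn
    exact base
  | succ n ih =>
    by_cases hy : y = v
    · subst hy
      exact base
    · obtain ⟨p, hp, hs⟩ := ih (f y) hn
      refine ⟨SimpleGraph.Walk.cons (hf.adj_apply hy) p, ?_, fun x => ?_⟩
      · rw [SimpleGraph.Walk.cons_isPath_iff]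
        refine ⟨hp, fun h => hf.apply_ne hy ?_⟩
        exact hf.antisymm ((hs y).1 h) (below_of_apply (Below.refl _ _))
      · rw [SimpleGraph.Walk.support_cons, List.mem_cons, hs]
        constructor
        · rintro (rfl | h)
          · exact Below.refl _ _
          · exact below_of_apply h
        · intro h
          by_cases hxy : x = y
          · exact Or.inl hxy
          · exact Or.inr (h.apply_of_ne fun h => hxy h.symm)

theorem IsParentFun.injOn_edge : Set.InjOn (fun x => s(x, f x)) ((Finset.univ.erase v : Finset α) :
    Set α) := by
  intro x hx y hy h
  rcases Sym2.eq_iff.1 h with h | h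
  · exact h.1
  · refine hf.antisymm ⟨1, h.2⟩ ⟨1, h.1.symm⟩

theorem IsParentFun.edgeSet_eq : (parentGraph f).edgeSet =
    (((Finset.univ.erase v).image fun x => s(x, f x) : Finset (Sym2 α)) : Set (Sym2 α)) := by
  ext e
  induction e using Sym2.ind with
  | _ x y =>
    rw [SimpleGraph.mem_edgeSet, Finset.mem_coe, Finset.mem_image]
    constructor
    · rintro ⟨hne, h | h⟩
      · refine ⟨x, Finset.mem_erase.2 ⟨fun hx => ?_, Finset.mem_univ x⟩, by rw [h]⟩
        rw [hx, hf.apply_root] at h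
        exact hne (hx.trans h)
      · refine ⟨y, Finset.mem_erase.2 ⟨fun hy => ?_, Finset.mem_univ y⟩, by rw [h, Sym2.eq_swap]⟩
        rw [hy, hf.apply_root] at h
        exact hne (h.symm.trans hy.symm)
    · rintro ⟨z, hz, h⟩
      have h2 := hf.adj_apply (Finset.ne_of_mem_erase hz)
      rw [← SimpleGraph.mem_edgeSet] at h2
      rw [← SimpleGraph.mem_edgeSet, ← h]
      exact h2

/-- Every vertex is joined to the root, and the edges `s(x, f x)` with `x ≠ v` are distinct, one
fewer than the vertices. -/
theorem IsParentFun.isTree : (parentGraph f).IsTree := by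
  rw [SimpleGraph.isTree_iff_connected_and_card]
  constructor
  · have hr : ∀ x, (parentGraph f).Reachable x v := fun x => by
      obtain ⟨p, -⟩ := hf.exists_path x
      exact ⟨p⟩
    have : Nonempty α := ⟨v⟩
    exact ⟨fun x y => (hr x).trans (hr y).symm⟩
  · rw [hf.edgeSet_eq, Nat.card_coe_set_eq, Set.ncard_coe_finset,
      Finset.card_image_of_injOn hf.injOn_edge, Finset.card_erase_of_mem (Finset.mem_univ v),
      Finset.card_univ, Nat.card_eq_fintype_card]
    have : 0 < Fintype.card α := Fintype.card_pos_iff.2 ⟨v⟩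
    omega

theorem IsParentFun.isAncestor_iff (x y : α) :
    IsAncestor (parentGraph f) v x y ↔ x ≠ y ∧ Below f y x := by
  refine and_congr_right fun _ => ?_
  obtain ⟨p, hp, hs⟩ := hf.exists_path y
  constructor
  · rintro ⟨p', hp', hx⟩
    rw [(hf.isTree.existsUnique_path y v).unique hp' hp] at hx
    exact (hs x).1 hx
  · exact fun h => ⟨p, hp, (hs x).2 h⟩

theorem IsParentFun.isParent_iff (p x : α) :
    IsParent (parentGraph f) v p x ↔ x ≠ v ∧ p = f x := by
  rw [IsParent, hf.isAncestor_iff]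
  constructor
  · rintro ⟨⟨hne, hb⟩, -, h | h⟩
    · exact absurd (hf.antisymm ⟨1, h⟩ hb) hne
    · refine ⟨fun hx => hne ?_, h.symm⟩
      rw [hx, hf.apply_root] at h
      rw [hx, h]
  · rintro ⟨hx, rfl⟩
    exact ⟨⟨hf.apply_ne hx, below_of_apply (Below.refl _ _)⟩, (hf.adj_apply hx).symm⟩

theorem IsParentFun.eq_of_parentGraph_eq {g : α → α} (hg : IsParentFun Finset.univ v g)
    (h : parentGraph f = parentGraph g) : f = g := by
  funext x
  by_cases hx : x = v
  · rw [hx, hf.apply_root, hg.apply_root]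
  · have h1 := (hf.isParent_iff (f x) x).2 ⟨hx, rfl⟩
    rw [h, hg.isParent_iff] at h1
    exact h1.2

omit hf

/-- The parent of a vertex is a neighbour closer to `v`. The resulting tree is contained in `T` and
has as many edges, so it is `T`. -/
theorem exists_parentGraph_eq (v : α) (T : SimpleGraph α) (hT : T.IsTree) :
    ∃ f, IsParentFun Finset.univ v f ∧ parentGraph f = T := by
  have hstep : ∀ x, x ≠ v → ∃ y, T.Adj x y ∧ T.dist y v < T.dist x v := fun x hx => by
    obtain ⟨p, hp⟩ := hT.connected.exists_walk_length_eq_dist x v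
    cases p with
    | nil => exact absurd rfl hx
    | cons h p =>
      refine ⟨_, h, ?_⟩
      rw [← hp, SimpleGraph.Walk.length_cons]
      exact Nat.lt_succ_of_le (SimpleGraph.dist_le p)
  choose! g hg using hstep
  set f : α → α := fun x => if x = v then v else g x with hfdef
  have hfv : f v = v := if_pos rfl
  have hfx : ∀ x, x ≠ v → f x = g x := fun x hx => if_neg hx
  have hbelow : ∀ (n : ℕ) x, T.dist x v = n → Below f x v := by
    intro n
    induction n using Nat.strong_induction_on with
    | _ n ih =>
      intro x hx
      by_cases hxv : x = v
      · rw [hxv]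
        exact Below.refl _ _
      · refine below_of_apply (ih _ ?_ (f x) rfl)
        rw [hfx x hxv, ← hx]
        exact (hg x hxv).2
  have hf : IsParentFun Finset.univ v f :=
    ⟨fun x hx => absurd (Finset.mem_univ x) hx, hfv, fun _ _ => Finset.mem_univ _,
      fun x _ => hbelow _ x rfl⟩
  have hadj : ∀ x y, x ≠ y → f x = y → T.Adj x y := fun x y hne h => by
    by_cases hx : x = v
    · rw [hx, hfv] at h
      exact absurd (hx.trans h) hne
    · rw [hfx x hx] at h
      exact h ▸ (hg x hx).1
  have hle : parentGraph f ≤ T := by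
    rintro x y ⟨hne, h | h⟩
    · exact hadj x y hne h
    · exact (hadj y x hne.symm h).symm
  refine ⟨f, hf, ?_⟩
  classical
  have h1 := hf.isTree.card_edgeFinset
  have h2 := hT.card_edgeFinset
  exact SimpleGraph.edgeFinset_inj.1
    (Finset.eq_of_subset_of_card_le (SimpleGraph.edgeFinset_mono hle) (by omega))

open Classical in
/-- Trees may be summed over through their parent functions. -/
theorem sum_isTree_eq_sum_parentFuns {R : Type*} [CommRing R] (v : α) (F : SimpleGraph α → R) :
    ∑ T ∈ (Finset.univ : Finset (SimpleGraph α)).filter (fun T => T.IsTree), F T =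
      ∑ f ∈ parentFuns Finset.univ v, F (parentGraph f) := by
  symm
  refine Finset.sum_bij (fun f _ => parentGraph f) ?_ ?_ ?_ (fun _ _ => rfl)
  · intro f hf
    exact Finset.mem_filter.2 ⟨Finset.mem_univ _, (mem_parentFuns.1 hf).isTree⟩
  · intro f hf g hg h
    exact (mem_parentFuns.1 hf).eq_of_parentGraph_eq (mem_parentFuns.1 hg) h
  · intro T hT
    obtain ⟨f, hf, h⟩ := exists_parentGraph_eq v T (Finset.mem_filter.1 hT).2
    exact ⟨f, mem_parentFuns.2 hf, h⟩

end SpanningTrees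

/-! ### The inversion polynomial as a sum over parent functions -/

section InversionPolynomial

variable {r : ℕ} [NeZero r] {R : Type*} [CommRing R]

-- The first entry of a triple is forced to be `f x`, and the adjacency condition can be dropped
-- because a non-adjacent pair contributes zero.
open Classical in
theorem kappaStat_parentGraph (G : Multigraph (Fin r)) {f : Fin r → Fin r}
    (hf : IsParentFun Finset.univ 0 f) : kappaStat G (parentGraph f) =
      ∑ x ∈ Finset.univ.erase 0, ∑ y ∈ Finset.univ.filter fun y => y < x ∧ Below f y x,
        G s(f x, y) := by
  rw [kappaStat, Finset.sum_filter, Fintype.sum_prod_type_right, Fintype.sum_prod_type,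
    ← Finset.sum_erase (s := Finset.univ) (a := (0 : Fin r))]
  · refine Finset.sum_congr rfl fun x hx => ?_
    rw [Finset.sum_filter]
    refine Finset.sum_congr rfl fun y _ => ?_
    rw [Finset.sum_eq_single (f x)]
    · simp only [hf.isParent_iff, hf.isAncestor_iff]
      by_cases hyx : y < x
      · by_cases h0 : G s(f x, y) = 0
        · simp [h0]
        · have h3 : x ≠ y := hyx.ne'
          simp [Finset.ne_of_mem_erase hx, hyx, h3, Nat.pos_of_ne_zero h0]
      · simp [hyx]
    · intro p _ hp
      refine if_neg fun h => hp ?_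
      exact ((hf.isParent_iff p x).1 h.1).2
    · exact fun h => absurd (Finset.mem_univ _) h
  · refine Finset.sum_eq_zero fun y _ => Finset.sum_eq_zero fun p _ => if_neg fun h => ?_
    exact ((hf.isParent_iff p 0).1 h.1).1 rfl

open Classical in
theorem prod_edgeFinset_parentGraph {M : Type*} [CommMonoid M] {f : Fin r → Fin r}
    (hf : IsParentFun Finset.univ 0 f) (F : Sym2 (Fin r) → M) :
    ∏ e ∈ (parentGraph f).edgeFinset, F e = ∏ x ∈ Finset.univ.erase 0, F s(x, f x) := by
  have : (parentGraph f).edgeFinset = (Finset.univ.erase 0).image fun x => s(x, f x) := by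
    rw [← Finset.coe_inj, SimpleGraph.coe_edgeFinset, hf.edgeSet_eq]
  rw [this, Finset.prod_image hf.injOn_edge]

theorem aeval_qInt (Q : R) (n : ℕ) :
    Polynomial.aeval Q (qInt n) = ∑ k ∈ Finset.range n, Q ^ k := by
  simp [qInt]

theorem aeval_inversionPoly (Q : R) (G : Multigraph (Fin r)) :
    Polynomial.aeval Q (inversionPoly G) =
      Q ^ (∑ x, G s(x, x)) * treeSum Q G Finset.univ 0 := by
  classical
  rw [inversionPoly, map_mul, map_pow, Polynomial.aeval_X, map_sum, treeSum]
  congr 1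
  -- Trees with an edge outside `G` may be included, because their weight contains the factor `[0]_Q
  -- = 0`.
  have hsub : ∀ T ∈ (Finset.univ : Finset (SimpleGraph (Fin r))).filter (fun T => T.IsTree),
      T ∉ (Finset.univ : Finset (SimpleGraph (Fin r))).filter
        (fun T => T ≤ G.simplify ∧ T.IsTree) →
      Polynomial.aeval Q (Polynomial.X ^ kappaStat G T * ∏ e ∈ T.edgeFinset, qInt (G e)) = 0 := by
    intro T hT hT'
    have hle : ¬ T ≤ G.simplify := fun h =>
      hT' (Finset.mem_filter.2 ⟨Finset.mem_univ _, h, (Finset.mem_filter.1 hT).2⟩)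
    obtain ⟨x, y, hxy, hG⟩ : ∃ x y, T.Adj x y ∧ ¬ G.simplify.Adj x y := by
      by_contra! h
      exact hle fun x y hxy => h x y hxy
    have h0 : G s(x, y) = 0 := by
      by_contra h0
      exact hG ⟨hxy.ne, Nat.pos_of_ne_zero h0⟩
    rw [map_mul, map_prod, Finset.prod_eq_zero (i := s(x, y)), mul_zero]
    · rw [SimpleGraph.mem_edgeFinset]
      exact hxy
    · rw [h0, aeval_qInt, Finset.range_zero, Finset.sum_empty]
  have hss : (Finset.univ : Finset (SimpleGraph (Fin r))).filter
      (fun T => T ≤ G.simplify ∧ T.IsTree) ⊆ Finset.univ.filter (fun T => T.IsTree) := fun T hT =>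
    Finset.mem_filter.2 ⟨Finset.mem_univ _, (Finset.mem_filter.1 hT).2.2⟩
  have h1 := Finset.sum_subset hss hsub
  have h2 := sum_isTree_eq_sum_parentFuns (0 : Fin r) fun T =>
    Polynomial.aeval Q (Polynomial.X ^ kappaStat G T * ∏ e ∈ T.edgeFinset, qInt (G e))
  refine (Eq.trans ?_ (h1.trans h2)).trans ?_
  · refine Finset.sum_congr ?_ fun _ _ => rfl
    ext T
    simp only [Finset.mem_filter]
  refine Finset.sum_congr rfl fun f hf => ?_
  have hf := mem_parentFuns.1 hf
  rw [prod_edgeFinset_parentGraph hf, kappaStat_parentGraph G hf, map_mul, map_pow,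
    Polynomial.aeval_X, map_prod, ← Finset.prod_pow_eq_pow_sum, ← Finset.prod_mul_distrib]
  refine Finset.prod_congr rfl fun x _ => ?_
  rw [aeval_qInt, vertexWeight, mul_comm]

/-- The cumulant of `B ↦ Q ^ (number of edges of G inside B)` is, up to a power of `Q - 1`, the
`G`-inversion polynomial. -/
theorem cumulant_pow_edges (Q : R) (G : Multigraph (Fin r)) :
    cumulant (fun B : Finset (Fin r) => Q ^ ∑ e ∈ B.sym2, G e) =
      (Q - 1) ^ (r - 1) * Polynomial.aeval Q (inversionPoly G) := by
  have h := cumulantOn_pow_edges Q G (r - 1) (Finset.univ.erase 0) 0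
    (by rw [Finset.card_erase_of_mem (Finset.mem_univ _), Finset.card_univ, Fintype.card_fin])
    (Finset.notMem_erase _ _)
  rw [Finset.insert_erase (Finset.mem_univ _)] at h
  rw [cumulant_eq_cumulantOn, aeval_inversionPoly, ← mul_assoc]
  convert h

end InversionPolynomial

/-! ### Coloured columns -/

section ColoredColumns

set_option linter.unusedSectionVars false

theorem rowLen_oplus {r : ℕ} (lam : Fin r → YoungDiagram) (B : Finset (Fin r)) (i : ℕ) :
    (oplus lam B).rowLen i = ∑ b ∈ B, (lam b).rowLen i := by
  have h : ∀ j, j < (oplus lam B).rowLen i ↔ j < ∑ b ∈ B, (lam b).rowLen i := fun j => by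
    rw [← YoungDiagram.mem_iff_lt_rowLen, mem_oplus]
  exact le_antisymm (not_lt.1 fun hlt => lt_irrefl _ ((h _).1 hlt))
    (not_lt.1 fun hlt => lt_irrefl _ ((h _).2 hlt))

theorem oplus_cells_subset {r : ℕ} (lam : Fin r → YoungDiagram) (B : Finset (Fin r)) :
    (oplus lam B).cells ⊆ (total lam).cells := by
  rintro ⟨i, j⟩ h
  rw [YoungDiagram.mem_cells, mem_oplus] at h
  rw [YoungDiagram.mem_cells, total, mem_oplus]
  exact h.trans_le (Finset.sum_le_sum_of_subset (Finset.subset_univ B))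

namespace Column

variable {r : ℕ} {lam : Fin r → YoungDiagram}

theorem not_before_self (x : Column lam) : ¬ x.Before x := by
  rintro (h | ⟨-, h | ⟨-, h⟩⟩)
  · exact lt_irrefl _ h
  · exact lt_irrefl _ h
  · exact lt_irrefl _ h

theorem Before.trans {x y z : Column lam} (h : x.Before y) (h' : y.Before z) : x.Before z := by
  rcases h with h | ⟨e, h⟩
  · rcases h' with h' | ⟨e', -⟩
    · exact Or.inl (h'.trans h)
    · exact Or.inl (e' ▸ h)
  · rcases h' with h' | ⟨e', h'⟩
    · exact Or.inl (e ▸ h')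
    · refine Or.inr ⟨e.trans e', ?_⟩
      rcases h with h | ⟨f, h⟩
      · rcases h' with h' | ⟨f', -⟩
        · exact Or.inl (h.trans h')
        · exact Or.inl (f' ▸ h)
      · rcases h' with h' | ⟨f', h'⟩
        · exact Or.inl (f ▸ h')
        · exact Or.inr ⟨f.trans f', h.trans h'⟩

theorem before_or_before {x y : Column lam} (hne : x ≠ y) : x.Before y ∨ y.Before x := by
  rcases lt_trichotomy x.length y.length with h | h | h
  · exact Or.inr (Or.inl h)
  · rcases lt_trichotomy x.1 y.1 with h1 | h1 | h1
    · exact Or.inl (Or.inr ⟨h, Or.inl h1⟩)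
    · obtain ⟨b, k⟩ := x
      obtain ⟨b', k'⟩ := y
      obtain rfl : b = b' := h1
      have hk : (k : ℕ) ≠ k' := fun hk => hne (by rw [Fin.ext hk])
      rcases lt_or_gt_of_ne hk with h2 | h2
      · exact Or.inl (Or.inr ⟨h, Or.inr ⟨rfl, h2⟩⟩)
      · exact Or.inr (Or.inr ⟨h.symm, Or.inr ⟨rfl, h2⟩⟩)
    · exact Or.inr (Or.inr ⟨h.symm, Or.inl h1⟩)
  · exact Or.inl (Or.inl h)

theorem position_lt_position {x y : Column lam} (h : x.Before y) : x.position < y.position := by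
  classical
  refine Finset.card_lt_card (Finset.ssubset_iff_subset_ne.2 ⟨fun z hz => ?_, fun he => ?_⟩)
  · rw [Finset.mem_filter] at hz ⊢
    exact ⟨hz.1, hz.2.trans h⟩
  · have : x ∈ Finset.univ.filter fun z : Column lam => z.Before x := by
      rw [he]
      exact Finset.mem_filter.2 ⟨Finset.mem_univ x, h⟩
    exact not_before_self x (Finset.mem_filter.1 this).2

theorem position_injective : Function.Injective (position : Column lam → ℕ) := by
  intro x y h
  by_contra hne
  rcases before_or_before hne with h' | h'
  · exact (position_lt_position h').ne h
  · exact (position_lt_position h').ne h.symm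

theorem card_filter_length (lam : Fin r → YoungDiagram) (B : Finset (Fin r)) (i : ℕ) :
    (Finset.univ.filter fun x : Column lam => x.1 ∈ B ∧ i < x.length).card =
      ∑ b ∈ B, (lam b).rowLen i := by
  have h1 : (Finset.univ.filter fun x : Column lam => x.1 ∈ B ∧ i < x.length) =
      B.sigma fun b => Finset.univ.filter fun k : Fin ((lam b).rowLen 0) =>
        (k : ℕ) < (lam b).rowLen i := by
    ext ⟨b, k⟩
    simp only [Finset.mem_filter, Finset.mem_univ, true_and, Finset.mem_sigma, length,
      ← YoungDiagram.mem_iff_lt_colLen, ← YoungDiagram.mem_iff_lt_rowLen]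
  rw [h1, Finset.card_sigma]
  refine Finset.sum_congr rfl fun b _ => ?_
  rw [Fin.card_filter_val_lt, min_eq_right ((lam b).rowLen_anti 0 i (Nat.zero_le i))]

/-- The columns of `total lam` which meet the row `i` are those whose length exceeds `i`. -/
theorem position_lt_rowLen_iff (x : Column lam) (i : ℕ) :
    x.position < (total lam).rowLen i ↔ i < x.length := by
  classical
  rw [total, rowLen_oplus, ← card_filter_length lam Finset.univ i]
  constructor
  · intro h
    by_contra hx
    refine absurd h (not_lt.2 (Finset.card_le_card fun y hy => ?_))
    rw [Finset.mem_filter] at hy ⊢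
    exact ⟨hy.1, Or.inl ((not_lt.1 hx).trans_lt hy.2.2)⟩
  · intro h
    refine Finset.card_lt_card (Finset.ssubset_iff_subset_ne.2 ⟨fun y hy => ?_, fun he => ?_⟩)
    · rw [Finset.mem_filter] at hy ⊢
      refine ⟨hy.1, Finset.mem_univ _, ?_⟩
      rcases hy.2 with h' | ⟨h', -⟩
      · exact h.trans h'
      · rwa [h']
    · have : x ∈ Finset.univ.filter fun z : Column lam => z.Before x := by
        rw [he]
        exact Finset.mem_filter.2 ⟨Finset.mem_univ x, Finset.mem_univ _, h⟩
      exact not_before_self x (Finset.mem_filter.1 this).2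

theorem exists_position_eq {j : ℕ} (hj : j < (total lam).rowLen 0) :
    ∃ x : Column lam, x.position = j := by
  classical
  have hpos : ∀ x : Column lam, 0 < x.length := fun x => by
    have := x.2.2
    rwa [← YoungDiagram.mem_iff_lt_rowLen, YoungDiagram.mem_iff_lt_colLen] at this
  have hcard : Fintype.card (Column lam) = (total lam).rowLen 0 := by
    rw [total, rowLen_oplus, ← card_filter_length lam Finset.univ 0, ← Finset.card_univ]
    congr 1
    ext x
    simp [hpos x]
  have himg : Finset.univ.image (position : Column lam → ℕ) =
      Finset.range ((total lam).rowLen 0) := by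
    refine Finset.eq_of_subset_of_card_le (fun k hk => ?_) ?_
    · obtain ⟨x, -, rfl⟩ := Finset.mem_image.1 hk
      exact Finset.mem_range.2 ((position_lt_rowLen_iff x 0).2 (hpos x))
    · rw [Finset.card_range, Finset.card_image_of_injective _ position_injective, Finset.card_univ,
        hcard]
  have := Finset.mem_range.2 hj
  rw [← himg] at this
  obtain ⟨x, -, hx⟩ := Finset.mem_image.1 this
  exact ⟨x, hx⟩

end Column

variable {r : ℕ} [NeZero r] (lam : Fin r → YoungDiagram)

open Classical in
/-- The colour of the column of `total lam` with index `j`. -/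
def columnColor (j : ℕ) : Fin r :=
  if h : ∃ x : Column lam, x.position = j then h.choose.1 else 0

variable {lam}

theorem columnColor_position (x : Column lam) : columnColor lam x.position = x.1 := by
  have h : ∃ y : Column lam, y.position = x.position := ⟨x, rfl⟩
  rw [columnColor, dif_pos h, Column.position_injective h.choose_spec]

theorem snd_lt_of_mem_total {c : ℕ × ℕ} (hc : c ∈ (total lam).cells) :
    c.2 < (total lam).rowLen 0 := by
  have : c.2 < (total lam).rowLen c.1 := YoungDiagram.mem_iff_lt_rowLen.1 hc
  exact this.trans_le ((total lam).rowLen_anti 0 c.1 (Nat.zero_le _))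

theorem hasColor_iff {c : ℕ × ℕ} (hc : c ∈ (total lam).cells) (b : Fin r) :
    HasColor lam c b ↔ columnColor lam c.2 = b := by
  constructor
  · rintro ⟨x, rfl, h⟩
    rw [← h, columnColor_position]
  · rintro rfl
    obtain ⟨x, hx⟩ := Column.exists_position_eq (snd_lt_of_mem_total hc)
    exact ⟨x, by rw [← hx, columnColor_position], hx⟩

variable (lam)

/-- The number of boxes to the left of a box in the column `j` with colour in `B`. -/
def leftCount (B : Finset (Fin r)) (j : ℕ) : ℕ :=
  ((Finset.range j).filter fun k => columnColor lam k ∈ B).card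

theorem card_filter_columnColor (B : Finset (Fin r)) (i : ℕ) :
    ((Finset.range ((total lam).rowLen i)).filter fun j => columnColor lam j ∈ B).card =
      (oplus lam B).rowLen i := by
  rw [rowLen_oplus, ← Column.card_filter_length lam B i]
  symm
  refine Finset.card_bij (fun x _ => x.position) (fun x hx => ?_)
    (fun x _ y _ h => Column.position_injective h) fun j hj => ?_
  · obtain ⟨-, h1, h2⟩ := Finset.mem_filter.1 hx
    refine Finset.mem_filter.2 ⟨Finset.mem_range.2 ((x.position_lt_rowLen_iff i).2 h2), ?_⟩
    rwa [columnColor_position]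
  · obtain ⟨h1, h2⟩ := Finset.mem_filter.1 hj
    rw [Finset.mem_range] at h1
    obtain ⟨x, rfl⟩ := Column.exists_position_eq
      (h1.trans_le ((total lam).rowLen_anti 0 i (Nat.zero_le _)))
    rw [columnColor_position] at h2
    exact ⟨x, Finset.mem_filter.2 ⟨Finset.mem_univ _, h2, (x.position_lt_rowLen_iff i).1 h1⟩, rfl⟩

/-- The numbers `#{k ∈ A | k < j}`, for `j ∈ A`, are the ranks `0, …, #A - 1`. -/
theorem prod_range_card_eq {M : Type*} [CommMonoid M] (A : Finset ℕ) (F : ℕ → M) :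
    ∏ k ∈ Finset.range A.card, F k = ∏ j ∈ A, F (A.filter (· < j)).card := by
  induction A using Finset.induction_on_max with
  | empty => simp
  | insert m A hm ih =>
    have hmA : m ∉ A := fun h => lt_irrefl _ (hm m h)
    rw [Finset.card_insert_of_notMem hmA, Finset.prod_range_succ, ih, Finset.prod_insert hmA,
      mul_comm]
    congr 1
    · congr 2
      ext j
      simp only [Finset.mem_filter, Finset.mem_insert]
      exact ⟨fun h => ⟨Or.inr h, hm j h⟩, fun h => h.1.resolve_left h.2.ne⟩
    · refine Finset.prod_congr rfl fun j hj => ?_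
      rw [Finset.filter_insert, if_neg (hm j hj).le.not_gt]

/-- The boxes of `oplus lam B` correspond to the boxes of `total lam` with colour in `B`. -/
theorem prod_oplus_cells {M : Type*} [CommMonoid M] (B : Finset (Fin r)) (F : ℕ → ℕ → M) :
    ∏ c ∈ (oplus lam B).cells, F c.1 c.2 =
      ∏ c ∈ (total lam).cells.filter fun c => columnColor lam c.2 ∈ B,
        F c.1 (leftCount lam B c.2) := by
  have hrow : ∀ c ∈ (total lam).cells, c.1 < (total lam).colLen 0 := fun c hc => by
    have : c.1 < (total lam).colLen c.2 := YoungDiagram.mem_iff_lt_colLen.1 hc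
    exact this.trans_le ((total lam).colLen_anti 0 c.2 (Nat.zero_le _))
  rw [Finset.prod_finset_product _ (Finset.range ((total lam).colLen 0))
      (fun i => Finset.range ((oplus lam B).rowLen i)),
    Finset.prod_finset_product _ (Finset.range ((total lam).colLen 0))
      (fun i => (Finset.range ((total lam).rowLen i)).filter fun j => columnColor lam j ∈ B)]
  · refine Finset.prod_congr rfl fun i _ => ?_
    -- Row by row: the columns with colour in `B` that meet row `i` are as many as the boxes of
    -- `oplus lam B` in this row, and the rank of such a column is its `leftCount`.
    rw [← card_filter_columnColor, prod_range_card_eq]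
    refine Finset.prod_congr rfl fun j hj => ?_
    dsimp only
    congr 2
    ext k
    have hj := Finset.mem_range.1 (Finset.mem_filter.1 hj).1
    simp only [Finset.mem_filter, Finset.mem_range]
    exact ⟨fun h => ⟨h.2, h.1.2⟩, fun h => ⟨⟨h.1.trans hj, h.2⟩, h.1⟩⟩
  · rintro ⟨i, j⟩
    simp only [Finset.mem_filter, Finset.mem_range]
    rw [← YoungDiagram.mem_iff_lt_rowLen, YoungDiagram.mem_cells]
    exact ⟨fun h => ⟨hrow (i, j) h.1, h⟩, fun h => h.2⟩
  · rintro ⟨i, j⟩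
    simp only [Finset.mem_range]
    rw [← YoungDiagram.mem_iff_lt_rowLen, YoungDiagram.mem_cells]
    exact ⟨fun h => ⟨hrow (i, j) (oplus_cells_subset lam B h), h⟩, fun h => h.2⟩

/-- The edges of the graph of `S` inside `B`. -/
theorem sum_boxGraph {S : Finset (ℕ × ℕ)} (hS : S ⊆ (total lam).cells) (B : Finset (Fin r)) :
    ∑ e ∈ B.sym2, boxGraph lam S e =
      ∑ c ∈ S, if columnColor lam c.2 ∈ B then leftCount lam B c.2 else 0 := by
  classical
  have h1 : ∀ e, boxGraph lam S e = ∑ c ∈ S, ∑ k ∈ Finset.range c.2,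
      if s(columnColor lam c.2, columnColor lam k) = e then 1 else 0 := fun e => by
    rw [boxGraph, Finset.card_filter, Finset.sum_product]
    refine Finset.sum_congr rfl fun c hc => ?_
    rw [← Finset.sum_filter, ← Finset.sum_filter]
    refine Finset.sum_bij (fun d _ => d.2) ?_ ?_ ?_ fun _ _ => rfl
    · intro d hd
      obtain ⟨hd, -, hlt, a, b, ha, hb, he⟩ := Finset.mem_filter.1 hd
      rw [hasColor_iff (hS hc)] at ha
      rw [hasColor_iff hd] at hb
      exact Finset.mem_filter.2 ⟨Finset.mem_range.2 hlt, by rw [ha, hb, he]⟩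
    · intro d hd d' hd' h
      have e1 := (Finset.mem_filter.1 hd).2.1
      have e2 := (Finset.mem_filter.1 hd').2.1
      exact Prod.ext (e1.trans e2.symm) h
    · intro k hk
      obtain ⟨hk, he⟩ := Finset.mem_filter.1 hk
      rw [Finset.mem_range] at hk
      have hmem : (c.1, k) ∈ (total lam).cells :=
        (total lam).up_left_mem le_rfl hk.le ((YoungDiagram.mem_cells _).1 (hS hc))
      refine ⟨(c.1, k), Finset.mem_filter.2 ⟨hmem, rfl, hk, _, _,
        (hasColor_iff (hS hc) _).2 rfl, (hasColor_iff hmem _).2 rfl, he⟩, rfl⟩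
  simp only [h1]
  rw [Finset.sum_comm]
  refine Finset.sum_congr rfl fun c _ => ?_
  rw [Finset.sum_comm]
  simp only [Finset.sum_ite_eq, Finset.mk_mem_sym2_iff]
  split_ifs with hc
  · simp only [hc, true_and]
    rw [leftCount, Finset.card_filter]
  · simp [hc]

variable {A : Type*} [CommRing A]

/-- The product over the blocks of a set partition, expanded over the sets of boxes. -/
theorem prod_blocks_eq_sum_powerset (Q : A) (w : ℕ → A) {p : Finset (Finset (Fin r))}
    (hp : p ∈ setPartitions Finset.univ) :
    ∏ B ∈ p, ∏ c ∈ (oplus lam B).cells, (1 - w c.1 * Q ^ c.2) =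
      ∑ S ∈ (total lam).cells.powerset, (∏ c ∈ S, -w c.1) *
        ∏ B ∈ p, Q ^ ∑ e ∈ B.sym2, boxGraph lam S e := by
  classical
  have h1 : ∏ B ∈ p, ∏ c ∈ (oplus lam B).cells, (1 - w c.1 * Q ^ c.2) =
      ∏ c ∈ (total lam).cells, (1 + -w c.1 *
        ∏ B ∈ p, if columnColor lam c.2 ∈ B then Q ^ leftCount lam B c.2 else 1) := by
    have h2 : ∀ B ∈ p, ∏ c ∈ (oplus lam B).cells, (1 - w c.1 * Q ^ c.2) =
        ∏ c ∈ (total lam).cells, if columnColor lam c.2 ∈ B then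
          1 - w c.1 * Q ^ leftCount lam B c.2 else 1 := fun B _ => by
      rw [prod_oplus_cells lam B fun i k => 1 - w i * Q ^ k, Finset.prod_filter]
    rw [Finset.prod_congr rfl h2, Finset.prod_comm]
    refine Finset.prod_congr rfl fun c _ => ?_
    -- The colour of `c` lies in exactly one block, so `c` occurs in exactly one of the products.
    obtain ⟨D, hD, hcD, hu⟩ := (mem_setPartitions.1 hp).2.2 (columnColor lam c.2)
      (Finset.mem_univ _)
    rw [Finset.prod_eq_single D, Finset.prod_eq_single D, if_pos hcD, if_pos hcD]
    · ring
    · exact fun B hB hne => if_neg fun h => hne (hu B hB h)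
    · exact fun h => absurd hD h
    · exact fun B hB hne => if_neg fun h => hne (hu B hB h)
    · exact fun h => absurd hD h
  rw [h1, Finset.prod_one_add]
  refine Finset.sum_congr rfl fun S hS => ?_
  rw [Finset.prod_mul_distrib, Finset.prod_comm]
  congr 1
  refine Finset.prod_congr rfl fun B _ => ?_
  rw [sum_boxGraph lam (Finset.mem_powerset.1 hS), ← Finset.prod_pow_eq_pow_sum]
  refine Finset.prod_congr rfl fun c _ => ?_
  split_ifs <;> simp

/-- The cumulant of the products over the boxes, in terms of the inversion polynomials. -/
theorem cumulant_prod_cells (Q : A) (w : ℕ → A) :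
    cumulant (fun B : Finset (Fin r) => ∏ c ∈ (oplus lam B).cells, (1 - w c.1 * Q ^ c.2)) =
      (Q - 1) ^ (r - 1) * ∑ S ∈ (total lam).cells.powerset, (∏ c ∈ S, -w c.1) *
        Polynomial.aeval Q (inversionPoly (boxGraph lam S)) := by
  rw [cumulant_eq_cumulantOn, cumulantOn, Finset.sum_congr rfl fun p hp => by
    rw [prod_blocks_eq_sum_powerset lam Q w hp]]
  simp only [Finset.mul_sum]
  rw [Finset.sum_comm]
  refine Finset.sum_congr rfl fun S _ => ?_
  -- The weights `-w` do not depend on the set partition, so for fixed `S` what is left is the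
  -- cumulant of the edge-counting function of its graph.
  rw [mul_left_comm, ← cumulant_pow_edges, cumulant_eq_cumulantOn, cumulantOn, Finset.mul_sum]
  refine Finset.sum_congr rfl fun p _ => ?_
  ring

/-- The blocks of a set partition distribute the boxes of `total lam`. -/
theorem sum_card_oplus {p : Finset (Finset (Fin r))} (hp : p ∈ setPartitions Finset.univ) :
    ∑ B ∈ p, (oplus lam B).card = (total lam).card := by
  have h2 : ∀ B ∈ p, (oplus lam B).card =
      ∑ c ∈ (total lam).cells, if columnColor lam c.2 ∈ B then 1 else 0 := fun B _ => by
    -- Counting boxes is the additive case, obtained with values in `Multiplicative ℕ`.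
    have := prod_oplus_cells lam B fun _ _ => Multiplicative.ofAdd (1 : ℕ)
    rw [Finset.prod_const, Finset.prod_const, ← ofAdd_nsmul, ← ofAdd_nsmul] at this
    have := Multiplicative.ofAdd.injective this
    simp only [smul_eq_mul, mul_one] at this
    rw [← Finset.card_filter]
    exact this
  rw [Finset.sum_congr rfl h2, Finset.sum_comm, YoungDiagram.card, Finset.card_eq_sum_ones]
  refine Finset.sum_congr rfl fun c _ => ?_
  obtain ⟨D, hD, hcD, hu⟩ := (mem_setPartitions.1 hp).2.2 (columnColor lam c.2) (Finset.mem_univ _)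
  rw [Finset.sum_eq_single D, if_pos hcD]
  · exact fun B hB hne => if_neg fun h => hne (hu B hB h)
  · exact fun h => absurd hD h

end ColoredColumns

/-! ### The Macdonald cumulant -/

section MacdonaldCumulants

set_option linter.unusedSectionVars false

theorem map_cumulant {A B J : Type*} [CommRing A] [CommRing B] [Fintype J] [DecidableEq J]
    (φ : A →+* B) (u : Finset J → A) : φ (cumulant u) = cumulant fun D => φ (u D) := by
  simp [cumulant, map_sum, map_prod]

theorem map_eval₂_nat {A B : Type*} [CommRing A] [CommRing B] (φ : A →+* B) (a : A)
    (p : Polynomial ℕ) : φ (p.eval₂ (Nat.castRingHom A) a) = Polynomial.aeval (φ a) p := by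
  rw [Polynomial.aeval_def, Polynomial.hom_eval₂]
  congr 1
  exact Subsingleton.elim _ _

theorem q_sub_one_ne_zero : q - 1 ≠ 0 := by
  intro h
  have h1 : (MvPolynomial.X 0 : MvPolynomial (Fin 2) ℚ) = 1 := by
    refine FaithfulSMul.algebraMap_injective (MvPolynomial (Fin 2) ℚ) QT ?_
    rw [map_one]
    exact sub_eq_zero.1 h
  have h2 := congrArg (MvPolynomial.eval fun _ => (0 : ℚ)) h1
  simp at h2

theorem IsHomogeneousOfDegree.mul {a b : ℕ} {F G : Series} (hF : IsHomogeneousOfDegree a F)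
    (hG : IsHomogeneousOfDegree b G) : IsHomogeneousOfDegree (a + b) (F * G) := by
  classical
  intro m hm
  have h : (F * G) m = ∑ p ∈ Finset.HasAntidiagonal.antidiagonal m, F p.1 * G p.2 := MvPowerSeries.coeff_mul m F G
  rw [h] at hm
  obtain ⟨p, hp, hne⟩ := Finset.exists_ne_zero_of_sum_ne_zero hm
  rw [← Finset.HasAntidiagonal.mem_antidiagonal.1 hp, map_add, hF _ (left_ne_zero_of_mul hne),
    hG _ (right_ne_zero_of_mul hne)]

theorem isHomogeneousOfDegree_prod {ι : Type*} (s : Finset ι) (d : ι → ℕ) (F : ι → Series)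
    (hF : ∀ i ∈ s, IsHomogeneousOfDegree (d i) (F i)) :
    IsHomogeneousOfDegree (∑ i ∈ s, d i) (∏ i ∈ s, F i) := by
  classical
  induction s using Finset.induction_on with
  | empty =>
    intro m hm
    have h : (1 : Series) m = if m = 0 then 1 else 0 := MvPowerSeries.coeff_one m
    rw [Finset.prod_empty, h] at hm
    rw [Finset.sum_empty]
    have : m = 0 := by
      by_contra h0
      exact hm (if_neg h0)
    rw [this, map_zero]
  | insert i s hi ih =>
    rw [Finset.sum_insert hi, Finset.prod_insert hi]
    exact (hF i (Finset.mem_insert_self i s)).mul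
      (ih fun j hj => hF j (Finset.mem_insert_of_mem hj))

theorem isHomogeneousOfDegree_sum {ι : Type*} {n : ℕ} (s : Finset ι) (c : ι → QT)
    (F : ι → Series) (hF : ∀ i ∈ s, IsHomogeneousOfDegree n (F i)) :
    IsHomogeneousOfDegree n (∑ i ∈ s, c i • F i) := by
  intro m hm
  rw [series_sum_smul_apply] at hm
  obtain ⟨i, hi, hne⟩ := Finset.exists_ne_zero_of_sum_ne_zero hm
  exact hF i hi m (right_ne_zero_of_mul hne)

variable {r : ℕ} (lam : Fin r → YoungDiagram)

theorem macdonaldCumulant_eq_sum : macdonaldCumulant lam =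
    ∑ p ∈ setPartitions (Finset.univ : Finset (Fin r)),
      (((q - 1) ^ (r - 1))⁻¹ * mobiusCoeff QT p.card) • ∏ B ∈ p, macdonald (oplus lam B) := by
  rw [macdonaldCumulant, cumulant_eq_cumulantOn, cumulantOn, Finset.smul_sum]
  refine Finset.sum_congr rfl fun p _ => ?_
  rw [mul_smul]
  congr 1
  have : mobiusCoeff Series p.card = algebraMap QT Series (mobiusCoeff QT p.card) := by
    simp [mobiusCoeff]
  rw [this, Algebra.smul_def]

theorem isHomogeneousOfDegree_macdonaldCumulant [NeZero r] :
    IsHomogeneousOfDegree (total lam).card (macdonaldCumulant lam) := by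
  rw [macdonaldCumulant_eq_sum]
  refine isHomogeneousOfDegree_sum _ _ _ fun p hp => ?_
  rw [← sum_card_oplus lam hp]
  exact isHomogeneousOfDegree_prod p _ _ fun B _ => isHomogeneousOfDegree_macdonald _

variable [NeZero r]

/-- The contribution of the set of boxes `S` to the hook coefficients. -/
def boxTerm (S : Finset (ℕ × ℕ)) : QT :=
  (inversionPoly (boxGraph lam S)).eval₂ (Nat.castRingHom QT) q * t ^ ∑ c ∈ S, coleg c

theorem natPoly_boxSum (C : Finset (ℕ × ℕ)) (s : ℕ) :
    natPoly (boxSum lam C s) = ∑ S ∈ C.powersetCard s, boxTerm lam S := by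
  have hX : ∀ i, natPoly (MvPolynomial.X i) =
      algebraMap (MvPolynomial (Fin 2) ℚ) QT (MvPolynomial.X i) := fun i => by
    simp [natPoly]
  rw [boxSum, map_sum]
  refine Finset.sum_congr rfl fun S _ => ?_
  rw [map_mul, map_pow, Polynomial.aeval_def, Polynomial.hom_eval₂, hX 0, hX 1, boxTerm]
  congr 2
  exact Subsingleton.elim _ _

/-- The cumulant as a polynomial in the power sums, and its plethystic evaluation. -/
theorem exists_ofPowerSums_macdonaldCumulant : ∃ P, ofPowerSums P = macdonaldCumulant lam ∧
    plethOneSubU P = ∑ S ∈ (total lam).cells.powerset,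
      (-Polynomial.X) ^ S.card * Polynomial.C (boxTerm lam S) := by
  choose P hP using fun B : Finset (Fin r) => exists_ofPowerSums_macdonald (oplus lam B)
  refine ⟨((q - 1) ^ (r - 1))⁻¹ • cumulant P, ?_, ?_⟩
  · rw [map_smul, macdonaldCumulant]
    congr 1
    have := map_cumulant (ofPowerSums : MvPolynomial ℕ+ QT →+* Series) P
    refine Eq.trans this ?_
    congr 1
    funext B
    exact hP B
  · rw [map_smul]
    -- The evaluation passes inside the cumulant. In `cumulant_prod_cells` row `i` then has weight
    -- `u t^i`, and the factor `(q - 1)^(r - 1)` cancels the normalisation.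
    have h1 : plethOneSubU (cumulant P) = cumulant fun B => ∏ c ∈ (oplus lam B).cells,
        (1 - Polynomial.X * Polynomial.C (t ^ c.1) * (Polynomial.C q) ^ c.2) := by
      refine (map_cumulant (plethOneSubU : MvPolynomial ℕ+ QT →+* Polynomial QT) P).trans ?_
      congr 1
      funext B
      refine (plethOneSubU_of_macdonald _ _ (hP B)).trans (Finset.prod_congr rfl fun c _ => ?_)
      rw [map_mul, map_pow]
      ring
    have h2 := cumulant_prod_cells lam (Polynomial.C q)
      fun i => Polynomial.X * Polynomial.C (t ^ i)
    have h3 : (Polynomial.C q - 1 : Polynomial QT) ^ (r - 1) =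
        Polynomial.C ((q - 1) ^ (r - 1)) := by simp
    rw [h1, h2, h3, ← Polynomial.smul_eq_C_mul, smul_smul,
      inv_mul_cancel₀ (pow_ne_zero _ q_sub_one_ne_zero), one_smul]
    refine Finset.sum_congr rfl fun S _ => ?_
    have h4 : ∏ c ∈ S, -(Polynomial.X * Polynomial.C (t ^ c.1)) =
        (-Polynomial.X : Polynomial QT) ^ S.card * Polynomial.C (t ^ ∑ c ∈ S, coleg c) := by
      rw [← Finset.prod_pow_eq_pow_sum, map_prod, ← Finset.prod_const, ← Finset.prod_mul_distrib]
      refine Finset.prod_congr rfl fun c _ => ?_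
      rw [coleg]
      ring
    have h5 := map_eval₂_nat (Polynomial.C : QT →+* Polynomial QT) q (inversionPoly (boxGraph lam S))
    rw [h4, ← h5, boxTerm, mul_comm _ (t ^ _), Polynomial.C_mul, mul_assoc]

theorem coeff_neg_X_pow (k s : ℕ) :
    ((-Polynomial.X : Polynomial QT) ^ k).coeff s = if s = k then (-1) ^ k else 0 := by
  rw [neg_pow (Polynomial.X : Polynomial QT), show ((-1 : Polynomial QT)) ^ k = Polynomial.C ((-1) ^ k) by simp,
    Polynomial.coeff_C_mul_X_pow]

theorem coeff_sum_powerset (C : Finset (ℕ × ℕ)) (s : ℕ) :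
    (-1) ^ s * (∑ S ∈ C.powerset, (-Polynomial.X) ^ S.card *
      Polynomial.C (boxTerm lam S)).coeff s = natPoly (boxSum lam C s) := by
  rw [natPoly_boxSum, Polynomial.finsetSum_coeff, Finset.powersetCard_eq_filter,
    Finset.sum_filter, Finset.mul_sum]
  refine Finset.sum_congr rfl fun S _ => ?_
  rw [Polynomial.coeff_mul_C, coeff_neg_X_pow]
  by_cases h : S.card = s
  · rw [if_pos h, if_pos h.symm, h, ← mul_assoc, ← pow_add, Even.neg_one_pow ⟨s, rfl⟩, one_mul]
  · rw [if_neg h, if_neg fun h' => h h'.symm, zero_mul, mul_zero]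

/-- Nothing lies to the left of the corner box, so selecting it creates no edge. -/
theorem boxGraph_insert_corner (S : Finset (ℕ × ℕ)) :
    boxGraph lam (insert (0, 0) S) = boxGraph lam S := by
  classical
  funext e
  unfold boxGraph
  congr 1
  ext p
  simp only [Finset.mem_filter, Finset.mem_product, Finset.mem_insert]
  refine and_congr_left fun h => and_congr_left fun _ => or_iff_right fun h' => ?_
  rw [h'] at h
  exact Nat.not_lt_zero _ h.2.1

theorem boxTerm_insert_corner {S : Finset (ℕ × ℕ)} (hS : (0, 0) ∉ S) :
    boxTerm lam (insert (0, 0) S) = boxTerm lam S := by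
  rw [boxTerm, boxTerm, boxGraph_insert_corner, Finset.sum_insert hS, coleg, zero_add]

/-- Pairing `S` with `insert (0, 0) S` extracts the factor `1 - u` that all hook evaluations share.
-/
theorem sum_powerset_eq_mul (h0 : (0, 0) ∈ (total lam).cells) :
    ∑ S ∈ (total lam).cells.powerset, (-Polynomial.X) ^ S.card * Polynomial.C (boxTerm lam S) =
      (1 - Polynomial.X) * ∑ S ∈ ((total lam).cells.erase (0, 0)).powerset,
        (-Polynomial.X) ^ S.card * Polynomial.C (boxTerm lam S) := by
  conv_lhs => rw [← Finset.insert_erase h0]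
  rw [Finset.sum_powerset_insert (Finset.notMem_erase _ _), Finset.mul_sum,
    ← Finset.sum_add_distrib]
  refine Finset.sum_congr rfl fun S hS => ?_
  have hS : (0, 0) ∉ S := fun h =>
    Finset.notMem_erase _ _ (Finset.mem_powerset.1 hS h)
  rw [boxTerm_insert_corner lam hS, Finset.card_insert_of_notMem hS]
  ring

/-- The hook coefficients of a Schur expansion of the cumulant. -/
theorem schur_coeff_hook (K : YoungDiagram →₀ QT) (hK : macdonaldCumulant lam = schurSum K)
    (s : ℕ) (hs : s < (total lam).card) : K (hook (total lam).card s hs) =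
      natPoly (boxSum lam ((total lam).cells.erase (0, 0)) s) := by
  have hn : (total lam).card ≠ 0 := by omega
  have h0 : (0, 0) ∈ (total lam).cells := by
    obtain ⟨⟨i, j⟩, hc⟩ := Finset.card_pos.1 (Nat.pos_of_ne_zero hn)
    exact (total lam).up_left_mem (Nat.zero_le _) (Nat.zero_le _) ((YoungDiagram.mem_cells _).1 hc)
  -- The given expansion might involve Schur functions of other degrees. Restricting to the
  -- homogeneous part discards them without using linear independence.
  have hdeg : macdonaldCumulant lam =
      ∑ μ ∈ K.support.filter (fun μ => μ.card = (total lam).card), K μ • schur μ := by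
    funext m
    have hKm : macdonaldCumulant lam m = ∑ μ ∈ K.support, K μ * schur μ m := by
      rw [hK, schurSum, Finsupp.sum, series_sum_smul_apply]
    rw [series_sum_smul_apply]
    by_cases hm : m.degree = (total lam).card
    · rw [hKm, Finset.sum_filter]
      refine Finset.sum_congr rfl fun μ _ => ?_
      split_ifs with h
      · rfl
      · by_contra hne
        exact h ((isHomogeneousOfDegree_schur μ m (right_ne_zero_of_mul hne)).symm.trans hm)
    · rw [Finset.sum_eq_zero]
      · by_contra hne
        exact hm (isHomogeneousOfDegree_macdonaldCumulant lam m hne)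
      · intro μ hμ
        by_contra hne
        exact hm ((isHomogeneousOfDegree_schur μ m (right_ne_zero_of_mul hne)).trans
          (Finset.mem_filter.1 hμ).2)
  obtain ⟨P, hP, hpl⟩ := exists_ofPowerSums_macdonaldCumulant lam
  have h1 := plethOneSubU_of_schurSum _ hn K P (hP.trans hdeg)
  rw [hpl, sum_powerset_eq_mul lam h0] at h1
  have hX : (1 - Polynomial.X : Polynomial QT) ≠ 0 := fun h => by
    have := congrArg (Polynomial.eval 0) h
    simp at this
  have h2 := mul_left_cancel₀ hX h1
  rw [← coeff_sum_powerset, h2, Polynomial.finsetSum_coeff, Finset.sum_eq_single ⟨s, hs⟩]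
  · rw [Polynomial.coeff_C_mul, coeff_neg_X_pow, if_pos rfl, mul_left_comm, ← pow_add, Even.neg_one_pow ⟨s, rfl⟩, mul_one]
  · intro k _ hk
    rw [Polynomial.coeff_C_mul, coeff_neg_X_pow, if_neg, mul_zero]
    exact fun h => hk (Fin.ext h.symm)
  · exact fun h => absurd (Finset.mem_univ _) h

end MacdonaldCumulants

end MacdonaldCumulant

end

/-! ### Both forms of the theorem -/

theorem mainTheorem2 (r : ℕ) [NeZero r] (lam : Fin r → YoungDiagram) :
    -- the cumulant is a polynomial in the power sums, and the coefficient of `(-u)^s` in its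
    -- plethystic evaluation at `1 - u` is the sum over all `s`-subsets of boxes
    ((∃ P : MvPolynomial ℕ+ MacdonaldCumulant.QT,
        MacdonaldCumulant.ofPowerSums P = MacdonaldCumulant.macdonaldCumulant lam) ∧
      ∀ P : MvPolynomial ℕ+ MacdonaldCumulant.QT,
        MacdonaldCumulant.ofPowerSums P = MacdonaldCumulant.macdonaldCumulant lam →
        ∀ s : ℕ, (-1) ^ s * (MacdonaldCumulant.plethOneSubU P).coeff s =
          MacdonaldCumulant.natPoly
            (MacdonaldCumulant.boxSum lam (MacdonaldCumulant.total lam).cells s)) ∧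
    -- the cumulant has a Schur expansion, and the coefficient of the hook `(n - s, 1^s)` is the sum
    -- over all `s`-subsets avoiding the corner box, hence lies in `ℕ[q,t]`
    ((∃ K : YoungDiagram →₀ MacdonaldCumulant.QT,
        MacdonaldCumulant.macdonaldCumulant lam = MacdonaldCumulant.schurSum K) ∧
      ∀ K : YoungDiagram →₀ MacdonaldCumulant.QT,
        MacdonaldCumulant.macdonaldCumulant lam = MacdonaldCumulant.schurSum K →
        ∀ (s : ℕ) (hs : s < (MacdonaldCumulant.total lam).card),
          K (MacdonaldCumulant.hook (MacdonaldCumulant.total lam).card s hs) =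
              MacdonaldCumulant.natPoly
                (MacdonaldCumulant.boxSum lam ((MacdonaldCumulant.total lam).cells.erase (0, 0)) s) ∧
            K (MacdonaldCumulant.hook (MacdonaldCumulant.total lam).card s hs) ∈
              Set.range MacdonaldCumulant.natPoly) := by
  obtain ⟨P, hP, hpl⟩ := MacdonaldCumulant.exists_ofPowerSums_macdonaldCumulant lam
  refine ⟨⟨⟨P, hP⟩, fun P' hP' s => ?_⟩, ?_, fun K hK s hs => ?_⟩
  -- An arbitrary expression in the power sums evaluates like the one constructed from the Macdonald
  -- polynomials.
  · rw [MacdonaldCumulant.plethOneSubU_eq_of_ofPowerSums_eq (hP'.trans hP.symm), hpl,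
      MacdonaldCumulant.coeff_sum_powerset]
  · refine MacdonaldCumulant.exists_schurSum_eq ?_
      (MacdonaldCumulant.isHomogeneousOfDegree_macdonaldCumulant lam)
    rw [← hP]
    exact MacdonaldCumulant.isAdjSymmetric_ofPowerSums P
  · have h := MacdonaldCumulant.schur_coeff_hook lam K hK s hs
    exact ⟨h, _, h.symm⟩
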